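/- Let $V_0,\Gamma_0:\mathbb R\to\mathbb R$ be bounded, (Lebesgue) measurable, $1$-periodic functions with $\operatorname{ess\,sup}\Gamma_0>0$, and let $1<p<\infty$ and $\tau,\lambda\in\mathbb R$. Set $V(x)=V_0(x+\tau)$, $\Gamma(x)=\Gamma_0(x+\tau)$ for $x>0$ and $V(x)=V_0(x-\tau)$, $\Gamma(x)=\Gamma_0(x-\tau)$ for $x<0$, and let $L_\lambda=-\frac{d^2}{dx^2}+V-\lambda$ with domain $H^2(\mathbb R)\subset L^2(\mathbb R)$. For real functions $Q,\Gamma_*\in L^\infty(\mathbb R)$ and real-valued $u\in H^1(\mathbb R)$ put $J_{Q,\Gamma_*}[u]=\int_{\mathbb R}\big(\tfrac12(|u'|^2+Qu^2)-\tfrac1{p+1}\Gamma_*|u|^{p+1}\big)dx$ and $N_{Q,\Gamma_*}=\{u\in H^1(\mathbb R):u\neq0,\ \int_{\mathbb R}(|u'|^2+Qu^2-\Gamma_*|u|^{p+1})dx=0\}$. A strong ground state of $L_\lambda u=\Gamma|u|^{p-1}u$ is a function $w\in N_{V-\lambda,\Gamma}$ with $J_{V-\lambda,\Gamma}[w]=\inf_{N_{V-\lambda,\Gamma}}J_{V-\lambda,\Gamma}$.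 The Bloch modes of $-\frac{d^2}{dx^2}+V_0-\lambda$ are the solutions of $-u''+(V_0-\lambda)u=0$ on $\mathbb R$ of the form $u_\pm(x)=p_\pm(x)e^{\mp\kappa x}$ with $\kappa>0$ and with positive $1$-periodic $p_\pm$ normalized by $\|p_\pm\|_\infty=1$. Consider the conditions $$\text{(1)}\quad \int_{-1}^0\big(V_0(x-\tau)-V_0(x+\tau)\big)\,p_-(x+\tau)^2e^{2\kappa x}\,dx<0,$$ $$\text{(1')}\quad \int_0^1\big(V_0(x+\tau)-V_0(x-\tau)\big)\,p_+(x-\tau)^2e^{-2\kappa x}\,dx<0,$$ $$\text{(2)}\quad V_0(-\tau)\neq V_0(\tau),\ \text{ or }\ V_0(-\tau)=V_0(\tau)\text{ and }V_0'(-\tau)>V_0'(\tau).$$ (a) Assume $0<\min\sigma(L_\lambda)$. Then the energy levels $c_1=\inf_{N_{Q,\Gamma_*}}J_{Q,\Gamma_*}$ with $Q=V_0(\cdot+\tau)-\lambda$, $\Gamma_*=\Gamma_0(\cdot+\tau)$ and $c_2=\inf_{N_{Q,\Gamma_*}}J_{Q,\Gamma_*}$ with $Q=V_0(\cdot-\tau)-\lambda$,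 $\Gamma_*=\Gamma_0(\cdot-\tau)$ coincide, and if (1) or (1') holds, then $L_\lambda u=\Gamma|u|^{p-1}u$ in $\mathbb R$ has a strong ground state. (b) Assume that $V_0\in C^1(\mathbb R)$. If (2) holds for $\tau$, then there is $\lambda_0<0$, depending only on $V_0$ and $\tau$, such that for every $\lambda<\lambda_0$ the Bloch modes $u_\pm$ exist and at least one of (1), (1') holds. Moreover, there is $\tau_0>0$, depending only on $V_0$, such that (2) holds for every $\tau$ with $0<|\tau|<\tau_0$ for which either $V_0'(0)\neq0$, or $V_0'(0)=0$, $V_0$ is twice differentiable at $0$ and $\operatorname{sign}\tau\cdot V_0''(0)<0$. -/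

import Mathlib

open MeasureTheory Set
open scoped ContDiff

/-- `g` is the weak (distributional) derivative of `u` on `ℝ`: both functions are locally integrable
and `∫ φ' u = - ∫ φ g` for every test function `φ ∈ C_c^∞(ℝ)`. -/
def HasWeakDeriv {E : Type*} [NormedAddCommGroup E] [NormedSpace ℝ E] (u g : ℝ → E) : Prop :=
  LocallyIntegrable u volume ∧ LocallyIntegrable g volume ∧
    ∀ φ : ℝ → ℝ, ContDiff ℝ ∞ φ → HasCompactSupport φ →
      ∫ x, deriv φ x • u x = -∫ x, φ x • g x

/-- A representative of the weak derivative (which is unique almost everywhere), and `0` if there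
is none. -/
noncomputable def weakDeriv (u : ℝ → ℝ) : ℝ → ℝ :=
  open Classical in if h : ∃ g, HasWeakDeriv u g then h.choose else 0

/-- The real Sobolev space `H¹(ℝ)`. -/
def MemH1 (u : ℝ → ℝ) : Prop :=
  MemLp u 2 volume ∧ ∃ g, HasWeakDeriv u g ∧ MemLp g 2 volume

/-- The complex Hilbert space `L²(ℝ)`. -/
abbrev L2C : Type := Lp ℂ 2 (volume : Measure ℝ)

/-- The graph of the Schrödinger operator `L = -d²/dx² + Q` in `L²(ℝ)` with domain `H²(ℝ)`:
`u ∈ H²(ℝ)` and `L u = f`. Here `g = u'` and `h = u''`. -/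
def SchrodingerGraph (Q : ℝ → ℝ) (u f : L2C) : Prop :=
  ∃ g h : L2C, HasWeakDeriv (u : ℝ → ℂ) (g : ℝ → ℂ) ∧ HasWeakDeriv (g : ℝ → ℂ) (h : ℝ → ℂ) ∧
    ∀ᵐ x : ℝ, f x = -h x + (Q x : ℂ) * u x

/-- The resolvent set of `L = -d²/dx² + Q`: those `z` for which `L - z : H²(ℝ) → L²(ℝ)` has a
bounded everywhere defined two-sided inverse `R`. -/
def schrodingerResolventSet (Q : ℝ → ℝ) : Set ℂ :=
  {z | ∃ R : L2C →L[ℂ] L2C,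
    (∀ f : L2C, SchrodingerGraph Q (R f) (f + z • R f)) ∧
    (∀ u f : L2C, SchrodingerGraph Q u f → R (f - z • u) = u)}

/-- The spectrum of `L = -d²/dx² + Q` on `H²(ℝ) ⊂ L²(ℝ)`. -/
def schrodingerSpectrum (Q : ℝ → ℝ) : Set ℂ := (schrodingerResolventSet Q)ᶜ

/-- `0 < min σ(L)` for `L = -d²/dx² + Q`. (For bounded real `Q` the operator is self-adjoint, so its
spectrum is real.) -/
def PosMinSpectrum (Q : ℝ → ℝ) : Prop :=
  ∃ m : ℝ, IsLeast {x : ℝ | (x : ℂ) ∈ schrodingerSpectrum Q} m ∧ 0 < m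

/-- The energy `J[u] = ∫ (|u'|² + Q u²) / 2 - Γ |u|^{p+1} / (p+1)` of `-u'' + Q u = Γ |u|^{p-1} u`. -/
noncomputable def energyJ (Q Γ : ℝ → ℝ) (p : ℝ) (u : ℝ → ℝ) : ℝ :=
  ∫ x, ((1 / 2) * ((weakDeriv u x) ^ 2 + Q x * (u x) ^ 2)
    - (1 / (p + 1)) * (Γ x * |u x| ^ (p + 1)))

/-- `G[u] = ∫ |u'|² + Q u² - Γ |u|^{p+1}`. -/
noncomputable def nehariG (Q Γ : ℝ → ℝ) (p : ℝ) (u : ℝ → ℝ) : ℝ :=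
  ∫ x, ((weakDeriv u x) ^ 2 + Q x * (u x) ^ 2 - Γ x * |u x| ^ (p + 1))

/-- The Nehari manifold `N = {u ∈ H¹(ℝ) : u ≠ 0, G[u] = 0}`. -/
def nehari (Q Γ : ℝ → ℝ) (p : ℝ) : Set (ℝ → ℝ) :=
  {u | MemH1 u ∧ ¬ (∀ᵐ x : ℝ, u x = 0) ∧ nehariG Q Γ p u = 0}

/-- The infimum of the energy on the Nehari manifold. -/
noncomputable def nehariLevel (Q Γ : ℝ → ℝ) (p : ℝ) : ℝ :=
  sInf (energyJ Q Γ p '' nehari Q Γ p)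

/-- `w` is a strong ground state of `-u'' + Q u = Γ |u|^{p-1} u`: it lies on the Nehari manifold and
its energy is the minimum of the energy there. -/
def IsStrongGroundState (Q Γ : ℝ → ℝ) (p : ℝ) (w : ℝ → ℝ) : Prop :=
  w ∈ nehari Q Γ p ∧ IsLeast (energyJ Q Γ p '' nehari Q Γ p) (energyJ Q Γ p w)

/-- `u` is a (Carathéodory) solution of `-u'' + Q u = 0` on `ℝ`: it is `C¹`, its derivative is
locally absolutely continuous, and `u'' = Q u` almost everywhere. -/
def SolvesHill (Q u : ℝ → ℝ) : Prop :=
  ContDiff ℝ 1 u ∧ ∀ a b : ℝ, deriv u b - deriv u a = ∫ t in a..b, Q t * u t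

/-- `u(x) = q(x) e^{kx}` is a Bloch mode of `-d²/dx² + Q`: a solution of `-u'' + Q u = 0` with `q`
positive, `1`-periodic and normalized by `‖q‖_∞ = 1`. -/
structure IsBlochMode (Q : ℝ → ℝ) (k : ℝ) (q : ℝ → ℝ) : Prop where
  periodic : Function.Periodic q 1
  pos : ∀ x, 0 < q x
  normalized : IsLUB (Set.range q) 1
  solves : SolvesHill Q (fun x => q x * Real.exp (k * x))

/-- `p₊(x) e^{-κx}` and `p₋(x) e^{κx}`, with `κ > 0`, are the Bloch modes of `-d²/dx² + Q`. -/
structure IsBlochModePair (Q : ℝ → ℝ) (κ : ℝ) (pPlus pMinus : ℝ → ℝ) : Prop where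
  kappa_pos : 0 < κ
  plus : IsBlochMode Q (-κ) pPlus
  minus : IsBlochMode Q κ pMinus

/-- The dislocation interface built from `f`: it is `f (x + τ)` for `x > 0` and `f (x - τ)` for
`x < 0`. -/
noncomputable def dislocation (f : ℝ → ℝ) (τ : ℝ) (x : ℝ) : ℝ :=
  if 0 < x then f (x + τ) else f (x - τ)

/-- The Bloch mode condition on the period to the left of the interface. -/
def LeftBlochCondition (V₀ : ℝ → ℝ) (τ κ : ℝ) (pMinus : ℝ → ℝ) : Prop :=
  ∫ x in (-1 : ℝ)..0, (V₀ (x - τ) - V₀ (x + τ)) * (pMinus (x + τ)) ^ 2 * Real.exp (2 * κ * x) < 0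

/-- The Bloch mode condition on the period to the right of the interface. -/
def RightBlochCondition (V₀ : ℝ → ℝ) (τ κ : ℝ) (pPlus : ℝ → ℝ) : Prop :=
  ∫ x in (0 : ℝ)..1, (V₀ (x + τ) - V₀ (x - τ)) * (pPlus (x - τ)) ^ 2 * Real.exp (-2 * κ * x) < 0

/-- The pointwise condition on `V₀` at `±τ`. -/
def DislocationCondition (V₀ : ℝ → ℝ) (τ : ℝ) : Prop :=
  V₀ (-τ) ≠ V₀ τ ∨ (V₀ (-τ) = V₀ τ ∧ deriv V₀ (-τ) > deriv V₀ τ)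

/-! Put q = p + 1 and minimize the form ∫ u'² + Q u² under the constraint ∫ Γ|u|^q = 1; let S be the
infimum. On the Nehari manifold J equals (1/2 - 1/q) ∫ u'² + Q u², and scaling carries a constrained
minimizer there, so a strong ground state exists as soon as S is attained
(`IsNormalizedMinimizer.exists_isStrongGroundState`). Positivity of the spectrum enters only as
coercivity of the form on H¹ (`PosMinSpectrum.exists_coercive`): the bottom of the Rayleigh quotient
must be spectral, since a bounded resolvent there would allow the bottom to be raised.

A minimizing sequence cannot become uniformly small. Following a point where it is large, along
integer shifts, produces a nonzero weak limit, and strict concavity of t ↦ t^(2/q) forbids splitting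
of mass. Hence S is attained either by the interface problem or, with the same S, by one of the
periodic problems at ±∞ (`exists_minimizer_or_limit_minimizer`). The two periodic problems are
translates of each other by 2τ, which is also why c₁ = c₂.

The second alternative is excluded by a test function (`not_sobolevBound_of_blochMode`). Let w
minimize the periodic problem on the right. Cut w at -n, continue it to the left by the multiple of
the growing Bloch solution φ with the same value (`tailReplace`), and translate so that the junction
lies at the interface. As φ solves the linear equation, the replacement lowers the form by the form
of what was removed. Switching the potential on x < 0 changes the form by w(-n)² times a fixed
multiple of ∫_{x<0} (Q - Q₁) φ², which by quasi-periodicity has the sign of the integral in (1). The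
errors in the power term are O(|w(-n)|^q) by `exists_tail_estimate`; since q > 2 and 0 ≠ w(-n) → 0,
the quotient falls below S. Condition (1') is (1) after the reflection x ↦ -x.

For (b), the logarithmic derivative of a growing mode is a periodic solution of a Riccati equation,
so it lies between the bounds of the square root of the potential. The weight in (1) therefore
concentrates at 0⁻ as λ → -∞, where the sign of V₀(x - τ) - V₀(x + τ) decides
(`exists_leftBlochCondition`). The modes themselves come from a contraction argument for the Riccati
equation (`exists_periodic_riccati`). The claim on small τ is a first-order expansion at 0. -/

open Filter Topology

/-! ### Primitives of locally integrable functions and weak derivatives -/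

/-- `u` is a primitive of the locally integrable function `g`. -/
def IsPrimitive (u g : ℝ → ℝ) : Prop :=
  LocallyIntegrable g volume ∧ ∀ a b, u b - u a = ∫ t in a..b, g t

namespace IsPrimitive

variable {u v g h : ℝ → ℝ}

theorem locallyIntegrable_intervalIntegrable {g : ℝ → ℝ} (hg : LocallyIntegrable g volume)
    (a b : ℝ) : IntervalIntegrable g volume a b :=
  intervalIntegrable_iff.mpr <|
    (hg.integrableOn_isCompact isCompact_uIcc).mono_set uIoc_subset_uIcc

theorem intervalIntegrable (hu : IsPrimitive u g) (a b : ℝ) : IntervalIntegrable g volume a b :=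
  locallyIntegrable_intervalIntegrable hu.1 a b

theorem eq_add (hu : IsPrimitive u g) (a : ℝ) : u = fun x => u a + ∫ t in a..x, g t := by
  ext x; rw [← hu.2 a x]; ring

theorem continuous (hu : IsPrimitive u g) : Continuous u := by
  rw [hu.eq_add 0]
  exact continuous_const.add (intervalIntegral.continuous_primitive (fun a b => hu.intervalIntegrable a b) 0)

theorem absolutelyContinuousOnInterval (hu : IsPrimitive u g) (a b : ℝ) :
    AbsolutelyContinuousOnInterval u a b := by
  rw [hu.eq_add a]
  exact ((LipschitzWith.const (α := ℝ) (u a)).lipschitzOnWith (s := uIcc a b)).absolutelyContinuousOnInterval.fun_add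
    ((hu.intervalIntegrable a b).absolutelyContinuousOnInterval_intervalIntegral (by simp))

theorem ae_hasDerivAt (hu : IsPrimitive u g) : ∀ᵐ x, HasDerivAt u (g x) x := by
  filter_upwards [LocallyIntegrable.ae_hasDerivAt_integral hu.1] with x hx
  rw [hu.eq_add 0]
  exact (hx 0).const_add _

theorem deriv_ae_eq (hu : IsPrimitive u g) : deriv u =ᵐ[volume] g := by
  filter_upwards [hu.ae_hasDerivAt] with x hx using hx.deriv

/-- Integration by parts. -/
theorem integral_mul (hu : IsPrimitive u g) (hv : IsPrimitive v h) (a b : ℝ) :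
    ∫ x in a..b, (g x * v x + u x * h x) = u b * v b - u a * v a := by
  rw [← (hu.absolutelyContinuousOnInterval a b).integral_deriv_mul_eq_sub
    (hv.absolutelyContinuousOnInterval a b)]
  apply intervalIntegral.integral_congr_ae
  filter_upwards [hu.deriv_ae_eq, hv.deriv_ae_eq] with x h1 h2 _
  rw [h1, h2]

theorem of_contDiff (hu : ContDiff ℝ 1 u) : IsPrimitive u (deriv u) := by
  have hc : Continuous (deriv u) := hu.continuous_deriv le_rfl
  refine ⟨hc.locallyIntegrable, fun a b => ?_⟩
  rw [intervalIntegral.integral_deriv_eq_sub (fun x _ => (hu.differentiable one_ne_zero).differentiableAt)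
    (hc.intervalIntegrable _ _)]

theorem congr_ae (hu : IsPrimitive u g) (h' : g =ᵐ[volume] h) : IsPrimitive u h := by
  refine ⟨hu.1.congr h', fun a b => ?_⟩
  rw [hu.2]
  exact intervalIntegral.integral_congr_ae (h'.mono fun x hx _ => hx)

theorem add (hu : IsPrimitive u g) (hv : IsPrimitive v h) :
    IsPrimitive (fun x => u x + v x) (fun x => g x + h x) := by
  refine ⟨hu.1.add hv.1, fun a b => ?_⟩
  rw [intervalIntegral.integral_add (hu.intervalIntegrable a b) (hv.intervalIntegrable a b),
    ← hu.2, ← hv.2]; ring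

theorem const_mul (hu : IsPrimitive u g) (c : ℝ) :
    IsPrimitive (fun x => c * u x) (fun x => c * g x) := by
  refine ⟨hu.1.smul c, fun a b => ?_⟩
  rw [intervalIntegral.integral_const_mul, ← hu.2]; ring

theorem sub (hu : IsPrimitive u g) (hv : IsPrimitive v h) :
    IsPrimitive (fun x => u x - v x) (fun x => g x - h x) := by
  simpa [sub_eq_add_neg] using hu.add (hv.const_mul (-1))

theorem locallyIntegrable_comp_add (hg : LocallyIntegrable g volume) (s : ℝ) :
    LocallyIntegrable (fun x => g (x + s)) volume := by
  rw [locallyIntegrable_iff]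
  intro k hk
  have := (measurePreserving_add_right volume s).integrableOn_comp_preimage
    (MeasurableEquiv.addRight s).measurableEmbedding (f := g) (s := (fun x => x + s) '' k)
  have h2 := this.2 (hg.integrableOn_isCompact (hk.image (by fun_prop)))
  exact h2.mono_set (subset_preimage_image _ _)

theorem comp_add (hu : IsPrimitive u g) (s : ℝ) :
    IsPrimitive (fun x => u (x + s)) (fun x => g (x + s)) := by
  refine ⟨locallyIntegrable_comp_add hu.1 s, fun a b => ?_⟩
  rw [hu.2, intervalIntegral.integral_comp_add_right]

theorem locallyIntegrable_comp_neg (hg : LocallyIntegrable g volume) :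
    LocallyIntegrable (fun x => g (-x)) volume := by
  rw [locallyIntegrable_iff]
  intro k hk
  have := (Measure.measurePreserving_neg (volume : Measure ℝ)).integrableOn_comp_preimage
    (MeasurableEquiv.neg ℝ).measurableEmbedding (f := g) (s := (fun x => -x) '' k)
  have h2 := this.2 (hg.integrableOn_isCompact (hk.image (by fun_prop)))
  exact h2.mono_set (subset_preimage_image _ _)

theorem comp_neg (hu : IsPrimitive u g) :
    IsPrimitive (fun x => u (-x)) (fun x => -g (-x)) := by
  refine ⟨(locallyIntegrable_comp_neg hu.1).neg, fun a b => ?_⟩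
  rw [hu.2, intervalIntegral.integral_neg, intervalIntegral.integral_comp_neg,
    intervalIntegral.integral_symm]

/-- Gluing two primitives at a point where they agree. -/
theorem ite (hu : IsPrimitive u g) (hv : IsPrimitive v h) (y : ℝ) (hy : u y = v y) :
    IsPrimitive (fun x => if x < y then u x else v x) (fun x => if x < y then g x else h x) := by
  have hi : (fun x => if x < y then g x else h x) = (Iio y).piecewise g h := by
    ext x; simp [Set.piecewise]
  have hloc : LocallyIntegrable (fun x => if x < y then g x else h x) volume := by
    rw [locallyIntegrable_iff]
    intro k hk
    rw [hi]
    refine Integrable.piecewise measurableSet_Iio ?_ ?_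
    · exact (hu.1.integrableOn_isCompact hk).integrableOn
    · exact (hv.1.integrableOn_isCompact hk).integrableOn
  have key : ∀ b, (if b < y then u b else v b) - v y = ∫ t in y..b, (if t < y then g t else h t) := by
    intro b
    split_ifs with hb
    · rw [← hy, hu.2]
      apply intervalIntegral.integral_congr_ae
      filter_upwards [compl_mem_ae_iff.2 (measure_singleton y)] with t ht hm
      rw [uIoc_of_ge hb.le] at hm
      rw [if_pos (lt_of_le_of_ne hm.2 ht)]
    · rw [hv.2]
      apply intervalIntegral.integral_congr_ae
      refine Filter.Eventually.of_forall fun t hm => ?_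
      rw [uIoc_of_le (not_lt.1 hb)] at hm
      rw [if_neg (not_lt.2 hm.1.le)]
  refine ⟨hloc, fun a b => ?_⟩
  have := intervalIntegral.integral_interval_sub_left
    (locallyIntegrable_intervalIntegrable hloc y b) (locallyIntegrable_intervalIntegrable hloc y a)
  rw [← this, ← key a, ← key b]; simp

/-- A primitive of `g` has `g` as its weak derivative. -/
theorem hasWeakDeriv (hu : IsPrimitive u g) : HasWeakDeriv u g := by
  refine ⟨hu.continuous.locallyIntegrable, hu.1, fun φ hφ hs => ?_⟩
  have hφ1 : ContDiff ℝ 1 φ := hφ.of_le (by norm_cast)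
  have hp := of_contDiff hφ1
  have hsd : HasCompactSupport (deriv φ) := hs.deriv
  obtain ⟨R, hR⟩ : ∃ R : ℝ, tsupport φ ⊆ Ioo (-R) R := by
    obtain ⟨R, hR⟩ := hs.isCompact.isBounded.subset_ball 0
    refine ⟨R, hR.trans ?_⟩
    rw [Real.ball_eq_Ioo]; simp
  have hz : ∀ x, x ∉ Ioo (-R) R → φ x = 0 := fun x hx =>
    image_eq_zero_of_notMem_tsupport fun h => hx (hR h)
  have hz' : ∀ x, x ∉ Ioo (-R) R → deriv φ x = 0 := fun x hx => by
    by_contra hne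
    exact hx (hR (support_deriv_subset hne))
  have I1 : Integrable (fun x => deriv φ x * u x) :=
    ((hφ1.continuous_deriv le_rfl).mul hu.continuous).integrable_of_hasCompactSupport hsd.mul_right
  have I2 : Integrable (fun x => φ x * g x) := by
    simpa using hu.1.integrable_smul_left_of_hasCompactSupport hφ1.continuous hs
  have hsum : ∫ x, (deriv φ x * u x + φ x * g x) = 0 := by
    rw [← intervalIntegral.integral_eq_integral_of_support_subset (a := -R) (b := R),
      hp.integral_mul hu, hz R (by simp), hz (-R) (by simp)]
    · simp
    · intro x hx
      by_contra hn
      have hn' : x ∉ Ioo (-R) R := fun h => hn (Ioo_subset_Ioc_self h)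
      exact hx (by simp [hz x hn', hz' x hn'])
  rw [integral_add I1 I2] at hsum
  simp only [smul_eq_mul]
  linarith

end IsPrimitive

/-- A weak derivative determines the function up to a constant. -/
theorem HasWeakDeriv.exists_isPrimitive {u g : ℝ → ℝ} (h : HasWeakDeriv u g) :
    ∃ v, IsPrimitive v g ∧ u =ᵐ[volume] v := by
  obtain ⟨hu, hg, hφ⟩ := h
  set w : ℝ → ℝ := fun x => ∫ t in (0:ℝ)..x, g t with hw
  have hwp : IsPrimitive w g := by
    refine ⟨hg, fun a b => ?_⟩
    exact intervalIntegral.integral_interval_sub_left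
      (IsPrimitive.locallyIntegrable_intervalIntegrable hg _ _)
      (IsPrimitive.locallyIntegrable_intervalIntegrable hg _ _)
  have hwd := hwp.hasWeakDeriv.2.2
  set d : ℝ → ℝ := fun x => u x - w x with hd
  have hdl : LocallyIntegrable d volume := hu.sub hwp.continuous.locallyIntegrable
  have hd0 : ∀ φ : ℝ → ℝ, ContDiff ℝ ∞ φ → HasCompactSupport φ → ∫ x, deriv φ x * d x = 0 := by
    intro φ h1 h2
    have hc : Continuous (deriv φ) := h1.continuous_deriv (by simp)
    have i1 := hu.integrable_smul_left_of_hasCompactSupport hc h2.deriv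
    have i2 := hwp.continuous.locallyIntegrable (μ := volume) |>.integrable_smul_left_of_hasCompactSupport hc h2.deriv
    have := integral_sub i1 i2
    simp only [smul_eq_mul, ← mul_sub] at this
    rw [this]
    have e1 := hφ φ h1 h2
    have e2 := hwd φ h1 h2
    simp only [smul_eq_mul] at e1 e2
    rw [e1, e2]; ring
  -- a fixed bump function of integral one
  let ψ0 : ContDiffBump (0:ℝ) := ⟨1, 2, one_pos, one_lt_two⟩
  set ψ : ℝ → ℝ := ψ0.normed volume with hψ
  have ψi : ∫ x, ψ x = 1 := ψ0.integral_normed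
  have ψd : ContDiff ℝ ∞ ψ := ψ0.contDiff_normed
  have ψs : HasCompactSupport ψ := ψ0.hasCompactSupport_normed
  set c := ∫ x, ψ x * d x with hc
  have iψd : Integrable (fun x => ψ x * d x) := by
    simpa using hdl.integrable_smul_left_of_hasCompactSupport ψd.continuous ψs
  have hconst : ∀ᵐ x, d x - c = 0 := by
    apply ae_eq_zero_of_integral_contDiff_smul_eq_zero (hdl.sub (locallyIntegrable_const c))
    intro φ h1 h2
    have iφ : Integrable φ := h1.continuous.integrable_of_hasCompactSupport h2
    have iψ : Integrable ψ := ψd.continuous.integrable_of_hasCompactSupport ψs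
    have iφd : Integrable (fun x => φ x * d x) := by
      simpa using hdl.integrable_smul_left_of_hasCompactSupport h1.continuous h2
    set A := ∫ x, φ x with hA
    -- Subtracting `A * ψ` gives `η` mean zero, so its primitive `P` from the left has compact
    -- support and is an admissible test function; `∫ η d = 0` then says `∫ φ (d - c) = 0`.
    set η : ℝ → ℝ := fun x => φ x - A * ψ x with hη
    have ηd : ContDiff ℝ ∞ η := h1.sub (contDiff_const.mul ψd)
    have ηs : HasCompactSupport η := h2.sub (ψs.mul_left)
    have iη : Integrable η := iφ.sub (iψ.const_mul A)
    have η0 : ∫ x, η x = 0 := by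
      rw [hη, integral_sub iφ (iψ.const_mul A), integral_const_mul, ψi]; simp [hA]
    obtain ⟨R, hR⟩ : ∃ R : ℝ, tsupport η ⊆ Ioo (-R) R := by
      obtain ⟨R, hR⟩ := ηs.isCompact.isBounded.subset_ball 0
      refine ⟨R, hR.trans ?_⟩
      rw [Real.ball_eq_Ioo]; simp
    have ηz : ∀ x, x ∉ Ioo (-R) R → η x = 0 := fun x hx =>
      image_eq_zero_of_notMem_tsupport fun h => hx (hR h)
    set P : ℝ → ℝ := fun x => ∫ t in (-R)..x, η t with hP
    have Pder : ∀ x, HasDerivAt P (η x) x := fun x =>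
      intervalIntegral.integral_hasDerivAt_right (ηd.continuous.intervalIntegrable _ _)
        (ηd.continuous.stronglyMeasurableAtFilter _ _) ηd.continuous.continuousAt
    have Pdd : deriv P = η := funext fun x => (Pder x).deriv
    have Pd : ContDiff ℝ ∞ P := by
      rw [contDiff_infty_iff_deriv]
      exact ⟨fun x => (Pder x).differentiableAt, by rw [Pdd]; exact ηd⟩
    have Ps : HasCompactSupport P := by
      refine HasCompactSupport.intro (isCompact_Icc (a := -R) (b := R)) fun x hx => ?_
      by_cases h : x ≤ -R
      · rw [hP]
        simp only
        apply intervalIntegral.integral_zero_ae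
        refine Filter.Eventually.of_forall fun t ht => ηz t fun hm => ?_
        rw [uIoc_of_ge h] at ht
        exact absurd ht.2 (not_le.2 hm.1)
      · have hxR : R < x := by
          by_contra hh
          exact hx ⟨by linarith, by linarith⟩
        have : ∫ t in (-R)..x, η t = ∫ t, η t := by
          apply intervalIntegral.integral_eq_integral_of_support_subset
          intro t ht
          have : t ∈ Ioo (-R) R := by
            by_contra hn; exact ht (ηz t hn)
          exact ⟨this.1, by linarith [this.2]⟩
        rw [hP]; simp only; rw [this, η0]
    have := hd0 P Pd Ps
    rw [Pdd] at this
    have e : (fun x => η x * d x) = fun x => φ x * d x - A * (ψ x * d x) := by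
      ext x; rw [hη]; ring
    rw [e, integral_sub iφd (iψd.const_mul A), integral_const_mul, ← hc] at this
    have e2 : (fun x => φ x • (d x - c)) = fun x => φ x * d x - φ x * c := by
      ext x; simp [mul_sub]
    simp only [Pi.sub_apply]
    rw [e2, integral_sub iφd (iφ.mul_const c), integral_mul_const, ← hA]
    linarith
  refine ⟨fun x => c + w x, ?_, ?_⟩
  · refine ⟨hg, fun a b => ?_⟩
    rw [← hwp.2]; ring
  · filter_upwards [hconst] with x hx
    simp only [hd] at hx
    linarith

theorem HasWeakDeriv.ae_unique {u v g h : ℝ → ℝ} (h1 : HasWeakDeriv u g) (h2 : HasWeakDeriv v h)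
    (huv : u =ᵐ[volume] v) : g =ᵐ[volume] h := by
  refine ae_eq_of_integral_contDiff_smul_eq h1.2.1 h2.2.1 fun φ hφ hs => ?_
  have e1 := h1.2.2 φ hφ hs
  have e2 := h2.2.2 φ hφ hs
  have : ∫ x, deriv φ x • u x = ∫ x, deriv φ x • v x :=
    integral_congr_ae (huv.mono fun x hx => by simp only [hx])
  linarith

theorem HasWeakDeriv.weakDeriv_ae_eq {u g : ℝ → ℝ} (h : HasWeakDeriv u g) :
    weakDeriv u =ᵐ[volume] g := by
  have hex : ∃ g, HasWeakDeriv u g := ⟨g, h⟩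
  rw [weakDeriv, dif_pos hex]
  exact hex.choose_spec.ae_unique h .rfl

/-! ### The space H¹ through continuous representatives, with its quadratic and power functionals -/

/-- `u` is the continuous representative of an `H¹(ℝ)` function with derivative `g`. -/
structure IsH1 (u g : ℝ → ℝ) : Prop where
  prim : IsPrimitive u g
  memLp : MemLp u 2 volume
  memLp_deriv : MemLp g 2 volume

/-- A bounded measurable coefficient. -/
structure IsBoundedCoeff (Q : ℝ → ℝ) (C : ℝ) : Prop where
  aesm : AEStronglyMeasurable Q volume
  bound : ∀ x, |Q x| ≤ C

/-- The quadratic form `∫ u'² + Q u²`. -/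
noncomputable def quadForm (Q u g : ℝ → ℝ) : ℝ := ∫ x, (g x ^ 2 + Q x * u x ^ 2)

/-- The functional `∫ Γ |u|^q`. -/
noncomputable def powForm (Γ : ℝ → ℝ) (q : ℝ) (u : ℝ → ℝ) : ℝ := ∫ x, Γ x * |u x| ^ q

/-- Factor out t² from |t|^q. Power integrals are thereby controlled by a sup norm and an L² norm,
and the positive exponent q - 2 supplies every smallness gain further on. -/
theorem abs_rpow_le_mul_sq {q M t : ℝ} (hq : 2 < q) (ht : |t| ≤ M) :
    |t| ^ q ≤ M ^ (q - 2) * t ^ 2 := by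
  have h1 : |t| ^ q = |t| ^ (q - 2) * t ^ 2 := by
    rcases eq_or_ne t 0 with rfl | h0
    · simp [Real.zero_rpow (by linarith : q ≠ 0)]
    · have : 0 < |t| := abs_pos.2 h0
      rw [← sq_abs t, ← Real.rpow_natCast |t| 2, ← Real.rpow_add this]
      congr 1; norm_num
  rw [h1]
  gcongr

theorem sq_intervalIntegral_le {f : ℝ → ℝ} (x : ℝ) (hf : IntervalIntegrable f volume x (x + 1))
    (hf2 : IntervalIntegrable (fun t => f t ^ 2) volume x (x + 1)) :
    (∫ t in x..(x + 1), f t) ^ 2 ≤ ∫ t in x..(x + 1), f t ^ 2 := by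
  set c := ∫ t in x..(x + 1), f t with hc
  have h0 : 0 ≤ ∫ t in x..(x + 1), (f t ^ 2 - 2 * c * f t + c ^ 2) := by
    apply intervalIntegral.integral_nonneg (by linarith)
    intro t _; nlinarith [sq_nonneg (f t - c)]
  rw [intervalIntegral.integral_add (hf2.sub (hf.const_mul _)) (by simp),
    intervalIntegral.integral_sub hf2 (hf.const_mul _), intervalIntegral.integral_const_mul, ← hc] at h0
  simp at h0
  nlinarith

theorem tendsto_intervalIntegral_window {F : ℝ → ℝ} (hF : Integrable F) :
    Filter.Tendsto (fun x => ∫ t in x..(x + 1), F t) Filter.atTop (nhds 0) := by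
  have h1 := intervalIntegral_tendsto_integral_Ioi 0 hF.integrableOn
    (Filter.tendsto_id (α := ℝ) (x := Filter.atTop))
  have h2 := intervalIntegral_tendsto_integral_Ioi 0 hF.integrableOn
    (Filter.tendsto_atTop_add_const_right Filter.atTop (1:ℝ) Filter.tendsto_id)
  have := h2.sub h1
  rw [sub_self] at this
  refine this.congr fun x => ?_
  exact intervalIntegral.integral_interval_sub_left (hF.intervalIntegrable) (hF.intervalIntegrable)

namespace IsH1

variable {u v g h : ℝ → ℝ}

theorem integrable_sq (hu : IsH1 u g) : Integrable (fun x => u x ^ 2) := hu.memLp.integrable_sq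

theorem integrable_deriv_sq (hu : IsH1 u g) : Integrable (fun x => g x ^ 2) :=
  hu.memLp_deriv.integrable_sq

theorem continuous (hu : IsH1 u g) : Continuous u := hu.prim.continuous

theorem add (hu : IsH1 u g) (hv : IsH1 v h) :
    IsH1 (fun x => u x + v x) (fun x => g x + h x) :=
  ⟨hu.prim.add hv.prim, hu.memLp.add hv.memLp, hu.memLp_deriv.add hv.memLp_deriv⟩

theorem sub (hu : IsH1 u g) (hv : IsH1 v h) :
    IsH1 (fun x => u x - v x) (fun x => g x - h x) :=
  ⟨hu.prim.sub hv.prim, hu.memLp.sub hv.memLp, hu.memLp_deriv.sub hv.memLp_deriv⟩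

theorem const_mul (hu : IsH1 u g) (c : ℝ) :
    IsH1 (fun x => c * u x) (fun x => c * g x) :=
  ⟨hu.prim.const_mul c, hu.memLp.const_mul c, hu.memLp_deriv.const_mul c⟩

theorem comp_add (hu : IsH1 u g) (s : ℝ) : IsH1 (fun x => u (x + s)) (fun x => g (x + s)) :=
  ⟨hu.prim.comp_add s, hu.memLp.comp_measurePreserving (measurePreserving_add_right volume s),
    hu.memLp_deriv.comp_measurePreserving (measurePreserving_add_right volume s)⟩

theorem comp_neg (hu : IsH1 u g) : IsH1 (fun x => u (-x)) (fun x => -g (-x)) :=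
  ⟨hu.prim.comp_neg, hu.memLp.comp_measurePreserving (Measure.measurePreserving_neg volume),
    (hu.memLp_deriv.comp_measurePreserving (Measure.measurePreserving_neg volume)).neg⟩

/-- Integration by parts against the weight `t - x - 1`, which is 0 at the right end of the window
and -1 at the left end, so that only the value at `x` survives. -/
theorem eq_integral (hu : IsPrimitive u g) (x : ℝ) :
    u x = ∫ t in x..(x + 1), (u t + (t - x - 1) * g t) := by
  have hl : IsPrimitive (fun t => t - x - 1) (fun _ => 1) := by
    refine ⟨locallyIntegrable_const 1, fun a b => ?_⟩
    simp
  have := hl.integral_mul hu x (x + 1)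
  simp only [one_mul] at this
  rw [this]; ring

/-- A local Sobolev embedding: on the window the weight in `eq_integral` is at most 1 in modulus.
Keeping the right side local yields decay at infinity as well as a sup bound. -/
theorem sq_le_window (hu : IsH1 u g) (x : ℝ) :
    u x ^ 2 ≤ 2 * ∫ t in x..(x + 1), (u t ^ 2 + g t ^ 2) := by
  have iu := hu.continuous.intervalIntegrable (μ := volume) x (x + 1)
  have ig := hu.prim.intervalIntegrable x (x + 1)
  have ig2 := hu.integrable_deriv_sq.intervalIntegrable (a := x) (b := x + 1)
  have iu2 := hu.integrable_sq.intervalIntegrable (a := x) (b := x + 1)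
  have c1 : Continuous fun t : ℝ => t - x - 1 := by fun_prop
  have ilg := ig.continuousOn_mul (c1.continuousOn (s := uIcc x (x+1)))
  have i2 : IntervalIntegrable (fun t => (u t + (t - x - 1) * g t) ^ 2) volume x (x + 1) := by
    have e : (fun t => (u t + (t - x - 1) * g t) ^ 2)
        = fun t => u t ^ 2 + (2 * u t * (t - x - 1)) * g t + (t - x - 1) ^ 2 * g t ^ 2 := by
      ext t; ring
    rw [e]
    have c2 : Continuous fun t : ℝ => 2 * u t * (t - x - 1) := by
      have := hu.continuous; fun_prop
    have c3 : Continuous fun t : ℝ => (t - x - 1) ^ 2 := by fun_prop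
    exact (iu2.add (ig.continuousOn_mul c2.continuousOn)).add (ig2.continuousOn_mul c3.continuousOn)
  rw [← intervalIntegral.integral_const_mul]
  conv_lhs => rw [eq_integral hu.prim x]
  refine (sq_intervalIntegral_le x (iu.add ilg) i2).trans ?_
  refine intervalIntegral.integral_mono_on (by linarith) i2 ((iu2.add ig2).const_mul 2) fun t ht => ?_
  have h1 : ((t - x - 1) * g t) ^ 2 ≤ g t ^ 2 := by
    have : (t - x - 1) ^ 2 ≤ 1 := by nlinarith [ht.1, ht.2]
    rw [mul_pow]; nlinarith [sq_nonneg (g t)]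
  nlinarith [sq_nonneg (u t - (t - x - 1) * g t)]

theorem sq_le (hu : IsH1 u g) (x : ℝ) :
    u x ^ 2 ≤ 2 * ((∫ t, u t ^ 2) + ∫ t, g t ^ 2) := by
  refine (hu.sq_le_window x).trans ?_
  rw [← integral_add hu.integrable_sq hu.integrable_deriv_sq]
  gcongr
  rw [intervalIntegral.integral_of_le (by linarith)]
  exact setIntegral_le_integral (hu.integrable_sq.add hu.integrable_deriv_sq)
    (Filter.Eventually.of_forall fun t => by positivity)

theorem exists_bound (hu : IsH1 u g) : ∃ M, 0 ≤ M ∧ ∀ x, |u x| ≤ M :=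
  ⟨√(2 * ((∫ t, u t ^ 2) + ∫ t, g t ^ 2)), Real.sqrt_nonneg _,
    fun x => Real.abs_le_sqrt (hu.sq_le x)⟩

theorem tendsto_atTop (hu : IsH1 u g) : Filter.Tendsto u Filter.atTop (nhds 0) := by
  have h1 := (tendsto_intervalIntegral_window
    (hu.integrable_sq.add hu.integrable_deriv_sq)).const_mul 2
  rw [mul_zero] at h1
  have h2 : Filter.Tendsto (fun x => u x ^ 2) Filter.atTop (nhds 0) :=
    squeeze_zero (fun x => sq_nonneg _) (fun x => hu.sq_le_window x) h1
  have h3 := h2.sqrt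
  simp only [Real.sqrt_sq_eq_abs, Real.sqrt_zero] at h3
  exact (tendsto_zero_iff_abs_tendsto_zero _).2 h3

theorem tendsto_atBot (hu : IsH1 u g) : Filter.Tendsto u Filter.atBot (nhds 0) := by
  have := hu.comp_neg.tendsto_atTop.comp Filter.tendsto_neg_atBot_atTop
  simpa [Function.comp_def] using this

theorem integrable_coeff_mul_sq (hu : IsH1 u g) {Q : ℝ → ℝ} {C : ℝ} (hQ : IsBoundedCoeff Q C) :
    Integrable (fun x => Q x * u x ^ 2) :=
  hu.integrable_sq.bdd_mul hQ.aesm (Filter.Eventually.of_forall hQ.bound)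

theorem integrable_quadForm (hu : IsH1 u g) {Q : ℝ → ℝ} {C : ℝ} (hQ : IsBoundedCoeff Q C) :
    Integrable (fun x => g x ^ 2 + Q x * u x ^ 2) :=
  hu.integrable_deriv_sq.add (hu.integrable_coeff_mul_sq hQ)

theorem integrable_rpow (hu : IsH1 u g) {q : ℝ} (hq : 2 < q) :
    Integrable (fun x => |u x| ^ q) := by
  obtain ⟨M, hM0, hM⟩ := hu.exists_bound
  refine (hu.integrable_sq.const_mul (M ^ (q - 2))).mono' ?_ ?_
  · exact (hu.continuous.abs.rpow_const fun x => Or.inr (by linarith)).aestronglyMeasurable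
  · refine Filter.Eventually.of_forall fun x => ?_
    rw [Real.norm_of_nonneg (by positivity)]
    exact abs_rpow_le_mul_sq hq (hM x)

theorem integrable_powForm (hu : IsH1 u g) {q : ℝ} (hq : 2 < q) {Γ : ℝ → ℝ} {C : ℝ}
    (hΓ : IsBoundedCoeff Γ C) : Integrable (fun x => Γ x * |u x| ^ q) :=
  (hu.integrable_rpow hq).bdd_mul hΓ.aesm (Filter.Eventually.of_forall fun x => hΓ.bound x)

theorem memH1 (hu : IsH1 u g) : MemH1 u :=
  ⟨hu.memLp, g, hu.prim.hasWeakDeriv, hu.memLp_deriv⟩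

end IsH1

theorem MemH1.exists_isH1 {u : ℝ → ℝ} (hu : MemH1 u) :
    ∃ v g, IsH1 v g ∧ u =ᵐ[volume] v ∧ weakDeriv u =ᵐ[volume] g := by
  obtain ⟨hu2, g, hg, hg2⟩ := hu
  obtain ⟨v, hv, huv⟩ := hg.exists_isPrimitive
  exact ⟨v, g, ⟨hv, (memLp_congr_ae huv).1 hu2, hg2⟩, huv, hg.weakDeriv_ae_eq⟩

theorem quadForm_smul (Q u g : ℝ → ℝ) (c : ℝ) :
    quadForm Q (fun x => c * u x) (fun x => c * g x) = c ^ 2 * quadForm Q u g := by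
  rw [quadForm, quadForm, ← integral_const_mul]
  congr 1; ext x; ring

theorem powForm_smul (Γ u : ℝ → ℝ) (q c : ℝ) :
    powForm Γ q (fun x => c * u x) = |c| ^ q * powForm Γ q u := by
  rw [powForm, powForm, ← integral_const_mul]
  congr 1; ext x
  rw [abs_mul, Real.mul_rpow (abs_nonneg _) (abs_nonneg _)]; ring

theorem quadForm_comp_add (Q u g : ℝ → ℝ) (s : ℝ) :
    quadForm (fun x => Q (x + s)) (fun x => u (x + s)) (fun x => g (x + s)) = quadForm Q u g :=
  integral_add_right_eq_self (fun x => g x ^ 2 + Q x * u x ^ 2) s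

theorem powForm_comp_add (Γ u : ℝ → ℝ) (q s : ℝ) :
    powForm (fun x => Γ (x + s)) q (fun x => u (x + s)) = powForm Γ q u :=
  integral_add_right_eq_self (fun x => Γ x * |u x| ^ q) s

theorem quadForm_comp_neg (Q u g : ℝ → ℝ) :
    quadForm (fun x => Q (-x)) (fun x => u (-x)) (fun x => -g (-x)) = quadForm Q u g := by
  have := integral_neg_eq_self (fun x => g x ^ 2 + Q x * u x ^ 2) volume
  simpa [quadForm] using this

theorem powForm_comp_neg (Γ u : ℝ → ℝ) (q : ℝ) :
    powForm (fun x => Γ (-x)) q (fun x => u (-x)) = powForm Γ q u :=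
  integral_neg_eq_self (fun x => Γ x * |u x| ^ q) volume

theorem powForm_congr {Γ u v : ℝ → ℝ} {q : ℝ} (h : u =ᵐ[volume] v) :
    powForm Γ q u = powForm Γ q v :=
  integral_congr_ae (h.mono fun x hx => by simp only [hx])

theorem IsBoundedCoeff.comp_add {Q : ℝ → ℝ} {C : ℝ} (hQ : IsBoundedCoeff Q C) (s : ℝ) :
    IsBoundedCoeff (fun x => Q (x + s)) C :=
  ⟨hQ.aesm.comp_measurePreserving (measurePreserving_add_right volume s), fun _ => hQ.bound _⟩

theorem IsBoundedCoeff.comp_neg {Q : ℝ → ℝ} {C : ℝ} (hQ : IsBoundedCoeff Q C) :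
    IsBoundedCoeff (fun x => Q (-x)) C :=
  ⟨hQ.aesm.comp_measurePreserving (Measure.measurePreserving_neg volume), fun _ => hQ.bound _⟩

theorem IsBoundedCoeff.nonneg {Q : ℝ → ℝ} {C : ℝ} (hQ : IsBoundedCoeff Q C) : 0 ≤ C :=
  (abs_nonneg _).trans (hQ.bound 0)

theorem energyJ_eq {Q Γ u v g : ℝ → ℝ} {p C D : ℝ} (hp : 1 < p) (hQ : IsBoundedCoeff Q C)
    (hΓ : IsBoundedCoeff Γ D) (hv : IsH1 v g) (huv : u =ᵐ[volume] v)
    (hug : weakDeriv u =ᵐ[volume] g) :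
    energyJ Q Γ p u = 1 / 2 * quadForm Q v g - 1 / (p + 1) * powForm Γ (p + 1) v := by
  rw [energyJ, quadForm, powForm, ← integral_const_mul, ← integral_const_mul, ← integral_sub
    ((hv.integrable_quadForm hQ).const_mul _)
    ((hv.integrable_powForm (by linarith) hΓ).const_mul _)]
  refine integral_congr_ae ?_
  filter_upwards [huv, hug] with x hx hy
  rw [hx, hy]

theorem nehariG_eq {Q Γ u v g : ℝ → ℝ} {p C D : ℝ} (hp : 1 < p) (hQ : IsBoundedCoeff Q C)
    (hΓ : IsBoundedCoeff Γ D) (hv : IsH1 v g) (huv : u =ᵐ[volume] v)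
    (hug : weakDeriv u =ᵐ[volume] g) :
    nehariG Q Γ p u = quadForm Q v g - powForm Γ (p + 1) v := by
  rw [nehariG, quadForm, powForm, ← integral_sub
    (hv.integrable_quadForm hQ) (hv.integrable_powForm (by linarith) hΓ)]
  refine integral_congr_ae ?_
  filter_upwards [huv, hug] with x hx hy
  rw [hx, hy]

/-- The bilinear form `∫ u' v' + Q u v`. -/
noncomputable def bilinForm (Q u g v h : ℝ → ℝ) : ℝ := ∫ x, (g x * h x + Q x * (u x * v x))

theorem integral_add_add {f₁ f₂ f₃ : ℝ → ℝ} (h₁ : Integrable f₁) (h₂ : Integrable f₂)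
    (h₃ : Integrable f₃) :
    ∫ x, (f₁ x + f₂ x + f₃ x) = (∫ x, f₁ x) + (∫ x, f₂ x) + ∫ x, f₃ x := by
  rw [← integral_add h₁ h₂, ← integral_add (f := fun x => f₁ x + f₂ x) (h₁.add h₂) h₃]

namespace IsH1

variable {u v g h : ℝ → ℝ}

theorem integrable_mul (hu : IsH1 u g) (hv : IsH1 v h) : Integrable (fun x => u x * v x) :=
  hu.memLp.integrable_mul hv.memLp

theorem integrable_bilinForm (hu : IsH1 u g) (hv : IsH1 v h) {Q : ℝ → ℝ} {C : ℝ}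
    (hQ : IsBoundedCoeff Q C) : Integrable (fun x => g x * h x + Q x * (u x * v x)) :=
  (hu.memLp_deriv.integrable_mul hv.memLp_deriv).add
    ((hu.integrable_mul hv).bdd_mul hQ.aesm (Filter.Eventually.of_forall hQ.bound))

theorem quadForm_add (hu : IsH1 u g) (hv : IsH1 v h) {Q : ℝ → ℝ} {C : ℝ}
    (hQ : IsBoundedCoeff Q C) :
    quadForm Q (fun x => u x + v x) (fun x => g x + h x)
      = quadForm Q u g + 2 * bilinForm Q u g v h + quadForm Q v h := by
  rw [quadForm, quadForm, quadForm, bilinForm, ← integral_const_mul, ← integral_add_add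
    (hu.integrable_quadForm hQ) ((hu.integrable_bilinForm hv hQ).const_mul 2)
    (hv.integrable_quadForm hQ)]
  congr 1; ext x; ring

theorem integral_sq_add_quadForm (hu : IsH1 u g) {Q : ℝ → ℝ} {C : ℝ}
    (hQ : IsBoundedCoeff Q C) : (∫ x, g x ^ 2) - C * (∫ x, u x ^ 2) ≤ quadForm Q u g := by
  rw [quadForm, ← integral_const_mul, ← integral_sub hu.integrable_deriv_sq
    (hu.integrable_sq.const_mul C)]
  refine integral_mono (hu.integrable_deriv_sq.sub (hu.integrable_sq.const_mul C))
    (hu.integrable_quadForm hQ) fun x => ?_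
  have := (abs_le.1 (hQ.bound x)).1
  simp only
  nlinarith [mul_le_mul_of_nonneg_right this (sq_nonneg (u x))]

/-- Integration by parts on the line. -/
theorem integral_mul_deriv_eq_zero (hu : IsH1 u g) (hv : IsH1 v h) :
    ∫ x, (g x * v x + u x * h x) = 0 := by
  have hi : Integrable (fun x => g x * v x + u x * h x) :=
    (hu.memLp_deriv.integrable_mul hv.memLp).add (hu.memLp.integrable_mul hv.memLp_deriv)
  have h1 := intervalIntegral_tendsto_integral hi Filter.tendsto_neg_atTop_atBot
    (Filter.tendsto_id (α := ℝ) (x := Filter.atTop))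
  refine tendsto_nhds_unique h1 ?_
  simp only [hu.prim.integral_mul hv.prim, id]
  have a := hu.tendsto_atTop.mul hv.tendsto_atTop
  have b := (hu.tendsto_atBot.mul hv.tendsto_atBot).comp Filter.tendsto_neg_atTop_atBot
  simpa [Function.comp_def] using a.sub b

end IsH1

/-! ### From the spectrum to coercivity of the form -/

theorem HasWeakDeriv.re {u g : ℝ → ℂ} (h : HasWeakDeriv u g) :
    HasWeakDeriv (fun x => (u x).re) (fun x => (g x).re) := by
  have hre : ∀ {f : ℝ → ℂ}, LocallyIntegrable f volume →
      LocallyIntegrable (fun x => (f x).re) volume := by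
    intro f hf
    rw [locallyIntegrable_iff] at hf ⊢
    exact fun k hk => (@hf k hk).re
  refine ⟨hre h.1, hre h.2.1, fun φ hφ hs => ?_⟩
  have key : ∀ {f : ℝ → ℂ} {η : ℝ → ℝ}, LocallyIntegrable f volume → Continuous η →
      HasCompactSupport η → ∫ x, η x • (f x).re = (∫ x, η x • f x).re := by
    intro f η hf h1 h2
    have hi := hf.integrable_smul_left_of_hasCompactSupport h1 h2
    have := integral_re hi
    simp only [RCLike.re_eq_complex_re] at this
    rw [← this]
    simp
  rw [key h.1 (hφ.continuous_deriv (by simp)) hs.deriv, key h.2.1 hφ.continuous hs, h.2.2 φ hφ hs]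
  simp

theorem L2C_integral_norm_sq (f : L2C) : ∫ x, ‖f x‖ ^ 2 = ‖f‖ ^ 2 := by
  have h1 := L2.inner_def (𝕜 := ℂ) f f
  simp only [inner_self_eq_norm_sq_to_K] at h1
  have : ((‖f‖ ^ 2 : ℝ) : ℂ) = ((∫ x, ‖f x‖ ^ 2 : ℝ) : ℂ) := by
    rw [← integral_complex_ofReal]
    push_cast
    simpa using h1
  exact_mod_cast this.symm

/-- If the resolvent exists at the real point `E` and the form of `L - E` is nonnegative, then it
has a spectral gap above `E`. -/
theorem quadForm_gap_of_resolvent {Q : ℝ → ℝ} {C E : ℝ} (hQ : IsBoundedCoeff Q C)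
    (hE : (E : ℂ) ∈ schrodingerResolventSet Q)
    (hpos : ∀ u g, IsH1 u g → E * (∫ x, u x ^ 2) ≤ quadForm Q u g) :
    ∃ δ > 0, ∀ u g, IsH1 u g → (E + δ) * (∫ x, u x ^ 2) ≤ quadForm Q u g := by
  obtain ⟨R, hR, -⟩ := hE
  set K := ‖R‖ + 1 with hK
  have hK0 : 0 < K := by positivity
  -- With s = Re (L - E)⁻¹u and a the form of L - E, one has a(u, s) = ‖u‖² and a(s, s) = ⟨s, u⟩ ≤
  -- K‖u‖². Nonnegativity of a at u - s/K then reads 0 ≤ a(u) - (2/K)‖u‖² + (1/K)‖u‖², which is the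
  -- gap 1/K.
  refine ⟨1 / K, by positivity, fun u g hu => ?_⟩
  set f : L2C := (hu.memLp.ofReal (K := ℂ)).toLp with hf
  have hfu : (f : ℝ → ℂ) =ᵐ[volume] fun x => (u x : ℂ) := (hu.memLp.ofReal (K := ℂ)).coeFn_toLp
  obtain ⟨g1, h1, hw1, hw2, hae⟩ := hR f
  set v := R f with hv
  have memre : ∀ w : L2C, MemLp (fun x => (w x).re) 2 volume := fun w => (Lp.memLp w).re
  obtain ⟨s, hs, hvs⟩ := hw1.re.exists_isPrimitive
  obtain ⟨d, hd, hgd⟩ := hw2.re.exists_isPrimitive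
  -- The resolvent acts on complex L² while the form is real; as `Q`, `E` and `u` are real, the real
  -- part of the resolvent solves the same equation. Both it and its derivative have H¹
  -- representatives, which justifies the integration by parts in `bus`.
  have Hs : IsH1 s d := ⟨hs.congr_ae hgd, (memLp_congr_ae hvs).1 (memre v),
    (memLp_congr_ae hgd).1 (memre g1)⟩
  set k : ℝ → ℝ := fun x => (h1 x).re with hk
  have Hd : IsH1 d k := ⟨hd, (memLp_congr_ae hgd).1 (memre g1), memre h1⟩
  have eqn : ∀ᵐ x, u x + E * s x = -k x + Q x * s x := by
    have hadd : ((f + (E : ℂ) • v : L2C) : ℝ → ℂ) =ᵐ[volume] fun x => f x + (E : ℂ) * v x := by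
      filter_upwards [Lp.coeFn_add f ((E : ℂ) • v), Lp.coeFn_smul (E : ℂ) v] with x a b
      rw [a, Pi.add_apply, b]; simp
    filter_upwards [hae, hadd, hfu, hvs] with x a b c e
    rw [b, c] at a
    have := congrArg Complex.re a
    simp at this
    simp only [hk, ← e]
    linarith
  set U := ∫ x, u x ^ 2 with hU
  have bus : ∀ w h, IsH1 w h → bilinForm Q w h s d = (∫ x, w x * u x) + E * ∫ x, w x * s x := by
    intro w h hw
    have p0 := hw.integral_mul_deriv_eq_zero Hd
    have : bilinForm Q w h s d - ∫ x, (h x * d x + w x * k x)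
        = (∫ x, w x * u x) + E * ∫ x, w x * s x := by
      rw [bilinForm, ← integral_sub (hw.integrable_bilinForm Hs hQ)
        ((hw.memLp_deriv.integrable_mul Hd.memLp).add (hw.memLp.integrable_mul Hd.memLp_deriv) :
          Integrable fun x => h x * d x + w x * k x),
        ← integral_const_mul, ← integral_add (hw.integrable_mul hu)
        ((hw.integrable_mul Hs).const_mul E)]
      refine integral_congr_ae ?_
      filter_upwards [eqn] with x hx
      have : Q x * s x = u x + E * s x + k x := by linarith
      have e2 : Q x * (w x * s x) = w x * (u x + E * s x + k x) := by rw [← this]; ring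
      simp only [e2]; ring
    rw [← this, p0, sub_zero]
  -- norm bound for the resolvent
  have hsU : ∫ x, s x ^ 2 ≤ ‖R‖ ^ 2 * U := by
    have e1 : ‖v‖ ^ 2 ≤ ‖R‖ ^ 2 * ‖f‖ ^ 2 := by
      rw [← mul_pow]; gcongr; exact R.le_opNorm f
    have e2 : ‖f‖ ^ 2 = U := by
      rw [← L2C_integral_norm_sq]
      refine integral_congr_ae (hfu.mono fun x hx => ?_)
      simp [hx]
    rw [e2, ← L2C_integral_norm_sq] at e1
    refine le_trans (integral_mono_ae Hs.integrable_sq ((Lp.memLp v).norm.integrable_sq) ?_) e1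
    filter_upwards [hvs] with x hx
    rw [← hx, ← sq_abs]
    gcongr
    exact Complex.abs_re_le_norm _
  have hsu : ∫ x, s x * u x ≤ K * U := by
    have : ∫ x, s x * u x ≤ ∫ x, (1 / (2 * K) * s x ^ 2 + K / 2 * u x ^ 2) := by
      refine integral_mono (Hs.integrable_mul hu)
        ((Hs.integrable_sq.const_mul _).add (hu.integrable_sq.const_mul _)) fun x => ?_
      simp only
      have : 0 ≤ (s x - K * u x) ^ 2 / (2 * K) := by positivity
      have e : (s x - K * u x) ^ 2 / (2 * K)
        = 1 / (2 * K) * s x ^ 2 + K / 2 * u x ^ 2 - s x * u x := by field_simp; ring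
      linarith
    rw [integral_add (Hs.integrable_sq.const_mul _) (hu.integrable_sq.const_mul _),
      integral_const_mul, integral_const_mul, ← hU] at this
    have U0 : 0 ≤ U := integral_nonneg fun x => sq_nonneg _
    have b1 : 1 / (2 * K) * ∫ x, s x ^ 2 ≤ 1 / (2 * K) * (K ^ 2 * U) := by
      gcongr
      refine hsU.trans ?_
      gcongr
      rw [hK]; linarith
    have b2 : 1 / (2 * K) * (K ^ 2 * U) = K / 2 * U := by field_simp
    linarith
  -- expand the form of `u - s / K`
  set t := -(1 / K) with ht
  have H := hpos _ _ (hu.add (Hs.const_mul t))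
  rw [hu.quadForm_add (Hs.const_mul t) hQ, quadForm_smul] at H
  have c1 : bilinForm Q u g (fun x => t * s x) (fun x => t * d x) = t * bilinForm Q u g s d := by
    rw [bilinForm, bilinForm, ← integral_const_mul]
    congr 1; ext x; ring
  have c2 : quadForm Q s d = bilinForm Q s d s d := by
    rw [quadForm, bilinForm]; congr 1; ext x; ring
  have c3 : ∫ x, (u x + t * s x) ^ 2
      = U + 2 * t * (∫ x, u x * s x) + t ^ 2 * ∫ x, s x * s x := by
    rw [hU, ← integral_const_mul, ← integral_const_mul, ← integral_add_add
      hu.integrable_sq ((hu.integrable_mul Hs).const_mul _) ((Hs.integrable_mul Hs).const_mul _)]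
    congr 1; ext x; ring
  have c4 : ∫ x, u x * u x = U := by rw [hU]; congr 1; ext x; ring
  rw [c1, c2, bus u g hu, bus s d Hs, c3, c4] at H
  have c5 : t ^ 2 * (∫ x, s x * u x) ≤ t ^ 2 * (K * U) := by gcongr
  have c6 : t ^ 2 * (K * U) = 1 / K * U := by rw [ht]; field_simp
  have c7 : 2 * (t * U) = - (2 * (1 / K * U)) := by rw [ht]; ring
  nlinarith

/-- A positive spectrum makes the quadratic form coercive on `H¹`. -/
theorem PosMinSpectrum.exists_coercive {Q : ℝ → ℝ} {C : ℝ} (hQ : IsBoundedCoeff Q C)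
    (h : PosMinSpectrum Q) :
    ∃ m > 0, ∀ u g, IsH1 u g → m * ((∫ x, u x ^ 2) + ∫ x, g x ^ 2) ≤ quadForm Q u g := by
  obtain ⟨m, hm, hm0⟩ := h
  -- The lower bounds of the Rayleigh quotient; the supremum `E` of `T` is the variational bottom of
  -- the operator.
  set T : Set ℝ := {e | ∀ u g, IsH1 u g → e * (∫ x, u x ^ 2) ≤ quadForm Q u g} with hT
  have Cn : 0 ≤ C := hQ.nonneg
  have hlow : -C ∈ T := fun u g hu => by
    have := hu.integral_sq_add_quadForm hQ
    have : 0 ≤ ∫ x, g x ^ 2 := integral_nonneg fun x => sq_nonneg _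
    linarith
  -- a smooth bump shows that the Rayleigh quotient is bounded above
  obtain ⟨u0, g0, hu0, hu0p⟩ : ∃ u g, IsH1 u g ∧ 0 < ∫ x, u x ^ 2 := by
    let b : ContDiffBump (0:ℝ) := ⟨1, 2, one_pos, one_lt_two⟩
    have hb : ContDiff ℝ 1 b := b.contDiff
    have hbc : Continuous (deriv b) := hb.continuous_deriv le_rfl
    refine ⟨b, deriv b, ⟨.of_contDiff hb, hb.continuous.memLp_of_hasCompactSupport b.hasCompactSupport,
      hbc.memLp_of_hasCompactSupport b.hasCompactSupport.deriv⟩, ?_⟩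
    have hc : Continuous fun x => b x ^ 2 := hb.continuous.pow 2
    refine hc.integral_pos_of_hasCompactSupport_nonneg_nonzero ?_ (fun x => sq_nonneg _) (x := 0) ?_
    · have := b.hasCompactSupport.mul_left (f := b)
      simp only [pow_two]
      exact this
    · have : b 0 = 1 := b.one_of_mem_closedBall (by simp [b])
      simp [this]
  have hbdd : BddAbove T := by
    refine ⟨quadForm Q u0 g0 / ∫ x, u0 x ^ 2, fun e he => ?_⟩
    rw [le_div_iff₀ hu0p]
    exact he u0 g0 hu0
  set E := sSup T with hE
  have hET : E ∈ T := by
    intro u g hu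
    have U0 : 0 ≤ ∫ x, u x ^ 2 := integral_nonneg fun x => sq_nonneg _
    rcases U0.eq_or_lt with h0 | h0
    · have := hlow u g hu
      rw [← h0] at this ⊢; simpa using this
    · rw [← le_div_iff₀ h0]
      exact csSup_le ⟨_, hlow⟩ fun e he => by
        rw [le_div_iff₀ h0]; exact he u g hu
  -- Otherwise the resolvent at `E` would put some `E + δ` into `T`. Only the inequality `m ≤ E` is
  -- extracted from this.
  have hspec : (E : ℂ) ∈ schrodingerSpectrum Q := by
    intro hres
    obtain ⟨δ, hδ, hgap⟩ := quadForm_gap_of_resolvent hQ hres hET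
    have : E + δ ≤ E := le_csSup hbdd hgap
    linarith
  have hmE : m ≤ E := hm.2 hspec
  have hmT : ∀ u g, IsH1 u g → m * (∫ x, u x ^ 2) ≤ quadForm Q u g := fun u g hu =>
    (mul_le_mul_of_nonneg_right hmE (integral_nonneg fun x => sq_nonneg _)).trans (hET u g hu)
  -- Weight of a convex combination of the crude bound ∫ g² - C ∫ u² and the spectral bound m ∫ u²,
  -- chosen so that the coefficient of ∫ u² becomes m/2.
  set t := m / (2 * (C + m)) with ht
  have ht0 : 0 < t := by positivity
  have ht1 : t * (C + m) = m / 2 := by rw [ht]; field_simp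
  have htl : t ≤ 1 := by
    rw [ht, div_le_one (by positivity)]; linarith
  refine ⟨min t (m / 2), by positivity, fun u g hu => ?_⟩
  have e1 := hu.integral_sq_add_quadForm hQ
  have e2 := hmT u g hu
  have U0 : 0 ≤ ∫ x, u x ^ 2 := integral_nonneg fun x => sq_nonneg _
  have G0 : 0 ≤ ∫ x, g x ^ 2 := integral_nonneg fun x => sq_nonneg _
  have f1 := mul_le_mul_of_nonneg_right (min_le_left t (m / 2)) G0
  have f2 := mul_le_mul_of_nonneg_right (min_le_right t (m / 2)) U0
  have f3 := mul_le_mul_of_nonneg_left e1 ht0.le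
  have f4 := mul_le_mul_of_nonneg_left e2 (sub_nonneg.2 htl)
  have f5 : t * ((∫ x, g x ^ 2) - C * ∫ x, u x ^ 2) + (1 - t) * (m * ∫ x, u x ^ 2)
      = t * (∫ x, g x ^ 2) + (m - t * (C + m)) * ∫ x, u x ^ 2 := by ring
  rw [ht1] at f5
  nlinarith

/-! ### Weak compactness and the estimates for splitting -/

/-- Bounded sequences in `L²(ℝ)` have weakly convergent subsequences. -/
theorem exists_weak_subseq_limit {f : ℕ → ℝ → ℝ} {M : ℝ} (hf : ∀ n, MemLp (f n) 2 volume)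
    (hM : ∀ n, ∫ x, f n x ^ 2 ≤ M) :
    ∃ F, MemLp F 2 volume ∧ ∃ φ : ℕ → ℕ, StrictMono φ ∧ ∀ h, MemLp h 2 volume →
      Tendsto (fun n => ∫ x, f (φ n) x * h x) atTop (𝓝 (∫ x, F x * h x)) := by
  let H := Lp ℝ 2 (volume : Measure ℝ)
  have : Fact ((2 : ENNReal) ≠ ⊤) := ⟨by norm_num⟩
  have inner_eq : ∀ (a b : H), inner ℝ a b = ∫ x, b x * a x := by
    intro a b
    rw [L2.inner_def]
    simp
  set a : ℕ → H := fun n => (hf n).toLp with ha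
  have hnorm : ∀ n, ‖a n‖ ≤ √M := by
    intro n
    refine Real.le_sqrt_of_sq_le ?_
    rw [← real_inner_self_eq_norm_sq, inner_eq]
    refine le_trans (le_of_eq ?_) (hM n)
    refine integral_congr_ae ((hf n).coeFn_toLp.mono fun x hx => ?_)
    simp only [ha, hx]; ring
  -- Sequential Banach–Alaoglu on L², with functions and functionals identified through the Riesz
  -- isomorphism.
  have hseq := WeakDual.isSeqCompact_closedBall ℝ H 0 (√M)
  set ℓ : ℕ → WeakDual ℝ H := fun n => StrongDual.toWeakDual (InnerProductSpace.toDual ℝ H (a n)) with hℓ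
  have hmem : ∀ n, ℓ n ∈ WeakDual.toStrongDual ⁻¹' Metric.closedBall (0 : StrongDual ℝ H) (√M) := by
    intro n
    simp only [mem_preimage, mem_closedBall_zero_iff, hℓ]
    change ‖InnerProductSpace.toDual ℝ H (a n)‖ ≤ _
    rw [LinearIsometryEquiv.norm_map]
    exact hnorm n
  obtain ⟨L, -, φ, hφ, hL⟩ := hseq hmem
  set A : H := (InnerProductSpace.toDual ℝ H).symm (WeakDual.toStrongDual L) with hA
  refine ⟨A, Lp.memLp A, φ, hφ, fun h hh => ?_⟩
  have hcont : Continuous fun l : WeakDual ℝ H => l (hh.toLp) := WeakDual.eval_continuous _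
  have h1 := (hcont.tendsto L).comp hL
  have e1 : L hh.toLp = ∫ x, A x * h x := by
    have : L hh.toLp = inner ℝ A hh.toLp := by
      rw [hA, InnerProductSpace.toDual_symm_apply]; rfl
    rw [this, inner_eq]
    refine integral_congr_ae (hh.coeFn_toLp.mono fun x hx => ?_)
    simp only [hx]; ring
  rw [e1] at h1
  refine h1.congr fun n => ?_
  have : (ℓ (φ n)) hh.toLp = inner ℝ (a (φ n)) hh.toLp := by
    simp only [hℓ]; rfl
  simp only [Function.comp]
  rw [this, inner_eq]
  refine integral_congr_ae ?_
  filter_upwards [hh.coeFn_toLp, (hf (φ n)).coeFn_toLp] with x hx hy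
  simp only [ha, hx, hy]; ring

/-- Bounded sequences in `H¹(ℝ)` subconverge pointwise, with weakly convergent derivatives. -/
theorem IsH1.exists_subseq_limit {u g : ℕ → ℝ → ℝ} {M : ℝ} (hu : ∀ n, IsH1 (u n) (g n))
    (hM : ∀ n, (∫ x, u n x ^ 2) + ∫ x, g n x ^ 2 ≤ M) :
    ∃ v h, IsH1 v h ∧ ∃ φ : ℕ → ℕ, StrictMono φ ∧
      (∀ x, Tendsto (fun n => u (φ n) x) atTop (𝓝 (v x))) ∧
      ∀ k, MemLp k 2 volume →
        Tendsto (fun n => ∫ x, g (φ n) x * k x) atTop (𝓝 (∫ x, h x * k x)) := by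
  have U0 : ∀ n, 0 ≤ ∫ x, u n x ^ 2 := fun n => integral_nonneg fun x => sq_nonneg _
  have G0 : ∀ n, 0 ≤ ∫ x, g n x ^ 2 := fun n => integral_nonneg fun x => sq_nonneg _
  obtain ⟨G, hG, φ, hφ, hw⟩ := exists_weak_subseq_limit (M := M) (fun n => (hu n).memLp_deriv)
    (fun n => by linarith [hM n, U0 n])
  have hb : ∀ n, u (φ n) 0 ∈ Metric.closedBall (0:ℝ) (√(2 * M)) := by
    intro n
    rw [mem_closedBall_zero_iff, Real.norm_eq_abs]
    exact Real.abs_le_sqrt (((hu _).sq_le 0).trans (by linarith [hM (φ n)]))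
  obtain ⟨c, -, ψ, hψ, hc⟩ := (isCompact_closedBall (0:ℝ) (√(2 * M))).isSeqCompact hb
  -- Convergence of the values at 0 and weak convergence of the derivatives determine the limit:
  -- testing against the indicator of an interval turns weak convergence into convergence of
  -- increments at every point.
  set v : ℝ → ℝ := fun x => c + ∫ t in (0:ℝ)..x, G t with hv
  have Gloc : LocallyIntegrable G volume := hG.locallyIntegrable (by norm_num)
  have hprim : IsPrimitive v G := by
    refine ⟨Gloc, fun a b => ?_⟩
    rw [hv]
    simp only [add_sub_add_left_eq_sub]
    exact intervalIntegral.integral_interval_sub_left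
      (IsPrimitive.locallyIntegrable_intervalIntegrable Gloc _ _)
      (IsPrimitive.locallyIntegrable_intervalIntegrable Gloc _ _)
  have hw' : ∀ k, MemLp k 2 volume →
        Tendsto (fun n => ∫ x, g (φ (ψ n)) x * k x) atTop (𝓝 (∫ x, G x * k x)) :=
    fun k hk => (hw k hk).comp hψ.tendsto_atTop
  have hint : ∀ a b : ℝ, a ≤ b →
      Tendsto (fun n => ∫ t in a..b, g (φ (ψ n)) t) atTop (𝓝 (∫ t in a..b, G t)) := by
    intro a b hab
    have hk : MemLp (indicator (Ioc a b) fun _ => (1:ℝ)) 2 volume :=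
      memLp_indicator_const 2 measurableSet_Ioc 1 (Or.inr (by simp))
    have key : ∀ f : ℝ → ℝ, ∫ x, f x * indicator (Ioc a b) (fun _ => (1:ℝ)) x
        = ∫ t in a..b, f t := by
      intro f
      rw [intervalIntegral.integral_of_le hab, ← integral_indicator measurableSet_Ioc]
      congr 1; ext x
      by_cases hx : x ∈ Ioc a b <;> simp [hx]
    simpa only [key] using hw' _ hk
  have hpt : ∀ x, Tendsto (fun n => u (φ (ψ n)) x) atTop (𝓝 (v x)) := by
    intro x
    have h1 : Tendsto (fun n => ∫ t in (0:ℝ)..x, g (φ (ψ n)) t) atTop (𝓝 (∫ t in (0:ℝ)..x, G t)) := by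
      rcases le_total 0 x with h | h
      · exact hint 0 x h
      · simp only [intervalIntegral.integral_symm x 0]
        exact (hint x 0 h).neg
    refine (hc.add h1).congr fun n => ?_
    simp only [Function.comp]
    rw [← (hu _).prim.2 0 x]; ring
  refine ⟨v, G, ⟨hprim, ?_, hG⟩, φ ∘ ψ, hφ.comp hψ, hpt, hw'⟩
  refine ⟨hprim.continuous.aestronglyMeasurable, ?_⟩
  -- Fatou: the pointwise limit inherits the L² bound.
  have hF := Lp.eLpNorm_lim_le_liminf_eLpNorm (p := 2) (μ := volume)
    (f := fun n => u (φ (ψ n))) (fun n => (hu _).memLp.1) v (Eventually.of_forall hpt)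
  refine hF.trans_lt (lt_of_le_of_lt (liminf_le_of_le (a := ENNReal.ofReal (√M)) (by isBoundedDefault) ?_)
    ENNReal.ofReal_lt_top)
  intro b hb
  obtain ⟨n, hn⟩ := hb.exists
  refine hn.trans ?_
  rw [(hu _).memLp.eLpNorm_eq_integral_rpow_norm (by norm_num) (by norm_num)]
  apply ENNReal.ofReal_le_ofReal
  have : ∫ x, ‖u (φ (ψ n)) x‖ ^ (ENNReal.toReal 2) = ∫ x, u (φ (ψ n)) x ^ 2 := by
    congr 1; ext x; simp
  rw [this, Real.sqrt_eq_rpow]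
  simp only [ENNReal.toReal_ofNat, one_div]
  refine Real.rpow_le_rpow (U0 _) ?_ (by norm_num)
  linarith [hM (φ (ψ n)), G0 (φ (ψ n))]

/-- The second difference of `|·|^q` is controlled by a product on bounded sets. -/
theorem abs_add_rpow_sub_le {q M a b : ℝ} (hq : 2 < q) (ha : |a| ≤ M) (hb : |b| ≤ M) :
    |(|a + b| ^ q - |a| ^ q - |b| ^ q)| ≤ q * (q - 1) * (2 * M) ^ (q - 2) * (|a| * |b|) := by
  have hM : 0 ≤ M := (abs_nonneg a).trans ha
  set D : ℝ → ℝ := fun t => q * (|t| ^ (q - 2) * t) with hD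
  have hder : ∀ t, HasDerivAt (fun t : ℝ => |t| ^ q) (D t) t := fun t => by
    have := hasDerivAt_abs_rpow t (p := q) (by linarith)
    rw [hD]; simpa [mul_assoc] using this
  -- the derivative is Lipschitz on bounded sets
  have hmono : ∀ s t : ℝ, |s| ≤ 2 * M → |t| ≤ 2 * M →
      |D s - D t| ≤ q * (q - 1) * (2 * M) ^ (q - 2) * |s - t| := by
    -- As q > 2, |t|^q is twice differentiable, also at 0, and its second derivative is bounded on
    -- [-2M, 2M], an interval containing x + b whenever |x|, |b| ≤ M.
    have hDder : ∀ t, HasDerivAt D (q * (q - 1) * |t| ^ (q - 2)) t := by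
      intro t
      rcases lt_trichotomy t 0 with h | h | h
      · have e : D =ᶠ[nhds t] fun x => -(q * (-x) ^ (q - 1)) := by
          filter_upwards [gt_mem_nhds h] with x hx
          have hx' : 0 < -x := by linarith
          rw [hD]; simp only
          rw [abs_of_neg hx, show q - 1 = (q - 2) + 1 by ring, Real.rpow_add_one hx'.ne']; ring
        refine HasDerivAt.congr_of_eventuallyEq ?_ e
        have h1 := ((hasDerivAt_id t).neg.rpow_const (p := q - 1) (Or.inl (by simpa using h.ne))).const_mul q
        refine h1.neg.congr_deriv ?_
        simp only [Pi.neg_apply, id, abs_of_neg h]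
        rw [show q - 1 - 1 = q - 2 by ring]; ring
      · subst h
        have h0 : D 0 = 0 := by simp [hD]
        rw [hasDerivAt_iff_tendsto_slope]
        have : slope D 0 =ᶠ[nhdsWithin 0 {0}ᶜ] fun x => q * |x| ^ (q - 2) := by
          filter_upwards [self_mem_nhdsWithin] with x hx
          have hx0 : x ≠ 0 := hx
          rw [slope_def_field, h0, hD]; field_simp; ring
        refine Filter.Tendsto.congr' this.symm ?_
        have hc : Continuous fun x : ℝ => q * |x| ^ (q - 2) :=
          continuous_const.mul (continuous_abs.rpow_const fun x => Or.inr (by linarith))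
        have := hc.tendsto 0
        rw [abs_zero, Real.zero_rpow (by linarith : q - 2 ≠ 0)] at this ⊢
        rw [mul_zero] at this ⊢
        exact this.mono_left nhdsWithin_le_nhds
      · have e : D =ᶠ[nhds t] fun x => q * x ^ (q - 1) := by
          filter_upwards [lt_mem_nhds h] with x hx
          rw [hD]; simp only
          rw [abs_of_pos hx, show q - 1 = (q - 2) + 1 by ring, Real.rpow_add_one hx.ne']
        refine HasDerivAt.congr_of_eventuallyEq ?_ e
        have h1 := ((hasDerivAt_id t).rpow_const (p := q - 1) (Or.inl h.ne')).const_mul q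
        refine h1.congr_deriv ?_
        simp only [id, abs_of_pos h]
        rw [show q - 1 - 1 = q - 2 by ring]; ring
    intro s t hs ht
    have := (convex_Icc (-(2 * M)) (2 * M)).norm_image_sub_le_of_norm_hasDerivWithin_le
      (f := D) (f' := fun t => q * (q - 1) * |t| ^ (q - 2)) (C := q * (q - 1) * (2 * M) ^ (q - 2))
      (fun x _ => (hDder x).hasDerivWithinAt) (fun x hx => ?_) (abs_le.1 ht) (abs_le.1 hs)
    · simpa using this
    · have h1 : 0 ≤ q * (q - 1) := by nlinarith
      have : |x| ≤ 2 * M := abs_le.2 hx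
      rw [Real.norm_of_nonneg (by positivity)]
      gcongr
  -- second mean value estimate
  have h2 := (convex_Icc (-M) M).norm_image_sub_le_of_norm_hasDerivWithin_le
    (f := fun x => |x + b| ^ q - |x| ^ q) (f' := fun x => D (x + b) - D x)
    (C := q * (q - 1) * (2 * M) ^ (q - 2) * |b|) (x := 0) (y := a)
    (fun x _ => (((hder (x + b)).comp_add_const x b).sub (hder x)).hasDerivWithinAt)
    (fun x hx => ?_) ⟨by linarith, hM⟩ (abs_le.1 ha)
  · simp only [zero_add, abs_zero, Real.zero_rpow (by linarith : q ≠ 0), sub_zero,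
      Real.norm_eq_abs] at h2
    refine h2.trans (le_of_eq (by ring))
  · have hx' : |x| ≤ M := abs_le.2 hx
    have := hmono (x + b) x ((abs_add_le x b).trans (by linarith)) (by linarith)
    simpa using this

/-- A pointwise null sequence bounded in `L²` is asymptotically orthogonal, in absolute value, to
every `L²` function. -/
theorem tendsto_integral_abs_mul {v : ℝ → ℝ} {r : ℕ → ℝ → ℝ} {M : ℝ} (hv : MemLp v 2 volume)
    (hr : ∀ n, MemLp (r n) 2 volume) (hM : ∀ n, ∫ x, r n x ^ 2 ≤ M)
    (h0 : ∀ x, Tendsto (fun n => r n x) atTop (𝓝 0)) :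
    Tendsto (fun n => ∫ x, |v x| * |r n x|) atTop (𝓝 0) := by
  have M0 : 0 ≤ M := (integral_nonneg fun x => sq_nonneg _).trans (hM 0)
  rw [Metric.tendsto_atTop]
  intro ε hε
  set η := ε / (2 * (M + 1)) with hη
  have η0 : 0 < η := by positivity
  have ηM : η * M ≤ ε / 2 := by
    rw [hη, div_mul_eq_mul_div, div_le_iff₀ (by positivity)]; nlinarith
  -- By Young's inequality this excess is dominated by v²/(4η), whatever `r n` is, so dominated
  -- convergence applies to it; the discarded part η r² contributes at most η M ≤ ε/2.
  set f : ℕ → ℝ → ℝ := fun n x => max (|v x| * |r n x| - η * r n x ^ 2) 0 with hf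
  have hmeas : ∀ n, AEStronglyMeasurable (f n) volume := by
    intro n
    have a1 := hv.1
    have a2 := (hr n).1
    have := (a1.norm.mul a2.norm).sub ((a2.pow 2).const_mul η)
    exact this.sup aestronglyMeasurable_const
  have hbd : ∀ n x, ‖f n x‖ ≤ v x ^ 2 / (4 * η) := by
    intro n x
    rw [Real.norm_of_nonneg (le_max_right _ _)]
    refine max_le ?_ (by positivity)
    rw [le_div_iff₀ (by positivity), ← sq_abs (v x), ← sq_abs (r n x)]
    nlinarith [sq_nonneg (|v x| - 2 * η * |r n x|)]
  have hlim : Tendsto (fun n => ∫ x, f n x) atTop (𝓝 (∫ _x : ℝ, (0:ℝ))) := by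
    refine tendsto_integral_of_dominated_convergence (fun x => v x ^ 2 / (4 * η)) hmeas
      (hv.integrable_sq.div_const _) (fun n => Eventually.of_forall (hbd n))
      (Eventually.of_forall fun x => ?_)
    have h1 := ((h0 x).abs.const_mul |v x|).sub (((h0 x).pow 2).const_mul η)
    have := h1.max (tendsto_const_nhds (x := (0:ℝ)))
    simpa using this
  rw [integral_zero, Metric.tendsto_atTop] at hlim
  obtain ⟨N, hN⟩ := hlim (ε / 2) (by positivity)
  refine ⟨N, fun n hn => ?_⟩
  have h1 := hN n hn
  rw [Real.dist_eq, sub_zero] at h1 ⊢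
  have fi : Integrable (f n) :=
    (hv.integrable_sq.div_const (4 * η)).mono' (hmeas n) (Eventually.of_forall (hbd n))
  have h2 : ∫ x, |v x| * |r n x| ≤ ∫ x, (f n x + η * r n x ^ 2) := by
    refine integral_mono (hv.abs.integrable_mul (hr n).abs) (fi.add ((hr n).integrable_sq.const_mul η))
      fun x => ?_
    have := le_max_left (|v x| * |r n x| - η * r n x ^ 2) 0
    simp only [hf]; linarith
  rw [integral_add fi ((hr n).integrable_sq.const_mul η), integral_const_mul] at h2
  have h3 : η * ∫ x, r n x ^ 2 ≤ η * M := by gcongr; exact hM n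
  rw [abs_of_nonneg (integral_nonneg fun x => by positivity)]
  have := le_abs_self (∫ x, f n x)
  linarith

/-! ### Concentration compactness for the Sobolev quotient -/

/-- Coercivity of the form `∫ u'² + Q u²` on `H¹(ℝ)`. -/
def CoerciveOnH1 (Q : ℝ → ℝ) (m : ℝ) : Prop :=
  ∀ u g, IsH1 u g → m * ((∫ x, u x ^ 2) + ∫ x, g x ^ 2) ≤ quadForm Q u g

/-- The inequality `S (∫ Γ |u|^q)₊^{2/q} ≤ ∫ u'² + Q u²` on `H¹(ℝ)`. -/
def SobolevBound (Q Γ : ℝ → ℝ) (q S : ℝ) : Prop :=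
  ∀ u g, IsH1 u g → S * (max (powForm Γ q u) 0) ^ (2 / q) ≤ quadForm Q u g

/-- A function realizing equality in `SobolevBound`, normalized by `∫ Γ |u|^q = 1`. -/
def IsNormalizedMinimizer (Q Γ : ℝ → ℝ) (q S : ℝ) (v h : ℝ → ℝ) : Prop :=
  IsH1 v h ∧ powForm Γ q v = 1 ∧ quadForm Q v h = S

section Shifts

variable {Q Γ Q' Γ' : ℝ → ℝ} {C D m S q : ℝ} {s : ℕ → ℝ}

theorem tendsto_quadForm_shift (hQ : IsBoundedCoeff Q C)
    (hlim : ∀ x, Tendsto (fun n => Q (x + s n)) atTop (𝓝 (Q' x))) {u g : ℝ → ℝ} (hu : IsH1 u g) :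
    Tendsto (fun n => quadForm (fun x => Q (x + s n)) u g) atTop (𝓝 (quadForm Q' u g)) := by
  refine tendsto_integral_of_dominated_convergence (fun x => g x ^ 2 + C * u x ^ 2)
    (fun n => (hu.integrable_quadForm (hQ.comp_add (s n))).aestronglyMeasurable)
    (hu.integrable_deriv_sq.add (hu.integrable_sq.const_mul C))
    (fun n => Eventually.of_forall fun x => ?_) (Eventually.of_forall fun x => ?_)
  · rw [Real.norm_eq_abs]
    refine (abs_add_le _ _).trans ?_
    rw [abs_mul, abs_of_nonneg (sq_nonneg (g x)), abs_of_nonneg (sq_nonneg (u x))]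
    gcongr
    exact hQ.bound _
  · exact ((hlim x).mul_const _).const_add _

theorem tendsto_powForm_shift (hΓ : IsBoundedCoeff Γ D) (hq : 2 < q)
    (hlim : ∀ x, Tendsto (fun n => Γ (x + s n)) atTop (𝓝 (Γ' x))) {u g : ℝ → ℝ} (hu : IsH1 u g) :
    Tendsto (fun n => powForm (fun x => Γ (x + s n)) q u) atTop (𝓝 (powForm Γ' q u)) := by
  refine tendsto_integral_of_dominated_convergence (fun x => D * |u x| ^ q)
    (fun n => (hu.integrable_powForm hq (hΓ.comp_add (s n))).aestronglyMeasurable)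
    ((hu.integrable_rpow hq).const_mul D)
    (fun n => Eventually.of_forall fun x => ?_) (Eventually.of_forall fun x => ?_)
  · rw [Real.norm_eq_abs, abs_mul, abs_of_nonneg (by positivity : 0 ≤ |u x| ^ q)]
    gcongr
    exact hΓ.bound _
  · exact (hlim x).mul_const _

theorem CoerciveOnH1.comp_add (h : CoerciveOnH1 Q m) (s : ℝ) : CoerciveOnH1 (fun x => Q (x + s)) m := by
  intro u g hu
  have h1 := h _ _ (hu.comp_add (-s))
  have e := quadForm_comp_add Q (fun x => u (x + -s)) (fun x => g (x + -s)) s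
  simp only [add_neg_cancel_right] at e
  rw [e]
  refine le_trans (le_of_eq ?_) h1
  rw [integral_add_right_eq_self (fun x => u x ^ 2) (-s),
    integral_add_right_eq_self (fun x => g x ^ 2) (-s)]

theorem SobolevBound.comp_add (h : SobolevBound Q Γ q S) (s : ℝ) :
    SobolevBound (fun x => Q (x + s)) (fun x => Γ (x + s)) q S := by
  intro u g hu
  have h1 := h _ _ (hu.comp_add (-s))
  have e := quadForm_comp_add Q (fun x => u (x + -s)) (fun x => g (x + -s)) s
  have e2 := powForm_comp_add Γ (fun x => u (x + -s)) q s
  simp only [add_neg_cancel_right] at e e2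
  rw [e, e2]
  exact h1

/-- The inequality holds with one constant for all translated coefficients; with the function fixed,
dominated convergence carries it to the limit. The problems at ±∞ thus inherit both `m` and `S`. -/
theorem CoerciveOnH1.of_shift (hQ : IsBoundedCoeff Q C) (h : CoerciveOnH1 Q m)
    (hlim : ∀ x, Tendsto (fun n => Q (x + s n)) atTop (𝓝 (Q' x))) : CoerciveOnH1 Q' m :=
  fun u g hu => ge_of_tendsto' (tendsto_quadForm_shift hQ hlim hu)
    fun n => h.comp_add (s n) u g hu

theorem SobolevBound.of_shift (hq : 2 < q) (hQ : IsBoundedCoeff Q C) (hΓ : IsBoundedCoeff Γ D)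
    (h : SobolevBound Q Γ q S)
    (hlim : ∀ x, Tendsto (fun n => Q (x + s n)) atTop (𝓝 (Q' x)))
    (hlim' : ∀ x, Tendsto (fun n => Γ (x + s n)) atTop (𝓝 (Γ' x))) : SobolevBound Q' Γ' q S :=
  fun u g hu => le_of_tendsto_of_tendsto'
    (((((tendsto_powForm_shift hΓ hq hlim' hu).max tendsto_const_nhds).rpow_const
      (Or.inr (by positivity))).const_mul S)) (tendsto_quadForm_shift hQ hlim hu)
    fun n => h.comp_add (s n) u g hu

end Shifts

/-- Cauchy–Schwarz on [a, b], giving a Hölder-1/2 modulus depending only on the derivative's norm.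
It transfers a lower bound at moving points to their limit point. -/
theorem IsH1.abs_sub_sq_le {u g : ℝ → ℝ} (hu : IsH1 u g) (a b : ℝ) :
    (u b - u a) ^ 2 ≤ |b - a| * ∫ x, g x ^ 2 := by
  wlog hab : a ≤ b generalizing a b
  · have := this b a (le_of_not_ge hab)
    rw [abs_sub_comm]; nlinarith
  rcases hab.eq_or_lt with rfl | hlt
  · simp
  have hL : 0 < b - a := sub_pos.2 hlt
  rw [hu.prim.2 a b, abs_of_pos hL]
  set c := ∫ t in a..b, g t with hc
  have ig := hu.prim.intervalIntegrable a b
  have ig2 := hu.integrable_deriv_sq.intervalIntegrable (a := a) (b := b)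
  have h0 : 0 ≤ ∫ t in a..b, ((b - a) * g t ^ 2 - 2 * c * g t + c ^ 2 / (b - a)) := by
    apply intervalIntegral.integral_nonneg hab
    intro t _
    have : (b - a) * g t ^ 2 - 2 * c * g t + c ^ 2 / (b - a)
      = ((b - a) * g t - c) ^ 2 / (b - a) := by field_simp; ring
    rw [this]; positivity
  rw [intervalIntegral.integral_add ((ig2.const_mul _).sub (ig.const_mul _)) (by simp),
    intervalIntegral.integral_sub (ig2.const_mul _) (ig.const_mul _),
    intervalIntegral.integral_const_mul, intervalIntegral.integral_const_mul, ← hc] at h0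
  have e : (b - a) • (c ^ 2 / (b - a)) = c ^ 2 := by rw [smul_eq_mul]; field_simp
  rw [intervalIntegral.integral_const, e] at h0
  have h1 : ∫ t in a..b, g t ^ 2 ≤ ∫ x, g x ^ 2 := by
    rw [intervalIntegral.integral_of_le hab]
    exact setIntegral_le_integral hu.integrable_deriv_sq (Eventually.of_forall fun t => sq_nonneg _)
  nlinarith

theorem IsH1.integral_sq_pos {u g : ℝ → ℝ} (hu : IsH1 u g) {x : ℝ} (hx : u x ≠ 0) :
    0 < ∫ x, u x ^ 2 := by
  rw [integral_pos_iff_support_of_nonneg (fun x => sq_nonneg _) hu.integrable_sq]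
  have ho : IsOpen (Function.support fun x => u x ^ 2) :=
    (hu.continuous.pow 2).isOpen_support
  exact ho.measure_pos volume ⟨x, by simp [hx]⟩

/-- Concentration compactness, compact case: a minimizing sequence which does not vanish along the
shifts `s n` yields a minimizer of the limit problem. -/
theorem exists_minimizer_of_nonvanishing {Q Γ Q' Γ' : ℝ → ℝ} {C D m S q : ℝ} (hq : 2 < q)
    (hQ : IsBoundedCoeff Q C) (hΓ : IsBoundedCoeff Γ D) (hm : 0 < m) (hco : CoerciveOnH1 Q m)
    (hS : 0 < S) (hSob : SobolevBound Q Γ q S) (s : ℕ → ℝ)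
    (hlim : ∀ x, Tendsto (fun n => Q (x + s n)) atTop (𝓝 (Q' x)))
    (hlim' : ∀ x, Tendsto (fun n => Γ (x + s n)) atTop (𝓝 (Γ' x)))
    (u g : ℕ → ℝ → ℝ) (hu : ∀ n, IsH1 (u n) (g n)) (hB : ∀ n, powForm Γ q (u n) = 1)
    (ha : Tendsto (fun n => quadForm Q (u n) (g n)) atTop (𝓝 S))
    {ε R : ℝ} (hε : 0 < ε) (x : ℕ → ℝ) (hxR : ∀ n, |x n| ≤ R)
    (hx : ∀ n, ε ≤ |u n (x n + s n)|) :
    ∃ v h, IsNormalizedMinimizer Q' Γ' q S v h := by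
  obtain ⟨A, hA⟩ : ∃ A, ∀ n, quadForm Q (u n) (g n) ≤ A := by
    obtain ⟨A, hA⟩ := ha.bddAbove_range
    exact ⟨A, fun n => hA ⟨n, rfl⟩⟩
  -- shift and extract
  have hw0 : ∀ n, IsH1 (fun y => u n (y + s n)) (fun y => g n (y + s n)) :=
    fun n => (hu n).comp_add (s n)
  have hM : ∀ n, (∫ y, u n (y + s n) ^ 2) + ∫ y, g n (y + s n) ^ 2 ≤ A / m := by
    intro n
    rw [le_div_iff₀ hm, integral_add_right_eq_self (fun y => u n y ^ 2) (s n),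
      integral_add_right_eq_self (fun y => g n y ^ 2) (s n), mul_comm]
    exact (hco _ _ (hu n)).trans (hA n)
  obtain ⟨v, h, hv, φ, hφ, hpt, hwk⟩ := IsH1.exists_subseq_limit hw0 hM
  have hxm : ∀ n, x (φ n) ∈ Metric.closedBall (0:ℝ) R := fun n => by
    rw [mem_closedBall_zero_iff]; exact hxR _
  obtain ⟨x0, -, ψ, hψ, hx0⟩ := (isCompact_closedBall (0:ℝ) R).isSeqCompact hxm
  set χ := φ ∘ ψ with hχ
  have hχm : StrictMono χ := hφ.comp hψ
  set w : ℕ → ℝ → ℝ := fun n y => u (χ n) (y + s (χ n)) with hw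
  set k : ℕ → ℝ → ℝ := fun n y => g (χ n) (y + s (χ n)) with hk
  have hwk1 : ∀ n, IsH1 (w n) (k n) := fun n => hw0 _
  have hMw : ∀ n, (∫ y, w n y ^ 2) + ∫ y, k n y ^ 2 ≤ A / m := fun n => hM _
  have hpt1 : ∀ y, Tendsto (fun n => w n y) atTop (𝓝 (v y)) :=
    fun y => (hpt y).comp hψ.tendsto_atTop
  have hwk2 : ∀ f, MemLp f 2 volume → Tendsto (fun n => ∫ y, k n y * f y) atTop
      (𝓝 (∫ y, h y * f y)) := fun f hf => (hwk f hf).comp hψ.tendsto_atTop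
  have U0 : ∀ f : ℝ → ℝ, 0 ≤ ∫ y, f y ^ 2 := fun f => integral_nonneg fun y => sq_nonneg _
  -- the limit does not vanish
  have hv0 : v x0 ≠ 0 := by
    intro hz
    have h1 : Tendsto (fun n => |w n x0| + √(|x (χ n) - x0| * (A / m))) atTop (𝓝 0) := by
      have a1 := (hpt1 x0).abs
      have a2 : Tendsto (fun n => √(|x (χ n) - x0| * (A / m))) atTop (𝓝 (√(|x0 - x0| * (A / m)))) :=
        ((hx0.sub_const x0).abs.mul_const _).sqrt
      simpa [hz] using a1.add a2
    have h2 : ∀ n, ε ≤ |w n x0| + √(|x (χ n) - x0| * (A / m)) := by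
      intro n
      have b1 := hx (χ n)
      have b2 := (hwk1 n).abs_sub_sq_le x0 (x (χ n))
      have b3 : |w n (x (χ n)) - w n x0| ≤ √(|x (χ n) - x0| * (A / m)) := by
        refine Real.abs_le_sqrt (b2.trans ?_)
        gcongr
        linarith [hMw n, U0 (w n)]
      have b4 := abs_sub_abs_le_abs_sub (w n (x (χ n))) (w n x0)
      change ε ≤ |w n (x (χ n))| at b1
      linarith
    have := ge_of_tendsto' h1 h2
    linarith
  -- the remainders
  set r : ℕ → ℝ → ℝ := fun n y => w n y - v y with hr
  set l : ℕ → ℝ → ℝ := fun n y => k n y - h y with hl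
  have hrl : ∀ n, IsH1 (r n) (l n) := fun n => (hwk1 n).sub hv
  set V := ∫ y, v y ^ 2 with hV
  have hrM : ∀ n, ∫ y, r n y ^ 2 ≤ 2 * (A / m) + 2 * V := by
    intro n
    have : ∫ y, r n y ^ 2 ≤ ∫ y, (2 * w n y ^ 2 + 2 * v y ^ 2) := by
      refine integral_mono (hrl n).integrable_sq
        (((hwk1 n).integrable_sq.const_mul 2).add (hv.integrable_sq.const_mul 2)) fun y => ?_
      simp only [hr]; nlinarith [sq_nonneg (w n y + v y)]
    rw [integral_add ((hwk1 n).integrable_sq.const_mul 2) (hv.integrable_sq.const_mul 2),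
      integral_const_mul, integral_const_mul] at this
    linarith [hMw n, U0 (k n)]
  have hrpt : ∀ y, Tendsto (fun n => r n y) atTop (𝓝 0) := fun y => by
    simpa [hr] using (hpt1 y).sub_const (v y)
  have hvr := tendsto_integral_abs_mul hv.memLp (fun n => (hrl n).memLp) hrM hrpt
  set Qn : ℕ → ℝ → ℝ := fun n y => Q (y + s (χ n)) with hQn
  set Γn : ℕ → ℝ → ℝ := fun n y => Γ (y + s (χ n)) with hΓn
  have hQnb : ∀ n, IsBoundedCoeff (Qn n) C := fun n => hQ.comp_add _
  have hΓnb : ∀ n, IsBoundedCoeff (Γn n) D := fun n => hΓ.comp_add _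
  have hqv : Tendsto (fun n => quadForm (Qn n) v h) atTop (𝓝 (quadForm Q' v h)) :=
    (tendsto_quadForm_shift hQ hlim hv).comp hχm.tendsto_atTop
  have hpv : Tendsto (fun n => powForm (Γn n) q v) atTop (𝓝 (powForm Γ' q v)) :=
    (tendsto_powForm_shift hΓ hq hlim' hv).comp hχm.tendsto_atTop
  have hqw : Tendsto (fun n => quadForm (Qn n) (w n) (k n)) atTop (𝓝 S) := by
    refine (ha.comp hχm.tendsto_atTop).congr fun n => ?_
    exact (quadForm_comp_add Q (u (χ n)) (g (χ n)) (s (χ n))).symm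
  have hpw : ∀ n, powForm (Γn n) q (w n) = 1 := fun n => by
    rw [← hB (χ n)]
    exact powForm_comp_add Γ (u (χ n)) q (s (χ n))
  -- the mixed quadratic term vanishes
  have hbil : Tendsto (fun n => bilinForm (Qn n) v h (r n) (l n)) atTop (𝓝 0) := by
    have e : ∀ n, bilinForm (Qn n) v h (r n) (l n)
        = ((∫ y, k n y * h y) - ∫ y, h y * h y) + ∫ y, Qn n y * (v y * r n y) := by
      intro n
      have i1 : Integrable (fun y => k n y * h y) := (hwk1 n).memLp_deriv.integrable_mul hv.memLp_deriv
      have i2 : Integrable (fun y => h y * h y) := hv.memLp_deriv.integrable_mul hv.memLp_deriv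
      have i3 : Integrable (fun y => Qn n y * (v y * r n y)) :=
        (hv.integrable_mul (hrl n)).bdd_mul (hQnb n).aesm (Eventually.of_forall (hQnb n).bound)
      rw [bilinForm, ← integral_sub i1 i2, ← integral_add (f := fun y => k n y * h y - h y * h y) (i1.sub i2) i3]
      congr 1; ext y; simp only [hl]; ring
    have t1 := (hwk2 h hv.memLp_deriv).sub_const (∫ y, h y * h y)
    have t2 : Tendsto (fun n => ∫ y, Qn n y * (v y * r n y)) atTop (𝓝 0) := by
      refine squeeze_zero_norm (fun n => ?_) (by simpa using hvr.const_mul C)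
      refine (norm_integral_le_integral_norm _).trans ?_
      rw [← integral_const_mul]
      have i4 : Integrable fun y => |v y| * |r n y| := hv.memLp.abs.integrable_mul (hrl n).memLp.abs
      refine integral_mono ((hv.integrable_mul (hrl n)).bdd_mul (hQnb n).aesm
        (Eventually.of_forall (hQnb n).bound)).norm (i4.const_mul C) fun y => ?_
      simp only [Real.norm_eq_abs, abs_mul]
      gcongr
      exact (hQnb n).bound y
    have := t1.add t2
    simp only [sub_self, zero_add] at this
    exact this.congr fun n => (e n).symm
  -- Brezis-Lieb splitting of the power term
  have hpr : Tendsto (fun n => powForm (Γn n) q (r n)) atTop (𝓝 (1 - powForm Γ' q v)) := by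
    -- The sum of the sup bounds for `w n` and for `v`, hence a bound for `v` and for every
    -- remainder `r n`.
    set L := √(2 * (A / m)) + √(2 * (V + ∫ y, h y ^ 2)) with hL
    have bv : ∀ y, |v y| ≤ L := fun y => by
      have := Real.abs_le_sqrt (hv.sq_le y)
      have := Real.sqrt_nonneg (2 * (A / m))
      rw [hL]; linarith
    have br : ∀ n y, |r n y| ≤ L := fun n y => by
      have h1 := Real.abs_le_sqrt (hv.sq_le y)
      have h2 := Real.abs_le_sqrt (((hwk1 n).sq_le y).trans
        (mul_le_mul_of_nonneg_left (hMw n) (by norm_num : (0:ℝ) ≤ 2)))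
      exact (abs_sub _ _).trans (add_le_add h2 h1)
    set K := q * (q - 1) * (2 * L) ^ (q - 2) with hK
    have hdiff : Tendsto (fun n => powForm (Γn n) q (w n) - powForm (Γn n) q v
        - powForm (Γn n) q (r n)) atTop (𝓝 0) := by
      refine squeeze_zero_norm (fun n => ?_) (by simpa using hvr.const_mul (D * K))
      have j1 := (hwk1 n).integrable_powForm hq (hΓnb n)
      have j2 := hv.integrable_powForm hq (hΓnb n)
      have j3 := (hrl n).integrable_powForm hq (hΓnb n)
      have i4 : Integrable fun y => |v y| * |r n y| := hv.memLp.abs.integrable_mul (hrl n).memLp.abs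
      rw [powForm, powForm, powForm, ← integral_sub j1 j2,
        ← integral_sub (f := fun y => Γn n y * |w n y| ^ q - Γn n y * |v y| ^ q) (j1.sub j2) j3]
      refine (norm_integral_le_integral_norm _).trans ?_
      rw [← integral_const_mul]
      refine integral_mono (((j1.sub j2).sub j3).norm) (i4.const_mul _) fun y => ?_
      have e : Γn n y * |w n y| ^ q - Γn n y * |v y| ^ q - Γn n y * |r n y| ^ q
          = Γn n y * (|v y + r n y| ^ q - |v y| ^ q - |r n y| ^ q) := by
        have : v y + r n y = w n y := by simp [hr]
        rw [this]; ring
      simp only [Real.norm_eq_abs, e, abs_mul]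
      rw [mul_assoc]
      refine mul_le_mul ((hΓnb n).bound y) ?_ (abs_nonneg _) hΓ.nonneg
      exact abs_add_rpow_sub_le hq (bv y) (br n y)
    simp only [hpw] at hdiff
    have := (hpv.const_sub 1).sub hdiff
    rw [sub_zero] at this
    refine this.congr fun n => by ring
  -- passing to the limit in the lower bound for the remainder
  have hsplit : ∀ n, quadForm (Qn n) (w n) (k n) = quadForm (Qn n) v h
      + 2 * bilinForm (Qn n) v h (r n) (l n) + quadForm (Qn n) (r n) (l n) := by
    intro n
    rw [← hv.quadForm_add (hrl n) (hQnb n)]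
    congr 1 <;> ext y <;> simp [hr, hl]
  have hqr : Tendsto (fun n => quadForm (Qn n) (r n) (l n)) atTop (𝓝 (S - quadForm Q' v h)) := by
    have := (hqw.sub hqv).sub (hbil.const_mul 2)
    simp only [mul_zero, sub_zero] at this
    refine this.congr fun n => ?_
    rw [hsplit n]; ring
  have hq0 : 0 < 2 / q := by positivity
  have hq1 : 2 / q < 1 := by rw [div_lt_one (by linarith)]; exact hq
  -- The Sobolev inequality for the remainders, in the limit: S (1 - θ)₊^(2/q) ≤ S - a(v), where a
  -- is the limit form and θ is the mass kept by `v`.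
  have key := le_of_tendsto_of_tendsto'
    (((hpr.max (tendsto_const_nhds (x := (0:ℝ)))).rpow_const (p := 2 / q)
      (Or.inr hq0.le)).const_mul S) hqr
    fun n => (hSob.comp_add (s (χ n))) _ _ (hrl n)
  have hvS := hSob.of_shift hq hQ hΓ hlim hlim' v h hv
  have hvc := hco.of_shift hQ hlim v h hv
  have hVpos : 0 < quadForm Q' v h := by
    have : 0 < V := hv.integral_sq_pos hv0
    have : 0 < m * (V + ∫ y, h y ^ 2) := mul_pos hm (by linarith [U0 h])
    linarith
  set θ := powForm Γ' q v with hθ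
  -- Compare `key` with S θ₊^(2/q) ≤ a(v). For θ ≤ 0 `key` forces a(v) ≤ 0; for 0 < θ < 1 the sum
  -- contradicts θ^(2/q) + (1 - θ)^(2/q) > 1; for θ > 1 the second bound gives a(v) > S while `key`
  -- gives a(v) ≤ S.
  have hθ1 : θ = 1 := by
    by_contra hne
    rcases le_or_gt θ 0 with h0 | h0
    · have : 1 ≤ (max (1 - θ) 0) ^ (2 / q) :=
        Real.one_le_rpow (le_max_of_le_left (by linarith)) hq0.le
      nlinarith
    · rcases lt_or_gt_of_ne hne with h1 | h1
      · rw [max_eq_left (by linarith)] at key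
        rw [max_eq_left h0.le] at hvS
        have a1 := Real.self_lt_rpow_of_lt_one h0 h1 hq1
        have a2 := Real.self_lt_rpow_of_lt_one (by linarith : 0 < 1 - θ) (by linarith) hq1
        nlinarith
      · have a1 : 1 < (max θ 0) ^ (2 / q) :=
          Real.one_lt_rpow (lt_max_of_lt_left h1) hq0
        have a2 : 0 ≤ (max (1 - θ) 0) ^ (2 / q) := Real.rpow_nonneg (le_max_right _ _) _
        nlinarith [mul_nonneg hS.le a2]
  refine ⟨v, h, hv, hθ1, le_antisymm ?_ ?_⟩
  · rw [hθ1, sub_self, max_self, Real.zero_rpow hq0.ne', mul_zero] at key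
    linarith
  · rw [hθ1, max_eq_left zero_le_one, Real.one_rpow, mul_one] at hvS
    exact hvS

theorem IsH1.powForm_le {u g Γ : ℝ → ℝ} {q M D : ℝ} (hu : IsH1 u g) (hq : 2 < q)
    (hΓ : IsBoundedCoeff Γ D) (hM : ∀ x, |u x| ≤ M) :
    powForm Γ q u ≤ D * (M ^ (q - 2) * ∫ x, u x ^ 2) := by
  rw [powForm, ← integral_const_mul, ← integral_const_mul]
  refine integral_mono (hu.integrable_powForm hq hΓ) ((hu.integrable_sq.const_mul _).const_mul _)
    fun x => ?_
  exact mul_le_mul ((le_abs_self _).trans (hΓ.bound x)) (abs_rpow_le_mul_sq hq (hM x))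
    (by positivity) hΓ.nonneg

/-- Functions with `∫ Γ |u|^q = 1` and bounded `L²` norm cannot be uniformly small. -/
theorem exists_pos_le_abs {Γ : ℝ → ℝ} {q D : ℝ} (hq : 2 < q) (hΓ : IsBoundedCoeff Γ D) (A : ℝ) :
    ∃ ε > 0, ∀ u g, IsH1 u g → ∫ x, u x ^ 2 ≤ A → powForm Γ q u = 1 → ∃ y, ε ≤ |u y| := by
  have hc : Continuous fun ε : ℝ => D * (ε ^ (q - 2) * A) :=
    continuous_const.mul ((continuous_id.rpow_const fun x => Or.inr (by linarith)).mul_const _)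
  have h0 : D * ((0:ℝ) ^ (q - 2) * A) < 1 := by
    rw [Real.zero_rpow (by linarith)]; simp
  obtain ⟨ε, hε, hε0⟩ := (((hc.tendsto 0).eventually (gt_mem_nhds h0)).filter_mono
    nhdsWithin_le_nhds |>.and (self_mem_nhdsWithin (a := (0:ℝ)) (s := Ioi 0))).exists
  have hε0' : 0 < ε := hε0
  refine ⟨ε, hε0', fun u g hu hA hB => ?_⟩
  by_contra! hcon
  have h1 := hu.powForm_le hq hΓ fun x => (hcon x).le
  have h2 : D * (ε ^ (q - 2) * ∫ x, u x ^ 2) ≤ D * (ε ^ (q - 2) * A) := by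
    have := hΓ.nonneg
    gcongr
  linarith

/-- The form is bounded below by a positive constant on `∫ Γ |u|^q = 1`. -/
theorem exists_pos_le_quadForm {Q Γ : ℝ → ℝ} {q D m : ℝ} (hq : 2 < q)
    (hΓ : IsBoundedCoeff Γ D) (hm : 0 < m) (hco : CoerciveOnH1 Q m) :
    ∃ c > 0, ∀ u g, IsH1 u g → powForm Γ q u = 1 → c ≤ quadForm Q u g := by
  set f : ℝ → ℝ := fun a => D * (√(2 * (a / m)) ^ (q - 2) * (a / m)) with hf
  have hc : Continuous f := by
    have h1 : Continuous fun a : ℝ => √(2 * (a / m)) ^ (q - 2) :=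
      Continuous.rpow_const (by fun_prop) fun x => Or.inr (by linarith)
    exact continuous_const.mul (h1.mul (by fun_prop))
  have h0 : f 0 < 1 := by simp [hf]
  obtain ⟨c, hcc, hc0⟩ := (((hc.tendsto 0).eventually (gt_mem_nhds h0)).filter_mono
    nhdsWithin_le_nhds |>.and (self_mem_nhdsWithin (a := (0:ℝ)) (s := Ioi 0))).exists
  have hc0' : 0 < c := hc0
  refine ⟨c, hc0', fun u g hu hB => ?_⟩
  by_contra! hcon
  have U0 : 0 ≤ ∫ x, u x ^ 2 := integral_nonneg fun y => sq_nonneg _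
  have G0 : 0 ≤ ∫ x, g x ^ 2 := integral_nonneg fun y => sq_nonneg _
  have h1 : (∫ x, u x ^ 2) + ∫ x, g x ^ 2 ≤ c / m := by
    rw [le_div_iff₀ hm, mul_comm]; exact (hco u g hu).trans hcon.le
  have h2 := hu.powForm_le hq hΓ fun x => Real.abs_le_sqrt ((hu.sq_le x).trans
    (mul_le_mul_of_nonneg_left h1 (by norm_num : (0:ℝ) ≤ 2)))
  have h3 : D * (√(2 * (c / m)) ^ (q - 2) * ∫ x, u x ^ 2) ≤ f c := by
    have := hΓ.nonneg
    simp only [hf]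
    gcongr
    linarith
  linarith

theorem exists_normalizing_scale {Q Γ u g : ℝ → ℝ} {q : ℝ} (hq : 2 < q)
    (hB : 0 < powForm Γ q u) :
    ∃ c > 0, powForm Γ q (fun x => c * u x) = 1 ∧
      quadForm Q (fun x => c * u x) (fun x => c * g x) * powForm Γ q u ^ (2 / q)
        = quadForm Q u g := by
  set B := powForm Γ q u with hBd
  refine ⟨B ^ (-(1 / q)), by positivity, ?_, ?_⟩
  · rw [powForm_smul, abs_of_pos (by positivity), ← Real.rpow_mul hB.le, ← hBd]
    have : -(1 / q) * q = -1 := by field_simp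
    rw [this, Real.rpow_neg_one]; field_simp
  · rw [quadForm_smul]
    have : (B ^ (-(1 / q))) ^ 2 * B ^ (2 / q) = 1 := by
      rw [← Real.rpow_natCast, ← Real.rpow_mul hB.le, ← Real.rpow_add hB]
      have : -(1 / q) * ((2:ℕ) : ℝ) + 2 / q = 0 := by push_cast; ring
      rw [this, Real.rpow_zero]
    linear_combination quadForm Q u g * this

/-- Minimizing `∫ u'² + Q u²` on `∫ Γ |u|^q = 1`: either the minimum is attained, or the same value
is attained for one of the limit problems at `±∞`. -/
theorem exists_minimizer_or_limit_minimizer {Q Γ Qp Γp Qm Γm : ℝ → ℝ} {C D m q : ℝ} (hq : 2 < q)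
    (hQ : IsBoundedCoeff Q C) (hΓ : IsBoundedCoeff Γ D) (hm : 0 < m) (hco : CoerciveOnH1 Q m)
    (hpos : ∃ u g, IsH1 u g ∧ 0 < powForm Γ q u)
    (hQp : ∀ x, Tendsto (fun n : ℕ => Q (x + n)) atTop (𝓝 (Qp x)))
    (hΓp : ∀ x, Tendsto (fun n : ℕ => Γ (x + n)) atTop (𝓝 (Γp x)))
    (hQm : ∀ x, Tendsto (fun n : ℕ => Q (x + -n)) atTop (𝓝 (Qm x)))
    (hΓm : ∀ x, Tendsto (fun n : ℕ => Γ (x + -n)) atTop (𝓝 (Γm x))) :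
    ∃ S > 0, SobolevBound Q Γ q S ∧ ((∃ v h, IsNormalizedMinimizer Q Γ q S v h) ∨
      (∃ v h, IsNormalizedMinimizer Qp Γp q S v h) ∨
      (∃ v h, IsNormalizedMinimizer Qm Γm q S v h)) := by
  set T : Set ℝ := {a | ∃ u g, IsH1 u g ∧ powForm Γ q u = 1 ∧ quadForm Q u g = a} with hT
  obtain ⟨c, hc0, hc⟩ := exists_pos_le_quadForm hq hΓ hm hco
  have hTne : T.Nonempty := by
    obtain ⟨u, g, hu, hB⟩ := hpos
    obtain ⟨t, -, h1, -⟩ := exists_normalizing_scale (Q := Q) (g := g) hq hB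
    exact ⟨_, _, _, hu.const_mul t, h1, rfl⟩
  have hTb : BddBelow T := ⟨c, by rintro _ ⟨u, g, hu, h1, rfl⟩; exact hc u g hu h1⟩
  set S := sInf T with hS
  have hS0 : 0 < S := hc0.trans_le
    (le_csInf hTne (by rintro _ ⟨u, g, hu, h1, rfl⟩; exact hc u g hu h1))
  have hSob : SobolevBound Q Γ q S := by
    intro u g hu
    have hq0 : 0 < 2 / q := by positivity
    rcases le_or_gt (powForm Γ q u) 0 with h0 | h0
    · rw [max_eq_right h0, Real.zero_rpow hq0.ne', mul_zero]
      refine le_trans (mul_nonneg hm.le (add_nonneg ?_ ?_)) (hco u g hu) <;>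
        exact integral_nonneg fun y => sq_nonneg _
    · rw [max_eq_left h0.le]
      obtain ⟨t, -, h1, h2⟩ := exists_normalizing_scale (Q := Q) (g := g) hq h0
      rw [← h2]
      gcongr
      exact csInf_le hTb ⟨_, _, hu.const_mul t, h1, rfl⟩
  refine ⟨S, hS0, hSob, ?_⟩
  obtain ⟨a, -, ha, haT⟩ := exists_seq_tendsto_sInf hTne hTb
  choose u g hu hB hua using haT
  have ha' : Tendsto (fun n => quadForm Q (u n) (g n)) atTop (𝓝 S) := by
    simpa only [hua] using ha
  obtain ⟨A, hA⟩ : ∃ A, ∀ n, quadForm Q (u n) (g n) ≤ A := by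
    obtain ⟨A, hA⟩ := ha'.bddAbove_range
    exact ⟨A, fun n => hA ⟨n, rfl⟩⟩
  obtain ⟨ε, hε, hlarge⟩ := exists_pos_le_abs hq hΓ (A / m)
  have hy : ∀ n, ∃ y, ε ≤ |u n y| := fun n => by
    refine hlarge _ _ (hu n) ?_ (hB n)
    rw [le_div_iff₀ hm, mul_comm]
    have h1 := (hco _ _ (hu n)).trans (hA n)
    have G0 : 0 ≤ ∫ x, g n x ^ 2 := integral_nonneg fun y => sq_nonneg _
    nlinarith
  choose y hy using hy
  -- The limits of the coefficients are known along integer shifts only. The concentration points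
  -- are rounded down, and the leftover, at most 1, stays in a fixed window.
  set k : ℕ → ℤ := fun n => ⌊y n⌋ with hk
  have main : ∀ (φ : ℕ → ℕ) (_ : StrictMono φ) (Q' Γ' : ℝ → ℝ) (s : ℕ → ℝ) (R : ℝ)
      (_ : ∀ x, Tendsto (fun n => Q (x + s n)) atTop (𝓝 (Q' x)))
      (_ : ∀ x, Tendsto (fun n => Γ (x + s n)) atTop (𝓝 (Γ' x)))
      (_ : ∀ n, |y (φ n) - s n| ≤ R), ∃ v h, IsNormalizedMinimizer Q' Γ' q S v h := by
    intro φ hφ Q' Γ' s R h1 h2 h3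
    refine exists_minimizer_of_nonvanishing hq hQ hΓ hm hco hS0 hSob s h1 h2 (fun n => u (φ n))
      (fun n => g (φ n)) (fun n => hu _) (fun n => hB _) (ha'.comp hφ.tendsto_atTop) hε
      (fun n => y (φ n) - s n) h3 fun n => ?_
    simpa using hy (φ n)
  have hfl : ∀ n, |y n - k n| ≤ 1 := fun n => by
    have h1 := Int.floor_le (y n)
    have h2 := Int.lt_floor_add_one (y n)
    rw [abs_le]; constructor <;> simp only [hk] <;> linarith
  -- If the concentration points stay bounded along a subsequence, no shift is needed and the
  -- original problem has a minimizer. Otherwise they escape, along a subsequence, to one of the two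
  -- ends.
  by_cases hb : ∃ R : ℕ, ∃ᶠ n in atTop, (k n).natAbs ≤ R
  · left
    obtain ⟨R, hR⟩ := hb
    obtain ⟨φ, hφ, hφR⟩ := extraction_of_frequently_atTop hR
    refine main φ hφ Q Γ (fun _ => 0) (R + 1) (fun x => by simp) (fun x => by simp) fun n => ?_
    have h1 : |((k (φ n) : ℤ) : ℝ)| ≤ R := by
      rw [← Int.cast_abs, Int.abs_eq_natAbs]; exact_mod_cast hφR n
    have h2 := hfl (φ n)
    have h3 := abs_sub_abs_le_abs_sub (y (φ n)) (k (φ n))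
    rw [sub_zero]; linarith
  · right
    have hlim : Tendsto (fun n => (k n).natAbs) atTop atTop := by
      rw [tendsto_atTop]
      intro R
      have : ∀ᶠ n in atTop, ¬ (k n).natAbs ≤ R := not_frequently.1 fun h => hb ⟨R, h⟩
      filter_upwards [this] with n hn using by omega
    by_cases hf : ∃ᶠ n in atTop, 0 ≤ k n
    · left
      obtain ⟨φ, hφ, hφk⟩ := extraction_of_frequently_atTop hf
      have hl := hlim.comp hφ.tendsto_atTop
      refine main φ hφ Qp Γp (fun n => ((k (φ n)).natAbs : ℝ)) 1
        (fun x => (hQp x).comp hl) (fun x => (hΓp x).comp hl) fun n => ?_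
      have : (((k (φ n)).natAbs : ℕ) : ℝ) = ((k (φ n) : ℤ) : ℝ) := by
        rw [← Int.cast_natCast, Int.natAbs_of_nonneg (hφk n)]
      rw [this]; exact hfl _
    · right
      have hf' : ∃ᶠ n in atTop, k n < 0 := by
        refine Eventually.frequently ?_
        filter_upwards [not_frequently.1 hf] with n hn using not_le.1 hn
      obtain ⟨φ, hφ, hφk⟩ := extraction_of_frequently_atTop hf'
      have hl := hlim.comp hφ.tendsto_atTop
      refine main φ hφ Qm Γm (fun n => -((k (φ n)).natAbs : ℝ)) 1
        (fun x => (hQm x).comp hl) (fun x => (hΓm x).comp hl) fun n => ?_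
      have : -(((k (φ n)).natAbs : ℕ) : ℝ) = ((k (φ n) : ℤ) : ℝ) := by
        rw [← Int.cast_natCast, Int.ofNat_natAbs_of_nonpos (hφk n).le]; push_cast; ring
      rw [this]; exact hfl _

/-- If all integrals over intervals were nonpositive, a primitive of Γ would be antitone, and its
derivative, which is Γ almost everywhere, nonpositive. -/
theorem exists_intervalIntegral_pos {Γ : ℝ → ℝ} (hΓ : LocallyIntegrable Γ volume)
    (hpos : ¬ ∀ᵐ x, Γ x ≤ 0) : ∃ a b, a < b ∧ 0 < ∫ x in a..b, Γ x := by
  by_contra! hcon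
  refine hpos ?_
  filter_upwards [LocallyIntegrable.ae_hasDerivAt_integral hΓ] with x hx
  have hanti : Antitone fun y => ∫ t in (0:ℝ)..y, Γ t := by
    intro a b hab
    rcases hab.eq_or_lt with rfl | h
    · exact le_rfl
    have := hcon a b h
    have e := intervalIntegral.integral_interval_sub_left
      (IsPrimitive.locallyIntegrable_intervalIntegrable hΓ 0 b)
      (IsPrimitive.locallyIntegrable_intervalIntegrable hΓ 0 a)
    simp only
    linarith
  have := (hx 0).deriv
  rw [← this]
  exact hanti.deriv_nonpos

/-- Smooth bumps with inner radius increasing to the outer one converge to the indicator of an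
interval on which Γ has positive integral. They take values in [0, 1], so the power q disappears in
the limit. -/
theorem exists_powForm_pos {Γ : ℝ → ℝ} {D q : ℝ} (hq : 2 < q) (hΓ : IsBoundedCoeff Γ D)
    (hpos : ¬ ∀ᵐ x, Γ x ≤ 0) : ∃ u g, IsH1 u g ∧ 0 < powForm Γ q u := by
  have hloc : LocallyIntegrable Γ volume := by
    rw [locallyIntegrable_iff]
    intro k hk
    refine Measure.integrableOn_of_bounded hk.measure_lt_top.ne hΓ.aesm (M := D) ?_
    exact Eventually.of_forall hΓ.bound
  obtain ⟨a, b, hab, hI⟩ := exists_intervalIntegral_pos hloc hpos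
  set c := (a + b) / 2 with hc
  set ρ := (b - a) / 2 with hρ
  have hρ0 : 0 < ρ := by rw [hρ]; linarith
  let B : ℕ → ContDiffBump c := fun n => ⟨ρ * ((n + 1) / (n + 2)), ρ, by positivity, by
    have : ((n:ℝ) + 1) / (n + 2) < 1 := by rw [div_lt_one (by positivity)]; linarith
    nlinarith⟩
  have hH1 : ∀ n, IsH1 (B n) (deriv (B n)) := fun n => by
    have hb : ContDiff ℝ 1 (B n) := (B n).contDiff
    have hbc : Continuous (deriv (B n)) := hb.continuous_deriv le_rfl
    exact ⟨.of_contDiff hb, hb.continuous.memLp_of_hasCompactSupport (B n).hasCompactSupport,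
      hbc.memLp_of_hasCompactSupport (B n).hasCompactSupport.deriv⟩
  have hball : Metric.ball c ρ = Ioo a b := by
    rw [Real.ball_eq_Ioo, hc, hρ]; congr 1 <;> ring
  have hzero : ∀ n x, x ∉ Ioo a b → B n x = 0 := fun n x hx => by
    refine (B n).zero_of_le_dist ?_
    rw [← hball, Metric.mem_ball, not_lt] at hx
    exact hx
  have hlim : Tendsto (fun n => powForm Γ q (B n)) atTop (𝓝 (∫ x in a..b, Γ x)) := by
    have e : ∫ x in a..b, Γ x = ∫ x, (Ioo a b).indicator Γ x := by
      rw [intervalIntegral.integral_of_le hab.le, integral_Ioc_eq_integral_Ioo,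
        integral_indicator measurableSet_Ioo]
    rw [e]
    refine tendsto_integral_of_dominated_convergence ((Ioo a b).indicator fun _ => D)
      (fun n => ((hH1 n).integrable_powForm hq hΓ).aestronglyMeasurable) ?_
      (fun n => Eventually.of_forall fun x => ?_) (Eventually.of_forall fun x => ?_)
    · exact (integrable_indicator_iff measurableSet_Ioo).2 (integrableOn_const (by simp))
    · by_cases hx : x ∈ Ioo a b
      · rw [indicator_of_mem hx, norm_mul, Real.norm_eq_abs, Real.norm_eq_abs]
        have h1 : |(|B n x| ^ q)| ≤ 1 := by
          rw [abs_of_nonneg (by positivity), abs_of_nonneg (B n).nonneg]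
          exact Real.rpow_le_one (B n).nonneg (B n).le_one (by linarith)
        exact (mul_le_mul (hΓ.bound x) h1 (abs_nonneg _) hΓ.nonneg).trans (by rw [mul_one])
      · rw [indicator_of_notMem hx, hzero n x hx]
        simp [Real.zero_rpow (by linarith : q ≠ 0)]
    · by_cases hx : x ∈ Ioo a b
      · rw [indicator_of_mem hx]
        rw [← hball, Metric.mem_ball] at hx
        have h1 : Tendsto (fun n : ℕ => ρ * (((n:ℝ) + 1) / (n + 2))) atTop (𝓝 (ρ * 1)) := by
          refine Tendsto.const_mul ρ ?_
          have : Tendsto (fun n : ℕ => 1 - 1 / ((n:ℝ) + 1 + 1)) atTop (𝓝 (1 - 0)) := by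
            refine Tendsto.const_sub 1 ?_
            exact_mod_cast (tendsto_one_div_add_atTop_nhds_zero_nat (𝕜 := ℝ)).comp
              (tendsto_add_atTop_nat 1)
          rw [sub_zero] at this
          refine this.congr fun n => ?_
          field_simp; ring
        rw [mul_one] at h1
        refine tendsto_const_nhds.congr' ?_
        filter_upwards [h1.eventually (lt_mem_nhds hx)] with n hn
        have : B n x = 1 := (B n).one_of_mem_closedBall (Metric.mem_closedBall.2 hn.le)
        simp [this]
      · rw [indicator_of_notMem hx]
        simp [hzero _ x hx, Real.zero_rpow (by linarith : q ≠ 0)]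
  obtain ⟨n, hn⟩ := (hlim.eventually (lt_mem_nhds hI)).exists
  exact ⟨_, _, hH1 n, hn⟩

/-! ### Replacing the tail of a minimizer by an exponential solution -/

/-- A positive solution of `-φ'' + Q φ = 0` comparable to `e^{κ x}`, where `ψ = φ'`. -/
structure IsExpSolution (Q φ ψ : ℝ → ℝ) (κ K : ℝ) : Prop where
  prim : IsPrimitive φ ψ
  prim_deriv : IsPrimitive ψ (fun x => Q x * φ x)
  kappa_pos : 0 < κ
  K_pos : 0 < K
  lower : ∀ x, Real.exp (κ * x) ≤ K * φ x
  upper : ∀ x, φ x ≤ K * Real.exp (κ * x)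
  deriv_le : ∀ x, |ψ x| ≤ K * Real.exp (κ * x)

/-- `w` with its part to the left of `y` replaced by the multiple of `φ` with the same value at
`y`. -/
noncomputable def tailReplace (φ w : ℝ → ℝ) (y x : ℝ) : ℝ :=
  if x < y then w y / φ y * φ x else w x

/-- The derivative of `tailReplace φ w y`. -/
noncomputable def tailReplaceDeriv (φ ψ w g : ℝ → ℝ) (y x : ℝ) : ℝ :=
  if x < y then w y / φ y * ψ x else g x

theorem memLp_ite_exp {f g : ℝ → ℝ} {κ K y : ℝ} (hκ : 0 < κ) (hf : AEStronglyMeasurable f volume)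
    (hfb : ∀ x, |f x| ≤ K * Real.exp (κ * x)) (hg : MemLp g 2 volume) :
    MemLp (fun x => if x < y then f x else g x) 2 volume := by
  have e : (fun x => if x < y then f x else g x) = (Iio y).piecewise f g := by
    ext x; simp [Set.piecewise]
  rw [e]
  refine MemLp.piecewise measurableSet_Iio ?_ (hg.restrict _)
  rw [memLp_two_iff_integrable_sq hf.restrict]
  have h1 : IntegrableOn (fun x => K ^ 2 * Real.exp ((2 * κ) * x)) (Iio y) :=
    ((integrableOn_exp_mul_Iic (by positivity : 0 < 2 * κ) y).mono_set Iio_subset_Iic_self).const_mul _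
  refine h1.mono' (hf.restrict.pow 2) (Eventually.of_forall fun x => ?_)
  rw [Real.norm_of_nonneg (by positivity), ← sq_abs]
  calc |f x| ^ 2 ≤ (K * Real.exp (κ * x)) ^ 2 := by gcongr; exact hfb x
    _ = K ^ 2 * Real.exp (2 * κ * x) := by
      rw [mul_pow, ← Real.exp_nat_mul]; congr 2; push_cast; ring

namespace IsExpSolution

variable {Q φ ψ w g : ℝ → ℝ} {κ K C y : ℝ}

theorem pos (h : IsExpSolution Q φ ψ κ K) (x : ℝ) : 0 < φ x := by
  have h1 := (Real.exp_pos (κ * x)).trans_le (h.lower x)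
  exact (pos_iff_pos_of_mul_pos h1).1 h.K_pos

theorem abs_ratio_le (h : IsExpSolution Q φ ψ κ K) (a y : ℝ) :
    |a / φ y| ≤ |a| * (K * Real.exp (-(κ * y))) := by
  rw [abs_div, abs_of_pos (h.pos y), div_le_iff₀ (h.pos y), mul_assoc]
  refine le_mul_of_one_le_right (abs_nonneg _) ?_
  have := mul_le_mul_of_nonneg_right (h.lower y) (Real.exp_pos (-(κ * y))).le
  rw [← Real.exp_add, add_neg_cancel, Real.exp_zero] at this
  linarith

theorem isH1_tailReplace (h : IsExpSolution Q φ ψ κ K) (hw : IsH1 w g) (y : ℝ) :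
    IsH1 (tailReplace φ w y) (tailReplaceDeriv φ ψ w g y) := by
  refine ⟨?_, ?_, ?_⟩
  · exact (h.prim.const_mul (w y / φ y)).ite hw.prim y (by field_simp [(h.pos y).ne'])
  · refine memLp_ite_exp (K := |w y / φ y| * K) h.kappa_pos
      (h.prim.continuous.const_mul _).aestronglyMeasurable (fun x => ?_) hw.memLp
    rw [abs_mul, mul_assoc, abs_of_pos (h.pos x)]
    exact mul_le_mul_of_nonneg_left (h.upper x) (abs_nonneg _)
  · refine memLp_ite_exp (K := |w y / φ y| * K) h.kappa_pos
      (h.prim_deriv.continuous.const_mul _).aestronglyMeasurable (fun x => ?_) hw.memLp_deriv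
    rw [abs_mul, mul_assoc]
    exact mul_le_mul_of_nonneg_left (h.deriv_le x) (abs_nonneg _)

/-- Replacing the tail lowers the quadratic form by exactly the form of the difference. -/
theorem quadForm_tailReplace (h : IsExpSolution Q φ ψ κ K) (hQ : IsBoundedCoeff Q C)
    (hw : IsH1 w g) (y : ℝ) :
    quadForm Q (tailReplace φ w y) (tailReplaceDeriv φ ψ w g y)
      = quadForm Q w g - quadForm Q (fun x => w x - tailReplace φ w y x)
        (fun x => g x - tailReplaceDeriv φ ψ w g y x) := by
  have hz := h.isH1_tailReplace hw y
  have hr := hw.sub hz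
  have e := hz.quadForm_add hr hQ
  simp only [add_sub_cancel] at e
  rw [e]
  set c := w y / φ y with hc
  -- Orthogonality of the new function to the removed part: to the left of `y` the integrand is the
  -- derivative of c ψ (w - c φ), which vanishes at `y` by the choice of c and decays at -∞; to the
  -- right the difference is zero.
  have hb : bilinForm Q (tailReplace φ w y) (tailReplaceDeriv φ ψ w g y)
      (fun x => w x - tailReplace φ w y x) (fun x => g x - tailReplaceDeriv φ ψ w g y x) = 0 := by
    have hi := hz.integrable_bilinForm hr hQ
    rw [bilinForm]
    have e1 : ∀ x, tailReplaceDeriv φ ψ w g y x * (g x - tailReplaceDeriv φ ψ w g y x)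
        + Q x * (tailReplace φ w y x * (w x - tailReplace φ w y x))
        = (Iio y).indicator (fun x => c * (Q x * φ x * (w x - c * φ x) + ψ x * (g x - c * ψ x))) x := by
      intro x
      by_cases hx : x < y
      · rw [indicator_of_mem (show x ∈ Iio y from hx)]
        simp only [tailReplace, tailReplaceDeriv, if_pos hx]; ring
      · rw [indicator_of_notMem (show x ∉ Iio y from hx)]
        simp only [tailReplace, tailReplaceDeriv, if_neg hx]; ring
    simp only [e1] at hi ⊢
    rw [integrable_indicator_iff measurableSet_Iio] at hi
    rw [integral_indicator measurableSet_Iio, ← integral_Iic_eq_integral_Iio]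
    have hi' : IntegrableOn (fun x => c * (Q x * φ x * (w x - c * φ x) + ψ x * (g x - c * ψ x)))
        (Iic y) := by rwa [integrableOn_Iic_iff_integrableOn_Iio]
    have t1 := intervalIntegral_tendsto_integral_Iic y hi' tendsto_id
    refine tendsto_nhds_unique t1 ?_
    have hprod := h.prim_deriv.integral_mul (hw.prim.sub (h.prim.const_mul c))
    simp only [intervalIntegral.integral_const_mul, hprod, id]
    have hcy : w y - c * φ y = 0 := by
      rw [hc]; field_simp [(h.pos y).ne']; ring
    simp only [hcy, mul_zero, zero_sub]
    have hexp : Tendsto (fun x => K * Real.exp (κ * x)) atBot (𝓝 0) := by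
      have : Tendsto (fun x : ℝ => κ * x) atBot atBot := tendsto_id.const_mul_atBot h.kappa_pos
      simpa using (Real.tendsto_exp_atBot.comp this).const_mul K
    have tφ : Tendsto φ atBot (𝓝 0) := squeeze_zero (fun x => (h.pos x).le) h.upper hexp
    have tψ : Tendsto ψ atBot (𝓝 0) := squeeze_zero_norm h.deriv_le hexp
    have := ((tψ.mul (hw.tendsto_atBot.sub (tφ.const_mul c))).neg).const_mul c
    simpa using this
  rw [hb]; ring

/-- The replaced tail is at most |a| K² e^(κ(x - y)), whose q-th power integrates to a multiple of
|a|^q with a constant independent of `y`. -/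
theorem integral_tail_rpow_le (h : IsExpSolution Q φ ψ κ K) {q : ℝ} (hq : 2 < q) (a y : ℝ) :
    IntegrableOn (fun x => |a / φ y * φ x| ^ q) (Iio y) ∧
    ∫ x in Iio y, |a / φ y * φ x| ^ q ≤ (K ^ 2) ^ q / (q * κ) * |a| ^ q := by
  have hκ := h.kappa_pos
  have hK := h.K_pos
  set E := (|a| * K ^ 2) ^ q * Real.exp (-(q * κ * y)) with hE
  have hb : ∀ x, |a / φ y * φ x| ^ q ≤ E * Real.exp ((q * κ) * x) := by
    intro x
    have h1 : |a / φ y * φ x| ≤ |a| * K ^ 2 * Real.exp (κ * x - κ * y) := by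
      rw [abs_mul, abs_of_pos (h.pos x), sub_eq_add_neg, Real.exp_add]
      calc _ ≤ |a| * (K * Real.exp (-(κ * y))) * (K * Real.exp (κ * x)) :=
            mul_le_mul (h.abs_ratio_le a y) (h.upper x) (h.pos x).le (by positivity)
        _ = _ := by ring
    refine (Real.rpow_le_rpow (abs_nonneg _) h1 (by linarith)).trans (le_of_eq ?_)
    rw [Real.mul_rpow (by positivity) (by positivity), ← Real.exp_mul, hE, mul_assoc,
      ← Real.exp_add]
    congr 2; ring
  have hi : IntegrableOn (fun x => E * Real.exp ((q * κ) * x)) (Iio y) :=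
    ((integrableOn_exp_mul_Iic (by positivity : 0 < q * κ) y).mono_set
      Iio_subset_Iic_self).const_mul _
  have hm : IntegrableOn (fun x => |a / φ y * φ x| ^ q) (Iio y) := by
    refine hi.mono' ?_ (Eventually.of_forall fun x => ?_)
    · have : Continuous fun x => |a / φ y * φ x| ^ q :=
        (h.prim.continuous.const_mul _).abs.rpow_const fun x => Or.inr (by linarith)
      exact this.aestronglyMeasurable.restrict
    · rw [Real.norm_of_nonneg (by positivity)]; exact hb x
  refine ⟨hm, (setIntegral_mono hm hi hb).trans (le_of_eq ?_)⟩
  rw [integral_const_mul, ← integral_Iic_eq_integral_Iio, integral_exp_mul_Iic (by positivity), hE,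
    Real.mul_rpow (abs_nonneg _) (by positivity), mul_div_assoc', mul_assoc _ (Real.exp _),
    ← Real.exp_add]
  simp only [neg_add_cancel, Real.exp_zero]
  ring

/-- Only the part to the left of `y` changes. The one-sided bound suffices, because only a loss in
the constraint can spoil a test function. -/
theorem abs_powForm_tailReplace_sub_le (h : IsExpSolution Q φ ψ κ K) {q D : ℝ} (hq : 2 < q)
    {Γ : ℝ → ℝ} (hΓ : IsBoundedCoeff Γ D) (hw : IsH1 w g) (y : ℝ) :
    powForm Γ q w - D * ((∫ x in Iio y, |w x| ^ q) + (K ^ 2) ^ q / (q * κ) * |w y| ^ q)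
      ≤ powForm Γ q (tailReplace φ w y) := by
  have hz := h.isH1_tailReplace hw y
  obtain ⟨hi, hle⟩ := h.integral_tail_rpow_le hq (w y) y
  have hwi := (hw.integrable_rpow hq).integrableOn (s := Iio y)
  have hD := hΓ.nonneg
  have h1 : powForm Γ q w - powForm Γ q (tailReplace φ w y)
      ≤ D * ((∫ x in Iio y, |w x| ^ q) + ∫ x in Iio y, |w y / φ y * φ x| ^ q) := by
    have i0 : IntegrableOn (fun x => D * (|w x| ^ q + |w y / φ y * φ x| ^ q)) (Iio y) :=
      (hwi.add hi).const_mul D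
    rw [powForm, powForm, ← integral_sub (hw.integrable_powForm hq hΓ)
      (hz.integrable_powForm hq hΓ), ← integral_add hwi hi, ← integral_const_mul,
      ← integral_indicator measurableSet_Iio]
    refine integral_mono ((hw.integrable_powForm hq hΓ).sub (hz.integrable_powForm hq hΓ))
      ((integrable_indicator_iff measurableSet_Iio).2 i0) fun x => ?_
    simp only
    by_cases hx : x < y
    · rw [indicator_of_mem (show x ∈ Iio y from hx)]
      simp only [tailReplace, if_pos hx]
      have a1 : 0 ≤ |w x| ^ q := by positivity
      have a2 : 0 ≤ |w y / φ y * φ x| ^ q := by positivity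
      have b := abs_le.1 (hΓ.bound x)
      nlinarith [mul_le_mul_of_nonneg_right b.2 a1, mul_le_mul_of_nonneg_right b.1 a2]
    · rw [indicator_of_notMem (show x ∉ Iio y from hx)]
      simp only [tailReplace, if_neg hx, sub_self, le_refl]
  have h2 := mul_le_mul_of_nonneg_left (add_le_add_right hle (∫ x in Iio y, |w x| ^ q)) hD
  linarith

end IsExpSolution

theorem abs_add_rpow_le {q : ℝ} (hq : 0 ≤ q) (a b : ℝ) :
    |a + b| ^ q ≤ 2 ^ q * (|a| ^ q + |b| ^ q) := by
  have h1 : |a + b| ≤ 2 * max |a| |b| := by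
    have := abs_add_le a b
    have := le_max_left |a| |b|
    have := le_max_right |a| |b|
    linarith
  have h0 : 0 ≤ max |a| |b| := (abs_nonneg a).trans (le_max_left _ _)
  refine (Real.rpow_le_rpow (abs_nonneg _) h1 hq).trans ?_
  rw [Real.mul_rpow (by norm_num) h0]
  gcongr
  have ha : 0 ≤ |a| ^ q := by positivity
  have hb : 0 ≤ |b| ^ q := by positivity
  rcases max_choice |a| |b| with h | h <;> rw [h] <;> linarith

/-- Since 2/q ≤ 1, t ≤ t^(2/q) on [0, 1]; a deficit in the constraint therefore costs at most a
linear amount in the lower bound. -/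
theorem SobolevBound.mul_one_sub_le {Q Γ : ℝ → ℝ} {q S X : ℝ} (hq : 2 < q) (hS : 0 < S)
    (h : SobolevBound Q Γ q S) {u g : ℝ → ℝ} (hu : IsH1 u g) (hX : 0 ≤ X)
    (hB : 1 - X ≤ powForm Γ q u) : S * (1 - X) ≤ quadForm Q u g := by
  refine le_trans ?_ (h u g hu)
  gcongr
  have hq0 : 0 < 2 / q := by positivity
  have hq1 : 2 / q ≤ 1 := by rw [div_le_one (by linarith)]; exact hq.le
  rcases le_or_gt (1 - X) 0 with h0 | h0
  · exact h0.trans (Real.rpow_nonneg (le_max_right _ _) _)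
  · refine (Real.self_le_rpow_of_le_one h0.le (by linarith) hq1).trans ?_
    exact Real.rpow_le_rpow h0.le (hB.trans (le_max_left _ _)) hq0.le

namespace IsExpSolution

variable {Q Γ φ ψ w g : ℝ → ℝ} {κ K C D m S q : ℝ}

/-- Where a minimizer is small to the left of `y`, its tail is governed by its value at `y`. -/
theorem exists_tail_estimate (h : IsExpSolution Q φ ψ κ K) (hq : 2 < q)
    (hQ : IsBoundedCoeff Q C) (hΓ : IsBoundedCoeff Γ D) (hm : 0 < m) (hco : CoerciveOnH1 Q m)
    (hS : 0 < S) (hSob : SobolevBound Q Γ q S) (hw : IsNormalizedMinimizer Q Γ q S w g) :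
    ∃ η > 0, ∃ B, 0 ≤ B ∧ ∀ y, (∀ x ≤ y, |w x| ≤ η) →
      (∫ x in Iio y, |w x| ^ q) ≤ B * |w y| ^ q ∧
      (∫ x, (w x - tailReplace φ w y x) ^ 2) ≤ B * |w y| ^ q := by
  obtain ⟨hw1, hwB, hwS⟩ := hw
  have hκ := h.kappa_pos
  have hK := h.K_pos
  have hD := hΓ.nonneg
  set C1 := (K ^ 2) ^ q / (q * κ) with hC1
  have hC10 : 0 ≤ C1 := by positivity
  -- choice of the smallness parameter
  obtain ⟨η, hη0, hηs⟩ : ∃ η > 0, 2 ^ q * (((1 + K ^ 2) * η) ^ (q - 2) * (S * D / m)) ≤ 1 / 2 := by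
    have hc : Continuous fun η : ℝ => 2 ^ q * (((1 + K ^ 2) * η) ^ (q - 2) * (S * D / m)) :=
      continuous_const.mul (((by fun_prop : Continuous fun η : ℝ => (1 + K ^ 2) * η).rpow_const
        fun x => Or.inr (by linarith)).mul_const _)
    have h0 : 2 ^ q * (((1 + K ^ 2) * (0:ℝ)) ^ (q - 2) * (S * D / m)) < 1 / 2 := by
      rw [mul_zero, Real.zero_rpow (by linarith)]; simp
    obtain ⟨ε, hε, hε0⟩ := (((hc.tendsto 0).eventually (gt_mem_nhds h0)).filter_mono
      nhdsWithin_le_nhds |>.and (self_mem_nhdsWithin (a := (0:ℝ)) (s := Ioi 0))).exists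
    exact ⟨ε, hε0, hε.le⟩
  set B1 := C1 + 2 * (2 ^ q * C1) with hB1
  have hB10 : 0 ≤ B1 := by positivity
  refine ⟨η, hη0, max B1 (S * D / m * (B1 + C1)), le_max_of_le_left hB10, fun y hy => ?_⟩
  set W := |w y| ^ q with hW
  have hW0 : 0 ≤ W := by positivity
  set T := ∫ x in Iio y, |w x| ^ q with hT
  have hT0 : 0 ≤ T := integral_nonneg fun x => by positivity
  have hz := h.isH1_tailReplace hw1 y
  have hr := hw1.sub hz
  set r : ℝ → ℝ := fun x => w x - tailReplace φ w y x with hrdef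
  set R2 := ∫ x, r x ^ 2 with hR2
  have hR20 : 0 ≤ R2 := integral_nonneg fun x => sq_nonneg _
  -- minimality
  have h1 : R2 ≤ S * D / m * (T + C1 * W) := by
    have a1 := h.abs_powForm_tailReplace_sub_le hq hΓ hw1 y
    rw [hwB] at a1
    -- The form drops exactly by that of the removed part, yet can drop by no more than `S * X`;
    -- coercivity turns this into the bound on `R2`.
    have a2 := hSob.mul_one_sub_le hq hS hz (X := D * (T + C1 * W)) (by positivity) a1
    rw [h.quadForm_tailReplace hQ hw1 y, hwS] at a2
    have a3 := hco _ _ hr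
    have a4 : m * R2 ≤ m * (R2 + ∫ x, (g x - tailReplaceDeriv φ ψ w g y x) ^ 2) := by
      gcongr
      exact le_add_of_nonneg_right (integral_nonneg fun x => sq_nonneg _)
    rw [div_mul_eq_mul_div, le_div_iff₀ hm]
    linarith
  -- absorption
  have h2 : T ≤ 2 ^ q * (((1 + K ^ 2) * η) ^ (q - 2) * R2 + C1 * W) := by
    obtain ⟨hi, hle⟩ := h.integral_tail_rpow_le hq (w y) y
    have hwi := (hw1.integrable_rpow hq).integrableOn (s := Iio y)
    have hri := (hr.integrable_rpow hq).integrableOn (s := Iio y)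
    have b1 : T ≤ ∫ x in Iio y, 2 ^ q * (|r x| ^ q + |w y / φ y * φ x| ^ q) := by
      refine setIntegral_mono_on hwi ((hri.add hi).const_mul _) measurableSet_Iio fun x hx => ?_
      have : w x = r x + w y / φ y * φ x := by
        simp only [hrdef, tailReplace, if_pos (show x < y from hx)]; ring
      conv_lhs => rw [this]
      exact abs_add_rpow_le (by linarith) _ _
    rw [integral_const_mul, integral_add hri hi] at b1
    -- On the tail both `w` and its replacement are small, so |r| ≤ (1 + K²) η there and q - 2
    -- powers of η are gained.
    have b2 : ∫ x in Iio y, |r x| ^ q ≤ ((1 + K ^ 2) * η) ^ (q - 2) * R2 := by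
      have c1 : ∫ x in Iio y, |r x| ^ q ≤ ∫ x in Iio y, ((1 + K ^ 2) * η) ^ (q - 2) * r x ^ 2 := by
        refine setIntegral_mono_on hri (hr.integrable_sq.integrableOn.const_mul _)
          measurableSet_Iio fun x hx => ?_
        refine abs_rpow_le_mul_sq hq ?_
        have hx' : x < y := hx
        simp only [hrdef, tailReplace, if_pos hx']
        have d1 : |w y / φ y * φ x| ≤ K ^ 2 * η := by
          rw [abs_mul, abs_of_pos (h.pos x)]
          calc _ ≤ |w y| * (K * Real.exp (-(κ * y))) * (K * Real.exp (κ * x)) :=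
                mul_le_mul (h.abs_ratio_le _ y) (h.upper x) (h.pos x).le (by positivity)
            _ = K ^ 2 * |w y| * Real.exp (κ * x - κ * y) := by
                rw [sub_eq_add_neg, Real.exp_add]; ring
            _ ≤ K ^ 2 * η * 1 := by
                gcongr
                · exact hy y le_rfl
                · rw [Real.exp_le_one_iff]; nlinarith
            _ = _ := mul_one _
        calc _ ≤ |w x| + |w y / φ y * φ x| := abs_sub _ _
          _ ≤ η + K ^ 2 * η := add_le_add (hy x hx'.le) d1
          _ = _ := by ring
      refine c1.trans ?_
      rw [integral_const_mul]
      gcongr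
      exact setIntegral_le_integral hr.integrable_sq (Eventually.of_forall fun x => sq_nonneg _)
    refine b1.trans ?_
    gcongr
  -- By the choice of η the two previous bounds combine to T ≤ (T + C1 W)/2 + 2^q C1 W; absorbing
  -- T/2 gives exactly the constant `B1`.
  have h3 : T ≤ B1 * W := by
    have c1 : 2 ^ q * (((1 + K ^ 2) * η) ^ (q - 2) * R2)
        ≤ 2 ^ q * (((1 + K ^ 2) * η) ^ (q - 2) * (S * D / m * (T + C1 * W))) := by gcongr
    have c2 : 2 ^ q * (((1 + K ^ 2) * η) ^ (q - 2) * (S * D / m)) * (T + C1 * W)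
        ≤ 1 / 2 * (T + C1 * W) := by gcongr
    have e : 2 ^ q * (((1 + K ^ 2) * η) ^ (q - 2) * (S * D / m * (T + C1 * W)))
      = 2 ^ q * (((1 + K ^ 2) * η) ^ (q - 2) * (S * D / m)) * (T + C1 * W) := by ring
    rw [mul_add] at h2
    rw [hB1]
    nlinarith
  refine ⟨h3.trans (by gcongr; exact le_max_left _ _), h1.trans ?_⟩
  calc S * D / m * (T + C1 * W) ≤ S * D / m * (B1 * W + C1 * W) := by gcongr
    _ = S * D / m * (B1 + C1) * W := by ring
    _ ≤ _ := by gcongr; exact le_max_right _ _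

/-- A minimizer does not vanish where it is small to the left. -/
theorem ne_zero_of_tail_estimate (h : IsExpSolution Q φ ψ κ K) (hq : 2 < q) (hw : IsH1 w g)
    (hne : ∃ x, w x ≠ 0) {η B : ℝ} (hη : 0 < η) (hB : 0 ≤ B)
    (hest : ∀ y, (∀ x ≤ y, |w x| ≤ η) →
      (∫ x, (w x - tailReplace φ w y x) ^ 2) ≤ B * |w y| ^ q)
    {y : ℝ} (hy : ∀ x ≤ y, |w x| ≤ η) : w y ≠ 0 := by
  intro hy0
  have hκ := h.kappa_pos
  have hK := h.K_pos
  have hzero : ∀ x ≤ y, w x = 0 := by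
    intro x hx
    rcases hx.eq_or_lt with rfl | hx
    · exact hy0
    by_contra hx0
    have h1 := hest y hy
    rw [hy0, abs_zero, Real.zero_rpow (by linarith), mul_zero] at h1
    have h2 := (hw.sub (h.isH1_tailReplace hw y)).integral_sq_pos (x := x)
      (by simp only [tailReplace, if_pos hx, hy0, zero_div, zero_mul, sub_zero]; exact hx0)
    linarith
  -- Unique continuation obtained from minimality alone, without a differential equation for `w`:
  -- the contradiction is derived just to the right of the last point up to which `w` vanishes.
  set Z : Set ℝ := {t | ∀ x ≤ t, w x = 0} with hZ
  have hZne : Z.Nonempty := ⟨y, hzero⟩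
  obtain ⟨x1, hx1⟩ := hne
  have hZb : BddAbove Z := ⟨x1, fun t ht => by
    by_contra hlt
    exact hx1 (ht x1 (not_le.1 hlt).le)⟩
  set x0 := sSup Z with hx0
  have hlt0 : ∀ x < x0, w x = 0 := fun x hx => by
    obtain ⟨t, ht, hxt⟩ := exists_lt_of_lt_csSup hZne hx
    exact ht x hxt.le
  have hw0 : w x0 = 0 := by
    have hcl : x0 ∈ closure (Iio x0) := by rw [closure_Iio]; exact self_mem_Iic
    have : IsClosed {x | w x = 0} := isClosed_eq hw.continuous continuous_const
    exact closure_minimal (fun x hx => hlt0 x hx) this hcl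
  -- lower bound for the removed part
  set c3 := Real.exp (-(4 * κ)) / K ^ 4 with hc3
  have hc30 : 0 < c3 := by positivity
  have hsmall : ∃ ε > 0, ∀ t : ℝ, |t| < ε → B * |t| ^ (q - 2) < c3 := by
    have hc : Continuous fun t : ℝ => B * |t| ^ (q - 2) :=
      continuous_const.mul (continuous_abs.rpow_const fun x => Or.inr (by linarith))
    have h0 : B * |(0:ℝ)| ^ (q - 2) < c3 := by
      rw [abs_zero, Real.zero_rpow (by linarith), mul_zero]; exact hc30
    have := (hc.tendsto 0).eventually (gt_mem_nhds h0)
    rw [Metric.eventually_nhds_iff] at this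
    simpa [Real.dist_eq] using this
  obtain ⟨ε, hε, hεs⟩ := hsmall
  obtain ⟨δ, hδ, hδs⟩ := Metric.continuous_iff.1 hw.continuous x0 (min η ε) (by positivity)
  obtain ⟨t, ht0, ht1, htn⟩ : ∃ t, x0 < t ∧ t < x0 + min δ 1 ∧ w t ≠ 0 := by
    by_contra! hcon
    have hp : 0 < min δ 1 := by positivity
    have : x0 + min δ 1 / 2 ∈ Z := by
      intro x hx
      rcases lt_trichotomy x x0 with hl | hl | hl
      · exact hlt0 x hl
      · rw [hl]; exact hw0
      · exact hcon x hl (by linarith)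
    have := le_csSup hZb this
    linarith
  have hnear : ∀ x ≤ t, |w x| < min η ε := by
    intro x hx
    rcases lt_or_ge x x0 with hl | hl
    · rw [hlt0 x hl, abs_zero]; positivity
    · have := hδs x (by
        rw [Real.dist_eq, abs_of_nonneg (by linarith)]
        have := min_le_left δ 1; linarith)
      rwa [hw0, Real.dist_eq, sub_zero] at this
  have h1 := hest t fun x hx => (hnear x hx).le.trans (min_le_left _ _)
  have hr := hw.sub (h.isH1_tailReplace hw t)
  -- On the unit interval left of `x0` the removed part is just the replaced tail, and t - x ≤ 2
  -- gives φ x / φ t ≥ e^(-2κ)/K², whose square is `c3`. The upper bound B |w t|^q is smaller than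
  -- this once `w t` is small.
  have h2 : c3 * w t ^ 2 ≤ ∫ x, (w x - tailReplace φ w t x) ^ 2 := by
    have a1 : ∫ x in Ioc (x0 - 1) x0, c3 * w t ^ 2
        ≤ ∫ x in Ioc (x0 - 1) x0, (w x - tailReplace φ w t x) ^ 2 := by
      refine setIntegral_mono_on (integrableOn_const (by simp)) hr.integrable_sq.integrableOn
        measurableSet_Ioc fun x hx => ?_
      have hwx : w x = 0 := by
        rcases hx.2.eq_or_lt with h | h
        · rw [h]; exact hw0
        · exact hlt0 x h
      rw [hwx, zero_sub, neg_sq, tailReplace, if_pos (by linarith [hx.2]), mul_pow, div_pow]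
      have l1 := h.lower x
      have l2 := h.upper t
      have p1 := h.pos x
      have p2 := h.pos t
      have e1 : Real.exp (κ * t) * Real.exp (-(2 * κ)) ≤ Real.exp (κ * x) := by
        rw [← Real.exp_add]
        have := min_le_right δ 1
        have := hx.1
        apply Real.exp_le_exp.2; nlinarith
      have e2 : φ t * Real.exp (-(2 * κ)) ≤ K ^ 2 * φ x := by
        calc φ t * Real.exp (-(2 * κ)) ≤ K * Real.exp (κ * t) * Real.exp (-(2 * κ)) := by gcongr
          _ = K * (Real.exp (κ * t) * Real.exp (-(2 * κ))) := by ring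
          _ ≤ K * (K * φ x) := mul_le_mul_of_nonneg_left (e1.trans l1) hK.le
          _ = _ := by ring
      have e3 : Real.exp (-(4 * κ)) = Real.exp (-(2 * κ)) ^ 2 := by
        rw [← Real.exp_nat_mul]; congr 1; push_cast; ring
      have e4 : φ t ^ 2 * Real.exp (-(2 * κ)) ^ 2 ≤ K ^ 4 * φ x ^ 2 := by
        have := pow_le_pow_left₀ (by positivity) e2 2
        calc _ = (φ t * Real.exp (-(2 * κ))) ^ 2 := by ring
          _ ≤ _ := this
          _ = _ := by ring
      rw [hc3, e3]
      rw [div_mul_eq_mul_div, div_mul_eq_mul_div, div_le_div_iff₀ (by positivity) (by positivity)]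
      nlinarith [mul_le_mul_of_nonneg_right e4 (sq_nonneg (w t))]
    rw [setIntegral_const] at a1
    simp only [Real.volume_real_Ioc, sub_sub_cancel, smul_eq_mul] at a1
    norm_num at a1
    exact a1.trans (setIntegral_le_integral hr.integrable_sq (Eventually.of_forall fun x => sq_nonneg _))
  have h3 : |w t| ^ q ≤ |w t| ^ (q - 2) * w t ^ 2 := abs_rpow_le_mul_sq hq le_rfl
  have h4 := hεs (w t) ((hnear t le_rfl).trans_le (min_le_right _ _))
  have h5 : 0 < w t ^ 2 := by positivity
  have h6 : B * |w t| ^ q ≤ B * (|w t| ^ (q - 2) * w t ^ 2) := by gcongr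
  nlinarith

end IsExpSolution

/-! ### The test function that undercuts the periodic quotient -/

/-- If `Q` coincides on the right with a periodic `Q₁`, and lowers on the left the form at the Bloch
mode of `Q₁`, then the Sobolev quotient of the periodic problem is not a lower bound for the problem
with `Q`. -/
theorem not_sobolevBound_of_blochMode {Q Q₁ Γ Γ₁ φ ψ w g : ℝ → ℝ} {κ K C D m S q : ℝ}
    (h : IsExpSolution Q₁ φ ψ κ K) (hφ : ∀ x, φ (x + 1) = Real.exp κ * φ x) (hq : 2 < q)
    (hQ : IsBoundedCoeff Q C) (hQ₁ : IsBoundedCoeff Q₁ C) (hΓ : IsBoundedCoeff Γ D)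
    (hΓ₁ : IsBoundedCoeff Γ₁ D) (hQp : Function.Periodic Q₁ 1) (hΓp : Function.Periodic Γ₁ 1)
    (hm : 0 < m) (hco : CoerciveOnH1 Q₁ m) (hS : 0 < S) (hSob₁ : SobolevBound Q₁ Γ₁ q S)
    (hw : IsNormalizedMinimizer Q₁ Γ₁ q S w g) (hQe : ∀ x, 0 < x → Q x = Q₁ x)
    (hΓe : ∀ x, 0 < x → Γ x = Γ₁ x)
    (hneg : ∫ x in Iio (0:ℝ), (Q x - Q₁ x) * φ x ^ 2 < 0) :
    ¬ SobolevBound Q Γ q S := by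
  intro hSob
  have hκ := h.kappa_pos
  have hK := h.K_pos
  have hD := hΓ.nonneg
  obtain ⟨η, hη, B, hB, hest⟩ := h.exists_tail_estimate hq hQ₁ hΓ₁ hm hco hS hSob₁ hw
  obtain ⟨hw1, hwB, hwS⟩ := hw
  have hne : ∃ x, w x ≠ 0 := by
    by_contra! hcon
    have : powForm Γ₁ q w = 0 := by
      simp [powForm, hcon, Real.zero_rpow (by linarith : q ≠ 0)]
    rw [this] at hwB; exact zero_ne_one hwB
  set C1 := (K ^ 2) ^ q / (q * κ) with hC1
  have hC10 : 0 ≤ C1 := by positivity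
  set I := ∫ x in Iio (0:ℝ), (Q x - Q₁ x) * φ x ^ 2 with hI
  -- The gain per unit of w(-n)², as the junction value fixes the coefficient w(-n)/φ(0) of φ on x <
  -- 0. In `B'` below, the first term accounts for replacing the tail and the second for Γ differing
  -- from Γ₁ on the left.
  set δ := -I / φ 0 ^ 2 with hδ
  have hδ0 : 0 < δ := div_pos (by linarith) (by have := h.pos 0; positivity)
  set B' := D * (B + C1) + 2 * D * C1 with hB'
  have hB'0 : 0 ≤ B' := by positivity
  have hφn : ∀ (n : ℕ) x, φ (x + n) = Real.exp (κ * n) * φ x := by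
    intro n
    induction n with
    | zero => simp
    | succ k ih =>
      intro x
      push_cast
      rw [← add_assoc, hφ, ih, mul_add, mul_one, Real.exp_add]; ring
  have hφm : ∀ (n : ℕ) x, φ (x + -n) = Real.exp (-(κ * n)) * φ x := by
    intro n x
    have := hφn n (x + -n)
    rw [neg_add_cancel_right] at this
    rw [this, ← mul_assoc, ← Real.exp_add]; simp
  have hper : ∀ {f : ℝ → ℝ}, Function.Periodic f 1 → ∀ (n : ℕ) x, f (x + -n) = f x := by
    intro f hf n x
    have := hf.sub_nat_mul_eq (x := x) n
    rw [mul_one] at this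
    rw [← sub_eq_add_neg, this]
  -- the decisive inequality
  have key : ∀ n : ℕ, (∀ x ≤ -(n:ℝ), |w x| ≤ η) →
      δ * w (-n) ^ 2 ≤ S * (B' * |w (-n)| ^ q) := by
    intro n hn
    obtain ⟨hT, -⟩ := hest (-n) hn
    set W := |w (-(n:ℝ))| ^ q with hW
    have hW0 : 0 ≤ W := by positivity
    set z := tailReplace φ w (-(n:ℝ)) with hz
    set zg := tailReplaceDeriv φ ψ w g (-(n:ℝ)) with hzg
    have hz1 : IsH1 z zg := h.isH1_tailReplace hw1 _
    -- The translation puts the junction at 0. Quasi-periodicity of φ makes the left part a multiple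
    -- of the same φ for every `n`, and the right part only meets coefficients agreeing with the
    -- periodic ones.
    set Z : ℝ → ℝ := fun x => z (x + -n) with hZ
    set Zg : ℝ → ℝ := fun x => zg (x + -n) with hZg
    have hZ1 : IsH1 Z Zg := hz1.comp_add _
    have eZ : ∀ x < 0, Z x = w (-n) / φ 0 * φ x := by
      intro x hx
      simp only [hZ, hz, tailReplace]
      rw [if_pos (by linarith)]
      have e1 := hφm n 0
      rw [zero_add] at e1
      rw [e1, hφm n x]
      have := h.pos 0
      have := Real.exp_pos (-(κ * n))
      field_simp
    have q1 : quadForm Q₁ Z Zg ≤ S := by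
      have e := quadForm_comp_add Q₁ z zg (-n)
      simp only [hper hQp] at e
      rw [e, h.quadForm_tailReplace hQ₁ hw1, hwS]
      have := hco _ _ (hw1.sub hz1)
      have : 0 ≤ m * ((∫ x, (w x - z x) ^ 2) + ∫ x, (g x - zg x) ^ 2) :=
        mul_nonneg hm.le (add_nonneg (integral_nonneg fun x => sq_nonneg _)
          (integral_nonneg fun x => sq_nonneg _))
      linarith
    have q2 : quadForm Q Z Zg = quadForm Q₁ Z Zg - δ * w (-n) ^ 2 := by
      have e1 : quadForm Q Z Zg - quadForm Q₁ Z Zg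
          = ∫ x, (Iio (0:ℝ)).indicator (fun x => (w (-n) / φ 0) ^ 2 * ((Q x - Q₁ x) * φ x ^ 2)) x := by
        rw [quadForm, quadForm, ← integral_sub (hZ1.integrable_quadForm hQ)
          (hZ1.integrable_quadForm hQ₁)]
        refine integral_congr_ae ?_
        filter_upwards [compl_mem_ae_iff.2 (measure_singleton (0:ℝ))] with x hx
        rcases lt_or_gt_of_ne (show x ≠ 0 from hx) with hl | hl
        · rw [indicator_of_mem (show x ∈ Iio (0:ℝ) from hl)]
          simp only [eZ x hl]; ring
        · rw [indicator_of_notMem (show x ∉ Iio (0:ℝ) from not_lt.2 hl.le), hQe x hl]; ring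
      rw [integral_indicator measurableSet_Iio, integral_const_mul, ← hI] at e1
      have : (w (-n) / φ 0) ^ 2 * I = -(δ * w (-n) ^ 2) := by rw [hδ]; ring
      linarith
    have p1 : 1 - D * (B * W + C1 * W) ≤ powForm Γ₁ q Z := by
      have e := powForm_comp_add Γ₁ z q (-n)
      simp only [hper hΓp] at e
      rw [e]
      refine le_trans ?_ (h.abs_powForm_tailReplace_sub_le hq hΓ₁ hw1 (-n))
      rw [hwB]
      gcongr
    have p2 : powForm Γ₁ q Z - 2 * D * (C1 * W) ≤ powForm Γ q Z := by
      obtain ⟨hi, hle⟩ := h.integral_tail_rpow_le hq (w (-n)) 0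
      have e1 : powForm Γ₁ q Z - powForm Γ q Z
          ≤ ∫ x, (Iio (0:ℝ)).indicator (fun x => 2 * D * |w (-n) / φ 0 * φ x| ^ q) x := by
        rw [powForm, powForm, ← integral_sub (hZ1.integrable_powForm hq hΓ₁)
          (hZ1.integrable_powForm hq hΓ)]
        refine integral_mono_ae ((hZ1.integrable_powForm hq hΓ₁).sub (hZ1.integrable_powForm hq hΓ))
          ((integrable_indicator_iff measurableSet_Iio).2 (hi.const_mul _)) ?_
        filter_upwards [compl_mem_ae_iff.2 (measure_singleton (0:ℝ))] with x hx
        rcases lt_or_gt_of_ne (show x ≠ 0 from hx) with hl | hl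
        · rw [indicator_of_mem (show x ∈ Iio (0:ℝ) from hl)]
          simp only [eZ x hl]
          have b1 := (abs_le.1 (hΓ.bound x)).1
          have b2 := (abs_le.1 (hΓ₁.bound x)).2
          have a0 : 0 ≤ |w (-n) / φ 0 * φ x| ^ q := by positivity
          nlinarith [mul_le_mul_of_nonneg_right b1 a0, mul_le_mul_of_nonneg_right b2 a0]
        · rw [indicator_of_notMem (show x ∉ Iio (0:ℝ) from not_lt.2 hl.le), hΓe x hl, sub_self]
      rw [integral_indicator measurableSet_Iio, integral_const_mul] at e1
      have := mul_le_mul_of_nonneg_left hle (by positivity : 0 ≤ 2 * D)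
      linarith
    have fin := hSob.mul_one_sub_le hq hS hZ1 (X := B' * W) (by positivity) (by
      rw [hB']; linarith)
    linarith
  -- let the translation go to infinity
  have hlim : Tendsto (fun n : ℕ => w (-(n:ℝ))) atTop (𝓝 0) :=
    hw1.tendsto_atBot.comp (tendsto_neg_atTop_atBot.comp tendsto_natCast_atTop_atTop)
  have hsm : ∀ᶠ n : ℕ in atTop, ∀ x ≤ -(n:ℝ), |w x| ≤ η := by
    have h1 : ∀ᶠ x in atBot, |w x| ≤ η := by
      have := hw1.tendsto_atBot.abs
      rw [abs_zero] at this
      exact (this.eventually (gt_mem_nhds hη)).mono fun x hx => hx.le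
    obtain ⟨X, hX⟩ := eventually_atBot.1 h1
    have h2 : Tendsto (fun n : ℕ => -(n:ℝ)) atTop atBot :=
      tendsto_neg_atTop_atBot.comp tendsto_natCast_atTop_atTop
    filter_upwards [h2.eventually (eventually_le_atBot X)] with n hn x hx
    exact hX x (hx.trans hn)
  -- The gain is quadratic in w(-n) and the loss is of order q > 2. The strict contradiction
  -- additionally needs w(-n) ≠ 0, supplied by `ne_zero_of_tail_estimate`.
  have hlast : ∀ᶠ n : ℕ in atTop, S * (B' * |w (-(n:ℝ))| ^ (q - 2)) < δ := by
    have hc : Continuous fun t : ℝ => S * (B' * |t| ^ (q - 2)) :=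
      continuous_const.mul (continuous_const.mul
        (continuous_abs.rpow_const fun x => Or.inr (by linarith)))
    have h0 : S * (B' * |(0:ℝ)| ^ (q - 2)) < δ := by
      rw [abs_zero, Real.zero_rpow (by linarith), mul_zero, mul_zero]; exact hδ0
    exact hlim.eventually ((hc.tendsto 0).eventually (gt_mem_nhds h0))
  obtain ⟨n, hn1, hn2⟩ := (hsm.and hlast).exists
  have hnz : w (-(n:ℝ)) ≠ 0 :=
    h.ne_zero_of_tail_estimate hq hw1 hne hη hB (fun y hy => (hest y hy).2) hn1
  have h1 := key n hn1
  have h2 : |w (-(n:ℝ))| ^ q ≤ |w (-(n:ℝ))| ^ (q - 2) * w (-(n:ℝ)) ^ 2 := abs_rpow_le_mul_sq hq le_rfl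
  have h3 : 0 < w (-(n:ℝ)) ^ 2 := by positivity
  have h4 : S * (B' * |w (-(n:ℝ))| ^ q) ≤ S * (B' * (|w (-(n:ℝ))| ^ (q - 2) * w (-(n:ℝ)) ^ 2)) := by
    gcongr
  nlinarith

/-! ### Bloch modes and their exponential bounds -/

theorem Function.Periodic.exists_abs_le {f : ℝ → ℝ} (hf : Function.Periodic f 1)
    (hc : Continuous f) : ∃ M, 0 < M ∧ ∀ x, |f x| ≤ M := by
  obtain ⟨M, hM⟩ := (isCompact_Icc (a := (0:ℝ)) (b := 1)).exists_bound_of_continuousOn hc.continuousOn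
  refine ⟨max M 1, by positivity, fun x => ?_⟩
  obtain ⟨y, hy, hxy⟩ := hf.exists_mem_Ico₀ one_pos x
  rw [hxy]
  exact (hM y ⟨hy.1, hy.2.le⟩).trans (le_max_left _ _)

namespace SolvesHill

variable {Q u : ℝ → ℝ}

theorem const_mul (h : SolvesHill Q u) (c : ℝ) : SolvesHill Q (fun x => c * u x) := by
  refine ⟨contDiff_const.mul h.1, fun a b => ?_⟩
  have hd : deriv (fun x => c * u x) = fun x => c * deriv u x := by
    ext x; exact deriv_const_mul_field c
  rw [hd]
  simp only
  rw [← mul_sub, h.2, ← intervalIntegral.integral_const_mul]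
  congr 1; ext x; ring

theorem comp_add (h : SolvesHill Q u) (s : ℝ) :
    SolvesHill (fun x => Q (x + s)) (fun x => u (x + s)) := by
  refine ⟨h.1.comp (contDiff_id.add contDiff_const), fun a b => ?_⟩
  simp only [deriv_comp_add_const]
  rw [h.2, intervalIntegral.integral_comp_add_right (fun x => Q x * u x)]

theorem comp_neg (h : SolvesHill Q u) : SolvesHill (fun x => Q (-x)) (fun x => u (-x)) := by
  refine ⟨h.1.comp contDiff_neg, fun a b => ?_⟩
  simp only [deriv_comp_neg]
  rw [intervalIntegral.integral_comp_neg (fun x => Q x * u x), ← h.2]; ring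

end SolvesHill

namespace IsBlochMode

variable {Q q : ℝ → ℝ} {k κ C : ℝ}

/-- Translating the full mode produces an extra factor e^(ks), which is divided out; the sup
normalization of the periodic factor is unaffected. -/
theorem comp_add (h : IsBlochMode Q k q) (s : ℝ) :
    IsBlochMode (fun x => Q (x + s)) k (fun x => q (x + s)) := by
  refine ⟨fun x => ?_, fun x => h.pos _, ?_, ?_⟩
  · rw [add_right_comm, h.periodic]
  · have : range (fun x => q (x + s)) = range q := (Equiv.addRight s).surjective.range_comp q
    rw [this]; exact h.normalized
  · have := (h.solves.comp_add s).const_mul (Real.exp (-(k * s)))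
    convert this using 2 with x
    rw [mul_add, Real.exp_add]
    have : Real.exp (-(k * s)) * Real.exp (k * s) = 1 := by rw [← Real.exp_add]; simp
    linear_combination -(q (x + s) * Real.exp (k * x)) * this

theorem comp_neg (h : IsBlochMode Q k q) :
    IsBlochMode (fun x => Q (-x)) (-k) (fun x => q (-x)) := by
  refine ⟨fun x => ?_, fun x => h.pos _, ?_, ?_⟩
  · have := h.periodic (-(x + 1))
    rw [← this]; congr 1; ring
  · have : range (fun x => q (-x)) = range q := (Equiv.neg ℝ).surjective.range_comp q
    rw [this]; exact h.normalized
  · convert h.solves.comp_neg using 2 with x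
    simp

theorem le_one (h : IsBlochMode Q k q) (x : ℝ) : q x ≤ 1 := h.normalized.1 ⟨x, rfl⟩

theorem continuous (h : IsBlochMode Q k q) : Continuous q := by
  have h1 : Continuous fun x => q x * Real.exp (k * x) * Real.exp (-(k * x)) :=
    h.solves.1.continuous.mul (by fun_prop)
  convert h1 using 2 with x
  rw [mul_assoc, ← Real.exp_add]; simp

theorem deriv_periodic (h : IsBlochMode Q k q) (x : ℝ) :
    deriv (fun x => q x * Real.exp (k * x)) (x + 1)
      = Real.exp k * deriv (fun x => q x * Real.exp (k * x)) x := by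
  rw [← deriv_comp_add_const, ← deriv_const_mul_field]
  congr 1; ext y
  rw [h.periodic, mul_add, mul_one, Real.exp_add]; ring

/-- The periodic factor, its reciprocal and u' e^(-κx) are continuous and periodic, hence bounded;
one `K` serves all three bounds. -/
theorem exists_isExpSolution (h : IsBlochMode Q κ q) (hκ : 0 < κ) (hQ : IsBoundedCoeff Q C) :
    ∃ K, IsExpSolution Q (fun x => q x * Real.exp (κ * x))
      (deriv (fun x => q x * Real.exp (κ * x))) κ K := by
  set u : ℝ → ℝ := fun x => q x * Real.exp (κ * x) with hu
  have hud : Continuous (deriv u) := h.solves.1.continuous_deriv le_rfl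
  obtain ⟨M1, hM1, hb1⟩ := Function.Periodic.exists_abs_le (f := fun x => 1 / q x)
    (fun x => by simp only [h.periodic x])
    (continuous_const.div h.continuous fun x => (h.pos x).ne')
  obtain ⟨M2, hM2, hb2⟩ := Function.Periodic.exists_abs_le
    (f := fun x => deriv u x * Real.exp (-(κ * x)))
    (fun x => by
      simp only
      rw [h.deriv_periodic, mul_add, mul_one, neg_add, Real.exp_add]
      have : Real.exp κ * Real.exp (-κ) = 1 := by rw [← Real.exp_add]; simp
      linear_combination (deriv u x * Real.exp (-(κ * x))) * this)
    (hud.mul (by fun_prop))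
  refine ⟨max 1 (max M1 M2), .of_contDiff h.solves.1, ⟨?_, h.solves.2⟩, hκ, by positivity, ?_, ?_, ?_⟩
  · have : LocallyIntegrable Q volume := by
      rw [locallyIntegrable_iff]
      intro k hk
      refine Measure.integrableOn_of_bounded hk.measure_lt_top.ne hQ.aesm (M := C) ?_
      exact Eventually.of_forall hQ.bound
    rw [locallyIntegrable_iff] at this ⊢
    exact fun k hk => IntegrableOn.mul_continuousOn (@this k hk) h.solves.1.continuous.continuousOn hk
  · intro x
    have h1 : 1 ≤ M1 * q x := by
      have := (le_abs_self _).trans (hb1 x)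
      rwa [div_le_iff₀ (h.pos x)] at this
    have h2 : M1 * q x ≤ max 1 (max M1 M2) * q x :=
      mul_le_mul_of_nonneg_right (le_max_of_le_right (le_max_left _ _)) (h.pos x).le
    rw [hu]; simp only
    rw [← mul_assoc]
    exact le_mul_of_one_le_left (Real.exp_pos _).le (h1.trans h2)
  · intro x
    rw [hu]; simp only
    gcongr
    exact (h.le_one x).trans (le_max_left _ _)
  · intro x
    have h1 := hb2 x
    rw [abs_mul, abs_of_pos (Real.exp_pos _), Real.exp_neg, ← div_eq_mul_inv,
      div_le_iff₀ (Real.exp_pos _)] at h1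
    refine h1.trans ?_
    gcongr
    exact le_max_of_le_right (le_max_right _ _)

end IsBlochMode

/-- A quasi-periodic function decaying to the left has an integral over the half line with the sign
of its integral over the last period. -/
theorem integral_Iio_neg_of_quasiperiodic {f : ℝ → ℝ} {κ : ℝ} (hκ : 0 < κ)
    (hf : IntegrableOn f (Iio 0)) (hq : ∀ x, f (x - 1) = Real.exp (-κ) * f x)
    (hneg : ∫ x in (-1:ℝ)..0, f x < 0) : ∫ x in Iio (0:ℝ), f x < 0 := by
  have hf' : IntegrableOn f (Iic 0) := by rwa [integrableOn_Iic_iff_integrableOn_Iio]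
  have h1 := intervalIntegral.integral_Iic_sub_Iic (a := -1) (b := 0)
    (hf'.mono_set (Iic_subset_Iic.2 (by norm_num))) hf'
  -- Shifting by one period, so that the last period carries the fraction 1 - e^(-κ) > 0 of the
  -- half-line integral.
  have h2 : ∫ x in Iic (-1:ℝ), f x = Real.exp (-κ) * ∫ x in Iic (0:ℝ), f x := by
    rw [← integral_const_mul]
    simp only [← hq]
    have hmp := (measurePreserving_sub_right volume (1:ℝ)).setIntegral_preimage_emb
      (MeasurableEquiv.subRight (1:ℝ)).measurableEmbedding f (Iic (-1))
    rw [← hmp]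
    congr 2; ext x; simp
  rw [← integral_Iic_eq_integral_Iio]
  rw [h2] at h1
  have h3 : Real.exp (-κ) < 1 := by rw [Real.exp_lt_one_iff]; linarith
  nlinarith

/-! ### Reflection, translation and passage to the Nehari manifold -/

theorem CoerciveOnH1.comp_neg {Q : ℝ → ℝ} {m : ℝ} (h : CoerciveOnH1 Q m) :
    CoerciveOnH1 (fun x => Q (-x)) m := by
  intro u g hu
  have h1 := h _ _ hu.comp_neg
  have e := quadForm_comp_neg Q (fun x => u (-x)) (fun x => -g (-x))
  simp only [neg_neg] at e
  rw [e]
  refine le_trans (le_of_eq ?_) h1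
  have e1 := integral_neg_eq_self (fun x => u x ^ 2) volume
  have e2 := integral_neg_eq_self (fun x => g x ^ 2) volume
  simp only [neg_sq]
  rw [e1, e2]

theorem SobolevBound.comp_neg {Q Γ : ℝ → ℝ} {q S : ℝ} (h : SobolevBound Q Γ q S) :
    SobolevBound (fun x => Q (-x)) (fun x => Γ (-x)) q S := by
  intro u g hu
  have h1 := h _ _ hu.comp_neg
  have e := quadForm_comp_neg Q (fun x => u (-x)) (fun x => -g (-x))
  have e2 := powForm_comp_neg Γ (fun x => u (-x)) q
  simp only [neg_neg] at e e2
  rw [e, e2]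
  exact h1

theorem IsNormalizedMinimizer.comp_neg {Q Γ v h : ℝ → ℝ} {q S : ℝ}
    (hv : IsNormalizedMinimizer Q Γ q S v h) :
    IsNormalizedMinimizer (fun x => Q (-x)) (fun x => Γ (-x)) q S (fun x => v (-x))
      (fun x => -h (-x)) :=
  ⟨hv.1.comp_neg, (powForm_comp_neg Γ v q).trans hv.2.1, (quadForm_comp_neg Q v h).trans hv.2.2⟩

theorem IsNormalizedMinimizer.comp_add {Q Γ v h : ℝ → ℝ} {q S : ℝ}
    (hv : IsNormalizedMinimizer Q Γ q S v h) (s : ℝ) :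
    IsNormalizedMinimizer (fun x => Q (x + s)) (fun x => Γ (x + s)) q S (fun x => v (x + s))
      (fun x => h (x + s)) :=
  ⟨hv.1.comp_add s, (powForm_comp_add Γ v q s).trans hv.2.1,
    (quadForm_comp_add Q v h s).trans hv.2.2⟩

/-- A minimizer of the Sobolev quotient can be scaled onto the Nehari manifold. -/
theorem IsNormalizedMinimizer.exists_isStrongGroundState {Q Γ v h : ℝ → ℝ} {p C D m S : ℝ}
    (hv : IsNormalizedMinimizer Q Γ (p + 1) S v h) (hp : 1 < p) (hQ : IsBoundedCoeff Q C)
    (hΓ : IsBoundedCoeff Γ D) (hm : 0 < m) (hco : CoerciveOnH1 Q m) (hS : 0 < S)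
    (hSob : SobolevBound Q Γ (p + 1) S) : ∃ w, IsStrongGroundState Q Γ p w := by
  obtain ⟨hv1, hvB, hvS⟩ := hv
  -- The scale solving t^(p+1) = t² S, which balances the two terms of the Nehari constraint.
  set t := S ^ (1 / (p - 1)) with ht
  have hp1 : 0 < p - 1 := by linarith
  have ht0 : 0 < t := by positivity
  have ht1 : t ^ (p + 1) = t ^ 2 * S := by
    have e1 : t ^ (p - 1) = S := by
      rw [ht, ← Real.rpow_mul hS.le, one_div, inv_mul_cancel₀ hp1.ne', Real.rpow_one]
    rw [show p + 1 = (p - 1) + 2 by ring, Real.rpow_add ht0, e1]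
    norm_num; ring
  have ht2 : t ^ 2 * S = S ^ ((p + 1) / (p - 1)) := by
    rw [ht, ← Real.rpow_natCast, ← Real.rpow_mul hS.le]
    nth_rewrite 2 [← Real.rpow_one S]
    rw [← Real.rpow_add hS]
    congr 1; push_cast; field_simp; ring
  set w : ℝ → ℝ := fun x => t * v x with hw
  have hw1 : IsH1 w (fun x => t * h x) := hv1.const_mul t
  have hwd := hw1.prim.hasWeakDeriv.weakDeriv_ae_eq
  have hqw : quadForm Q w (fun x => t * h x) = t ^ 2 * S := by rw [hw, quadForm_smul, hvS]
  have hpw : powForm Γ (p + 1) w = t ^ 2 * S := by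
    rw [hw, powForm_smul, hvB, abs_of_pos ht0, mul_one, ht1]
  have hwN : w ∈ nehari Q Γ p := by
    refine ⟨hw1.memH1, fun hz => ?_, ?_⟩
    · have h0 : powForm Γ (p + 1) w = powForm Γ (p + 1) (fun _ => 0) := powForm_congr hz
      rw [hpw] at h0
      have : powForm Γ (p + 1) (fun _ => 0) = 0 := by
        simp [powForm, Real.zero_rpow (by linarith : p + 1 ≠ 0)]
      rw [this] at h0
      have : 0 < t ^ 2 * S := by positivity
      linarith
    · rw [nehariG_eq hp hQ hΓ hw1 .rfl hwd, hqw, hpw, sub_self]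
  refine ⟨w, hwN, ⟨⟨w, hwN, rfl⟩, ?_⟩⟩
  rintro _ ⟨u, ⟨hu1, hu2, hu3⟩, rfl⟩
  obtain ⟨v', g', hv', huv, hug⟩ := hu1.exists_isH1
  rw [energyJ_eq hp hQ hΓ hw1 .rfl hwd, energyJ_eq hp hQ hΓ hv' huv hug, hqw, hpw]
  rw [nehariG_eq hp hQ hΓ hv' huv hug] at hu3
  set a := quadForm Q v' g' with ha
  have hB : powForm Γ (p + 1) v' = a := by linarith
  have ha0 : 0 < a := by
    obtain ⟨x, hx⟩ : ∃ x, v' x ≠ 0 := by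
      by_contra! hcon
      exact hu2 (huv.mono fun x hx => by rw [hx, hcon])
    have h1 := hv'.integral_sq_pos hx
    have h2 : 0 ≤ ∫ x, g' x ^ 2 := integral_nonneg fun x => sq_nonneg _
    have h3 := hco _ _ hv'
    have : 0 < m * ((∫ x, v' x ^ 2) + ∫ x, g' x ^ 2) := mul_pos hm (by linarith)
    linarith
  -- On the Nehari manifold form and power term share the value a, so the Sobolev bound reads S
  -- a^(2/(p+1)) ≤ a, that is a ≥ S^((p+1)/(p-1)) = t² S.
  have hmain : t ^ 2 * S ≤ a := by
    have h1 := hSob _ _ hv'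
    rw [hB, max_eq_left ha0.le, ← ha] at h1
    have h2 : S ≤ a ^ ((p - 1) / (p + 1)) := by
      have e : a = a ^ (2 / (p + 1)) * a ^ ((p - 1) / (p + 1)) := by
        rw [← Real.rpow_add ha0, ← add_div, show 2 + (p - 1) = p + 1 by ring, div_self (by linarith),
          Real.rpow_one]
      have h3 : 0 < a ^ (2 / (p + 1)) := by positivity
      have h4 : a ^ (2 / (p + 1)) * S ≤ a ^ (2 / (p + 1)) * a ^ ((p - 1) / (p + 1)) := by
        rw [← e]; linarith
      exact le_of_mul_le_mul_left h4 h3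
    rw [ht2]
    have h5 := Real.rpow_le_rpow hS.le h2 (by positivity : 0 ≤ (p + 1) / (p - 1))
    refine h5.trans (le_of_eq ?_)
    rw [← Real.rpow_mul ha0.le]
    have : (p - 1) / (p + 1) * ((p + 1) / (p - 1)) = 1 := by
      have : p + 1 ≠ 0 := by linarith
      field_simp
    rw [this, Real.rpow_one]
  rw [hB]
  have hc : 0 ≤ 1 / 2 - 1 / (p + 1) := by
    rw [sub_nonneg]; exact one_div_le_one_div_of_le (by norm_num) (by linarith)
  have := mul_le_mul_of_nonneg_left hmain hc
  linarith

/-- `weakDeriv` is a choice and need not commute with translation, so continuous representatives are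
translated instead. One inclusion suffices: applying it with `-s` gives the other. -/
theorem energyJ_image_nehari_subset_comp_add {Q Γ : ℝ → ℝ} {p C D : ℝ} (hp : 1 < p)
    (hQ : IsBoundedCoeff Q C) (hΓ : IsBoundedCoeff Γ D) (s : ℝ) :
    energyJ Q Γ p '' nehari Q Γ p ⊆ energyJ (fun x => Q (x + s)) (fun x => Γ (x + s)) p ''
      nehari (fun x => Q (x + s)) (fun x => Γ (x + s)) p := by
  rintro _ ⟨u, ⟨hu1, hu2, hu3⟩, rfl⟩
  obtain ⟨v, g, hv, huv, hug⟩ := hu1.exists_isH1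
  have hvs := hv.comp_add s
  have hd := hvs.prim.hasWeakDeriv.weakDeriv_ae_eq
  refine ⟨fun x => v (x + s), ⟨hvs.memH1, fun hz => hu2 ?_, ?_⟩, ?_⟩
  · have hz' : ∀ᵐ x, v x = 0 := by
      have := (measurePreserving_sub_right volume s).quasiMeasurePreserving.ae hz
      simpa using this
    filter_upwards [huv, hz'] with x h1 h2
    rw [h1, h2]
  · rw [nehariG_eq hp (hQ.comp_add s) (hΓ.comp_add s) hvs .rfl hd, quadForm_comp_add,
      powForm_comp_add, ← hu3, nehariG_eq hp hQ hΓ hv huv hug]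
  · rw [energyJ_eq hp (hQ.comp_add s) (hΓ.comp_add s) hvs .rfl hd, quadForm_comp_add,
      powForm_comp_add, energyJ_eq hp hQ hΓ hv huv hug]

theorem nehariLevel_comp_add {Q Γ : ℝ → ℝ} {p C D : ℝ} (hp : 1 < p)
    (hQ : IsBoundedCoeff Q C) (hΓ : IsBoundedCoeff Γ D) (s : ℝ) :
    nehariLevel (fun x => Q (x + s)) (fun x => Γ (x + s)) p = nehariLevel Q Γ p := by
  have h1 := energyJ_image_nehari_subset_comp_add hp hQ hΓ s
  have h2 := energyJ_image_nehari_subset_comp_add hp (hQ.comp_add s) (hΓ.comp_add s) (-s)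
  simp only [neg_add_cancel_right] at h2
  rw [nehariLevel, nehariLevel, h2.antisymm h1]

/-! ### The interface problem -/

theorem aestronglyMeasurable_dislocation {f : ℝ → ℝ} (hf : AEStronglyMeasurable f volume) (τ : ℝ) :
    AEStronglyMeasurable (dislocation f τ) volume := by
  have e : dislocation f τ = (Ioi (0:ℝ)).piecewise (fun x => f (x + τ)) (fun x => f (x - τ)) := by
    ext x; simp [dislocation, Set.piecewise]
  rw [e]
  exact AEStronglyMeasurable.piecewise measurableSet_Ioi
    (hf.comp_measurePreserving (measurePreserving_add_right volume τ)).restrict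
    (hf.comp_measurePreserving (measurePreserving_sub_right volume τ)).restrict

theorem IsBoundedCoeff.dislocation {f : ℝ → ℝ} {C : ℝ} (hf : IsBoundedCoeff f C) (τ : ℝ) :
    IsBoundedCoeff (dislocation f τ) C := by
  refine ⟨aestronglyMeasurable_dislocation hf.aesm τ, fun x => ?_⟩
  rw [_root_.dislocation]
  split_ifs <;> exact hf.bound _

theorem IsBoundedCoeff.sub_const {f : ℝ → ℝ} {C : ℝ} (hf : IsBoundedCoeff f C) (c : ℝ) :
    IsBoundedCoeff (fun x => f x - c) (C + |c|) :=
  ⟨hf.aesm.sub aestronglyMeasurable_const,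
    fun x => (abs_sub _ _).trans (by have := hf.bound x; linarith)⟩

/-- Once x + n > 0, periodicity absorbs n: the limits of the translated interface are eventual
equalities, without any regularity of the coefficient. -/
theorem dislocation_add_nat {f : ℝ → ℝ} (hf : Function.Periodic f 1) (τ x : ℝ) :
    ∀ᶠ n : ℕ in atTop, dislocation f τ (x + n) = f (x + τ) := by
  obtain ⟨N, hN⟩ := exists_nat_gt (-x)
  filter_upwards [eventually_ge_atTop N] with n hn
  have : (N:ℝ) ≤ n := by exact_mod_cast hn
  rw [dislocation, if_pos (by linarith), add_right_comm]
  have := hf.nat_mul n (x + τ)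
  rwa [mul_one] at this

theorem dislocation_sub_nat {f : ℝ → ℝ} (hf : Function.Periodic f 1) (τ x : ℝ) :
    ∀ᶠ n : ℕ in atTop, dislocation f τ (x + -n) = f (x - τ) := by
  obtain ⟨N, hN⟩ := exists_nat_gt x
  filter_upwards [eventually_ge_atTop N] with n hn
  have : (N:ℝ) ≤ n := by exact_mod_cast hn
  rw [dislocation, if_neg (by linarith)]
  have := hf.sub_nat_mul_eq (x := x - τ) n
  rw [mul_one] at this
  rw [← this]; congr 1; ring

/-- Boundedness guards against the default value of a real `limsup` on a set unbounded below. -/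
theorem not_ae_nonpos_of_essSup_pos {f : ℝ → ℝ} {D : ℝ} (hf : ∀ x, |f x| ≤ D)
    (h : 0 < essSup f volume) : ¬ ∀ᵐ x, f x ≤ 0 := by
  intro hle
  have : essSup f volume ≤ 0 := by
    refine limsup_le_of_le ?_ hle
    have : IsBoundedUnder (· ≥ ·) (ae volume) f :=
      ⟨-D, eventually_map.2 (Eventually.of_forall fun x => (abs_le.1 (hf x)).1)⟩
    exact this.isCoboundedUnder_le
  linarith

/-- The substitution x ↦ -x swaps the half lines and turns decaying modes into growing ones. Every
statement about the right condition is obtained through this equivalence. -/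
theorem leftBlochCondition_comp_neg {V₀ q : ℝ → ℝ} {τ κ : ℝ} :
    LeftBlochCondition (fun x => V₀ (-x)) τ κ (fun x => q (-x)) ↔ RightBlochCondition V₀ τ κ q := by
  have hc := intervalIntegral.integral_comp_neg (a := (-1:ℝ)) (b := 0) (fun x =>
    (V₀ (x + τ) - V₀ (x - τ)) * (q (x - τ)) ^ 2 * Real.exp (-2 * κ * x))
  have e1 : ∀ x, -(x - τ) = -x + τ := fun x => by ring
  have e2 : ∀ x, -(x + τ) = -x - τ := fun x => by ring
  have e3 : ∀ x, -2 * κ * -x = 2 * κ * x := fun x => by ring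
  simp only [neg_zero, neg_neg, e3] at hc
  rw [RightBlochCondition, ← hc, LeftBlochCondition]
  simp only [e1, e2]

section Dislocation

variable {V₀ Γ₀ : ℝ → ℝ} {p τ lam C D κ m S : ℝ} {v h pPlus pMinus : ℝ → ℝ}

/-- The left Bloch mode condition makes the periodic quotient on the right not a lower bound. -/
theorem not_sobolevBound_of_leftBlochCondition (hV : IsBoundedCoeff V₀ C)
    (hΓ : IsBoundedCoeff Γ₀ D) (hVp : Function.Periodic V₀ 1) (hΓp : Function.Periodic Γ₀ 1)
    (hp : 1 < p) (hm : 0 < m) (hS : 0 < S) (hκ : 0 < κ)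
    (hco : CoerciveOnH1 (fun x => V₀ (x + τ) - lam) m)
    (hSob : SobolevBound (fun x => V₀ (x + τ) - lam) (fun x => Γ₀ (x + τ)) (p + 1) S)
    (hv : IsNormalizedMinimizer (fun x => V₀ (x + τ) - lam) (fun x => Γ₀ (x + τ)) (p + 1) S v h)
    (hbl : IsBlochMode (fun x => V₀ x - lam) κ pMinus) (hleft : LeftBlochCondition V₀ τ κ pMinus)
    {Q Γ : ℝ → ℝ} (hQ : IsBoundedCoeff Q (C + |lam|)) (hΓb : IsBoundedCoeff Γ D)
    (hQr : ∀ x, 0 < x → Q x = V₀ (x + τ) - lam) (hQl : ∀ x < 0, Q x = V₀ (x - τ) - lam)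
    (hΓr : ∀ x, 0 < x → Γ x = Γ₀ (x + τ)) :
    ¬ SobolevBound Q Γ (p + 1) S := by
  have hQ1 : IsBoundedCoeff (fun x => V₀ (x + τ) - lam) (C + |lam|) :=
    (hV.sub_const lam).comp_add τ
  have hbl' := hbl.comp_add τ
  obtain ⟨K, hK⟩ := hbl'.exists_isExpSolution hκ hQ1
  have hper : ∀ {f : ℝ → ℝ}, Function.Periodic f 1 → ∀ x, f (x - 1) = f x := fun hf x => by
    have := hf (x - 1); rw [sub_add_cancel] at this; exact this.symm
  refine not_sobolevBound_of_blochMode hK (fun x => ?_) (by linarith) hQ hQ1 hΓb (hΓ.comp_add τ)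
    (fun x => ?_) (fun x => ?_) hm hco hS hSob hv hQr hΓr ?_
  · have := hbl'.periodic x
    rw [this, mul_add, mul_one, Real.exp_add]; ring
  · rw [add_right_comm, hVp]
  · rw [add_right_comm, hΓp]
  · set f : ℝ → ℝ := fun x => (V₀ (x - τ) - V₀ (x + τ)) * (pMinus (x + τ)) ^ 2 * Real.exp (2 * κ * x)
      with hf
    have hexp : ∀ x : ℝ, Real.exp (κ * x) ^ 2 = Real.exp (2 * κ * x) := fun x => by
      rw [← Real.exp_nat_mul]; congr 1; push_cast; ring
    have e : ∀ x < 0, (Q x - (V₀ (x + τ) - lam)) * (pMinus (x + τ) * Real.exp (κ * x)) ^ 2 = f x := by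
      intro x hx
      rw [hQl x hx, hf, mul_pow, hexp]; ring
    rw [setIntegral_congr_fun measurableSet_Iio (fun x hx => e x hx)]
    have hq : ∀ x, f (x - 1) = Real.exp (-(2 * κ)) * f x := by
      intro x
      have e1 := hper hVp (x - τ)
      have e2 := hper hVp (x + τ)
      have e3 := hper hbl.periodic (x + τ)
      rw [show x - τ - 1 = x - 1 - τ by ring] at e1
      rw [show x + τ - 1 = x - 1 + τ by ring] at e2 e3
      have e4 : Real.exp (2 * κ * (x - 1)) = Real.exp (-(2 * κ)) * Real.exp (2 * κ * x) := by
        rw [← Real.exp_add]; congr 1; ring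
      simp only [hf]
      rw [e1, e2, e3, e4]; ring
    refine integral_Iio_neg_of_quasiperiodic (κ := 2 * κ) (by positivity) ?_ hq hleft
    have hi : IntegrableOn (fun x => 2 * C * Real.exp (2 * κ * x)) (Iio 0) :=
      ((integrableOn_exp_mul_Iic (by positivity : 0 < 2 * κ) 0).mono_set Iio_subset_Iic_self).const_mul _
    refine hi.mono' ?_ (Eventually.of_forall fun x => ?_)
    · have m1 := hV.aesm.comp_measurePreserving (measurePreserving_sub_right volume τ)
      have m2 := hV.aesm.comp_measurePreserving (measurePreserving_add_right volume τ)
      have m3 : Continuous fun x => (pMinus (x + τ)) ^ 2 := (hbl'.continuous).pow 2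
      have m4 : Continuous fun x : ℝ => Real.exp (2 * κ * x) := by fun_prop
      exact (((m1.sub m2).mul m3.aestronglyMeasurable).mul m4.aestronglyMeasurable).restrict
    · simp only [hf, norm_mul, Real.norm_eq_abs, abs_of_pos (Real.exp_pos _)]
      refine mul_le_mul_of_nonneg_right ?_ (Real.exp_pos _).le
      have b1 : |V₀ (x - τ) - V₀ (x + τ)| ≤ 2 * C :=
        (abs_sub _ _).trans (by linarith [hV.bound (x - τ), hV.bound (x + τ)])
      have b2 : |pMinus (x + τ) ^ 2| ≤ 1 := by
        rw [abs_of_nonneg (sq_nonneg _)]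
        exact pow_le_one₀ (hbl.pos _).le (hbl.le_one _)
      calc _ ≤ 2 * C * 1 := mul_le_mul b1 b2 (abs_nonneg _) (by linarith [hV.nonneg])
        _ = _ := mul_one _

/-- If the interface infimum is not attained, a periodic limit problem attains it. Translation by 2τ
then provides minimizers at both ends, so whichever Bloch condition holds can be used to contradict
the Sobolev bound of the interface problem. -/
theorem exists_isStrongGroundState_dislocation (hV : IsBoundedCoeff V₀ C)
    (hΓ : IsBoundedCoeff Γ₀ D) (hVp : Function.Periodic V₀ 1) (hΓp : Function.Periodic Γ₀ 1)
    (hp : 1 < p) (hpos : 0 < essSup Γ₀ volume)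
    (hspec : PosMinSpectrum (fun x => dislocation V₀ τ x - lam))
    (hbl : IsBlochModePair (fun x => V₀ x - lam) κ pPlus pMinus)
    (hcond : LeftBlochCondition V₀ τ κ pMinus ∨ RightBlochCondition V₀ τ κ pPlus) :
    ∃ w, IsStrongGroundState (fun x => dislocation V₀ τ x - lam) (dislocation Γ₀ τ) p w := by
  have hq : 2 < p + 1 := by linarith
  have hQ : IsBoundedCoeff (fun x => dislocation V₀ τ x - lam) (C + |lam|) :=
    (hV.dislocation τ).sub_const lam
  have hΓd : IsBoundedCoeff (dislocation Γ₀ τ) D := hΓ.dislocation τ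
  obtain ⟨m, hm, hco⟩ := hspec.exists_coercive hQ
  change CoerciveOnH1 _ m at hco
  have hQp : ∀ x, Tendsto (fun n : ℕ => (fun x => dislocation V₀ τ x - lam) (x + n)) atTop
      (𝓝 (V₀ (x + τ) - lam)) := fun x => tendsto_const_nhds.congr' (by
    filter_upwards [dislocation_add_nat hVp τ x] with n hn
    simp only [hn])
  have hQm : ∀ x, Tendsto (fun n : ℕ => (fun x => dislocation V₀ τ x - lam) (x + -n)) atTop
      (𝓝 (V₀ (x - τ) - lam)) := fun x => tendsto_const_nhds.congr' (by
    filter_upwards [dislocation_sub_nat hVp τ x] with n hn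
    simp only [hn])
  have hΓP : ∀ x, Tendsto (fun n : ℕ => dislocation Γ₀ τ (x + n)) atTop (𝓝 (Γ₀ (x + τ))) :=
    fun x => tendsto_const_nhds.congr' (by
      filter_upwards [dislocation_add_nat hΓp τ x] with n hn using hn.symm)
  have hΓM : ∀ x, Tendsto (fun n : ℕ => dislocation Γ₀ τ (x + -n)) atTop (𝓝 (Γ₀ (x - τ))) :=
    fun x => tendsto_const_nhds.congr' (by
      filter_upwards [dislocation_sub_nat hΓp τ x] with n hn using hn.symm)
  -- A function that is good for Γ₀ is moved far to the right, where the interface coefficient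
  -- agrees with Γ₀(· + τ).
  have hpos' : ∃ u g, IsH1 u g ∧ 0 < powForm (dislocation Γ₀ τ) (p + 1) u := by
    obtain ⟨u, g, hu, hu0⟩ := exists_powForm_pos hq hΓ (not_ae_nonpos_of_essSup_pos hΓ.bound hpos)
    have h1 := tendsto_powForm_shift (s := fun n : ℕ => (n:ℝ)) hΓd hq hΓP (hu.comp_add τ)
    rw [powForm_comp_add] at h1
    obtain ⟨n, hn⟩ := (h1.eventually (lt_mem_nhds hu0)).exists
    refine ⟨_, _, (hu.comp_add τ).comp_add (-n), ?_⟩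
    have e := powForm_comp_add (dislocation Γ₀ τ) (fun x => u (x + -n + τ)) (p + 1) n
    simp only [add_neg_cancel_right] at e
    rwa [← e]
  obtain ⟨S, hS, hSob, halt⟩ := exists_minimizer_or_limit_minimizer hq hQ hΓd hm hco hpos'
    hQp hΓP hQm hΓM
  rcases halt with ⟨v, h, hv⟩ | halt
  · exact hv.exists_isStrongGroundState hp hQ hΓd hm hco hS hSob
  exfalso
  have hcoP := hco.of_shift (s := fun n : ℕ => (n:ℝ)) hQ hQp
  have hSobP := hSob.of_shift (s := fun n : ℕ => (n:ℝ)) hq hQ hΓd hQp hΓP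
  have hcoM := hco.of_shift (s := fun n : ℕ => -(n:ℝ)) hQ hQm
  have hSobM := hSob.of_shift (s := fun n : ℕ => -(n:ℝ)) hq hQ hΓd hQm hΓM
  -- both periodic problems are translates of each other
  have hminP : ∃ v h, IsNormalizedMinimizer (fun x => V₀ (x + τ) - lam) (fun x => Γ₀ (x + τ))
      (p + 1) S v h := by
    rcases halt with ⟨v, h, hv⟩ | ⟨v, h, hv⟩
    · exact ⟨v, h, hv⟩
    · have := hv.comp_add (2 * τ)
      have e : ∀ x, x + 2 * τ - τ = x + τ := fun x => by ring
      simp only [e] at this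
      exact ⟨_, _, this⟩
  obtain ⟨v, h, hv⟩ := hminP
  rcases hcond with hleft | hright
  · refine not_sobolevBound_of_leftBlochCondition hV hΓ hVp hΓp hp hm hS hbl.kappa_pos hcoP hSobP hv
      hbl.minus hleft hQ hΓd (fun x hx => ?_) (fun x hx => ?_) (fun x hx => ?_) hSob
    · simp only [dislocation, if_pos hx]
    · simp only [dislocation, if_neg (not_lt.2 hx.le)]
    · simp only [dislocation, if_pos hx]
  · have hvM : IsNormalizedMinimizer (fun x => V₀ (x - τ) - lam) (fun x => Γ₀ (x - τ))
        (p + 1) S (fun x => v (x + -(2 * τ))) (fun x => h (x + -(2 * τ))) := by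
      have := hv.comp_add (-(2 * τ))
      have e : ∀ x, x + -(2 * τ) + τ = x - τ := fun x => by ring
      simp only [e] at this
      exact this
    have e : ∀ x, -x - τ = -(x + τ) := fun x => by ring
    have hvR := hvM.comp_neg
    have hcoR := hcoM.comp_neg
    have hSobR := hSobM.comp_neg
    simp only [e] at hvR hcoR hSobR
    have hblR := hbl.plus.comp_neg
    rw [neg_neg] at hblR
    have hper : ∀ {f : ℝ → ℝ}, Function.Periodic f 1 → Function.Periodic (fun x => f (-x)) 1 :=
      fun {f} hf x => by
        have := hf (-(x + 1))
        simp only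
        rw [← this]; congr 1; ring
    refine not_sobolevBound_of_leftBlochCondition (V₀ := fun x => V₀ (-x)) (Γ₀ := fun x => Γ₀ (-x))
      (τ := τ) hV.comp_neg hΓ.comp_neg (hper hVp) (hper hΓp) hp hm hS hbl.kappa_pos hcoR hSobR hvR
      hblR (leftBlochCondition_comp_neg.2 hright) hQ.comp_neg hΓd.comp_neg (fun x hx => ?_) (fun x hx => ?_) (fun x hx => ?_)
      hSob.comp_neg
    · simp only [dislocation, if_neg (by linarith : ¬ 0 < -x), e]
    · simp only [dislocation, if_pos (by linarith : 0 < -x)]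
      ring_nf
    · simp only [dislocation, if_neg (by linarith : ¬ 0 < -x), e]

end Dislocation

/-! ### Growth of Bloch modes for continuous positive potentials -/

namespace SolvesHill

variable {Q u : ℝ → ℝ}

theorem hasDerivAt (h : SolvesHill Q u) (x : ℝ) : HasDerivAt u (deriv u x) x :=
  (h.1.differentiable one_ne_zero x).hasDerivAt

theorem hasDerivAt_deriv (h : SolvesHill Q u) (hQ : Continuous Q) (x : ℝ) :
    HasDerivAt (deriv u) (Q x * u x) x := by
  have hc : Continuous fun t => Q t * u t := hQ.mul h.1.continuous
  have e : deriv u = fun x => deriv u 0 + ∫ t in (0:ℝ)..x, Q t * u t := by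
    ext y; rw [← h.2 0 y]; ring
  rw [e]
  exact (intervalIntegral.integral_hasDerivAt_right (hc.intervalIntegrable _ _)
    (hc.stronglyMeasurableAtFilter _ _) hc.continuousAt).const_add _

end SolvesHill

namespace IsBlochMode

variable {Q q : ℝ → ℝ} {κ κ' a b : ℝ}

/-- Over one period u' is multiplied by e^κ, so (e^κ - 1) u'(x) equals the integral of Q u over that
period, which is positive. -/
theorem deriv_pos (h : IsBlochMode Q κ q) (hκ : 0 < κ) (hQ : Continuous Q) (hQ0 : ∀ x, 0 < Q x)
    (x : ℝ) : 0 < deriv (fun x => q x * Real.exp (κ * x)) x := by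
  have h1 := h.solves.2 x (x + 1)
  rw [h.deriv_periodic] at h1
  have h2 : 0 < ∫ t in x..(x + 1), Q t * (q t * Real.exp (κ * t)) :=
    intervalIntegral.intervalIntegral_pos_of_pos
      ((hQ.mul h.solves.1.continuous).intervalIntegrable _ _)
      (fun t => mul_pos (hQ0 t) (mul_pos (h.pos t) (Real.exp_pos _))) (by linarith)
  have h3 : 1 < Real.exp κ := Real.one_lt_exp_iff.2 hκ
  have h4 : 0 < (Real.exp κ - 1) * deriv (fun x => q x * Real.exp (κ * x)) x := by linarith
  exact (pos_iff_pos_of_mul_pos h4).1 (by linarith)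

/-- The logarithmic derivative of a growing Bloch mode lies between the bounds for `√Q`. -/
theorem logDeriv_mem_Icc (h : IsBlochMode Q κ q) (hκ : 0 < κ) (hQ : Continuous Q) (ha : 0 < a)
    (hb : 0 < b) (hQa : ∀ x, a ^ 2 ≤ Q x) (hQb : ∀ x, Q x ≤ b ^ 2) (x : ℝ) :
    a * (q x * Real.exp (κ * x)) ≤ deriv (fun x => q x * Real.exp (κ * x)) x ∧
      deriv (fun x => q x * Real.exp (κ * x)) x ≤ b * (q x * Real.exp (κ * x)) := by
  have hd := h.deriv_pos hκ hQ fun x => (by positivity : 0 < a ^ 2).trans_le (hQa x)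
  set u : ℝ → ℝ := fun x => q x * Real.exp (κ * x) with hu
  have hu0 : ∀ x, 0 < u x := fun x => mul_pos (h.pos x) (Real.exp_pos _)
  set ρ : ℝ → ℝ := fun x => deriv u x / u x with hρ
  -- Riccati equation. As ρ is periodic it attains its extrema, where ρ² = Q; with ρ > 0 this bounds
  -- ρ by `a` and `b` everywhere.
  have hρd : ∀ x, HasDerivAt ρ (Q x - ρ x ^ 2) x := by
    intro x
    refine ((h.solves.hasDerivAt_deriv hQ x).div (h.solves.hasDerivAt x) (hu0 x).ne').congr_deriv ?_
    have := (hu0 x).ne'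
    have key : ∀ U U' c : ℝ, U ≠ 0 → (c * U * U - U' * U') / U ^ 2 = c - (U' / U) ^ 2 := by
      intro U U' c hU
      field_simp
    exact key _ _ _ this
  have hρc : Continuous ρ := continuous_iff_continuousAt.2 fun x => (hρd x).continuousAt
  have hρp : Function.Periodic ρ 1 := by
    intro x
    have e1 : u (x + 1) = Real.exp κ * u x := by
      simp only [hu]; rw [h.periodic, mul_add, mul_one, Real.exp_add]; ring
    simp only [hρ]
    rw [h.deriv_periodic, e1]
    exact mul_div_mul_left _ _ (Real.exp_pos _).ne'
  have hρ0 : ∀ x, 0 < ρ x := fun x => div_pos (hd x) (hu0 x)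
  have ext : ∀ x, IsLocalExtr ρ x → ρ x ^ 2 = Q x := fun x hx => by
    have := hx.hasDerivAt_eq_zero (hρd x); linarith
  have glob : ∀ y, ∃ t ∈ Icc (0:ℝ) 1, ρ y = ρ t := fun y => by
    obtain ⟨t, ht, e⟩ := hρp.exists_mem_Ico₀ one_pos y
    exact ⟨t, ⟨ht.1, ht.2.le⟩, e⟩
  obtain ⟨xM, -, hM⟩ := isCompact_Icc.exists_isMaxOn (nonempty_Icc.2 (zero_le_one (α := ℝ)))
    hρc.continuousOn
  obtain ⟨xm, -, hm⟩ := isCompact_Icc.exists_isMinOn (nonempty_Icc.2 (zero_le_one (α := ℝ)))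
    hρc.continuousOn
  have hM' : ∀ y, ρ y ≤ ρ xM := fun y => by
    obtain ⟨t, ht, e⟩ := glob y
    rw [e]; exact hM ht
  have hm' : ∀ y, ρ xm ≤ ρ y := fun y => by
    obtain ⟨t, ht, e⟩ := glob y
    rw [e]; exact hm ht
  have eM := ext xM (Or.inr (Eventually.of_forall hM'))
  have em := ext xm (Or.inl (Eventually.of_forall hm'))
  have bM : ρ xM ≤ b := le_of_sq_le_sq (by rw [eM]; exact hQb _) hb.le
  have bm : a ≤ ρ xm := le_of_sq_le_sq (by rw [em]; exact hQa _) (hρ0 _).le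
  have e : deriv u x = ρ x * u x := by simp only [hρ]; rw [div_mul_cancel₀ _ (hu0 x).ne']
  rw [e]
  exact ⟨mul_le_mul_of_nonneg_right (bm.trans (hm' x)) (hu0 x).le,
    mul_le_mul_of_nonneg_right ((hM' x).trans bM) (hu0 x).le⟩

/-- By the bounds on u'/u, u e^(-ax) increases and u e^(-bx) decreases; both are compared with their
values at 0. -/
theorem exp_bounds (h : IsBlochMode Q κ q) (hκ : 0 < κ) (hQ : Continuous Q) (ha : 0 < a)
    (hb : 0 < b) (hQa : ∀ x, a ^ 2 ≤ Q x) (hQb : ∀ x, Q x ≤ b ^ 2) {x : ℝ} (hx : x ≤ 0) :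
    q 0 * Real.exp (b * x) ≤ q x * Real.exp (κ * x) ∧
      q x * Real.exp (κ * x) ≤ q 0 * Real.exp (a * x) := by
  have hl := h.logDeriv_mem_Icc hκ hQ ha hb hQa hQb
  set u : ℝ → ℝ := fun x => q x * Real.exp (κ * x) with hu
  have hu0 : u 0 = q 0 := by simp [hu]
  have hd : ∀ c x, HasDerivAt (fun x => u x * Real.exp (-(c * x)))
      ((deriv u x - c * u x) * Real.exp (-(c * x))) x := by
    intro c x
    have h1 : HasDerivAt (fun x : ℝ => Real.exp (-(c * x))) (Real.exp (-(c * x)) * (-(c * 1))) x :=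
      ((hasDerivAt_id x).const_mul c).neg.exp
    exact ((h.solves.hasDerivAt x).mul h1).congr_deriv (by ring)
  have hmono : Monotone fun x => u x * Real.exp (-(a * x)) :=
    monotone_of_hasDerivAt_nonneg (hd a) fun x =>
      mul_nonneg (by linarith [(hl x).1]) (Real.exp_pos _).le
  have hanti : Antitone fun x => u x * Real.exp (-(b * x)) :=
    antitone_of_hasDerivAt_nonpos (hd b) fun x =>
      mul_nonpos_of_nonpos_of_nonneg (by linarith [(hl x).2]) (Real.exp_pos _).le
  have h1 := hmono hx
  have h2 := hanti hx
  simp only [mul_zero, neg_zero, Real.exp_zero, mul_one, hu0, Real.exp_neg, ← div_eq_mul_inv] at h1 h2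
  rw [div_le_iff₀ (Real.exp_pos _)] at h1
  rw [le_div_iff₀ (Real.exp_pos _)] at h2
  exact ⟨h2, h1⟩

/-- Growing and decaying Bloch modes have opposite exponents. -/
theorem exponent_eq {q' : ℝ → ℝ} (h : IsBlochMode Q κ q) (h' : IsBlochMode Q (-κ') q')
    (hκ : 0 < κ) (hκ' : 0 < κ') (hQ : Continuous Q) (hQ0 : ∀ x, 0 < Q x) : κ = κ' := by
  have d1 := h.deriv_pos hκ hQ hQ0
  have d2 := h'.deriv_periodic
  have p1 := h.deriv_periodic
  have hR := h'.comp_neg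
  rw [neg_neg] at hR
  have d3 := hR.deriv_pos hκ' (hQ.comp continuous_neg) (fun x => hQ0 _)
  set u : ℝ → ℝ := fun x => q x * Real.exp (κ * x) with hu
  set v : ℝ → ℝ := fun x => q' x * Real.exp (-κ' * x) with hv
  have hu0 : ∀ x, 0 < u x := fun x => mul_pos (h.pos x) (Real.exp_pos _)
  have hv0 : ∀ x, 0 < v x := fun x => mul_pos (h'.pos x) (Real.exp_pos _)
  have d4 : ∀ x, deriv v x < 0 := by
    intro x
    have e : (fun x => q' (-x) * Real.exp (κ' * x)) = fun x => v (-x) := by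
      ext y; simp [hv]
    have := d3 (-x)
    rw [e, deriv_comp_neg, neg_neg] at this
    linarith
  -- The Wronskian is constant, yet a period multiplies it by e^(κ - κ'). It is nonzero because `u`
  -- increases and `v` decreases.
  set W : ℝ → ℝ := fun x => u x * deriv v x - deriv u x * v x with hW
  have hWd : ∀ x, HasDerivAt W 0 x := fun x =>
    (((h.solves.hasDerivAt x).mul (h'.solves.hasDerivAt_deriv hQ x)).sub
      ((h.solves.hasDerivAt_deriv hQ x).mul (h'.solves.hasDerivAt x))).congr_deriv (by ring)
  have hconst : W (0 + 1) = W 0 :=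
    is_const_of_deriv_eq_zero (fun x => (hWd x).differentiableAt) (fun x => (hWd x).deriv) _ _
  have hW0 : W 0 < 0 := by
    simp only [hW]
    nlinarith [mul_pos (hu0 0) (neg_pos.2 (d4 0)), mul_pos (d1 0) (hv0 0)]
  have e1 : u (0 + 1) = Real.exp κ * u 0 := by
    simp only [hu]; rw [h.periodic, mul_add, mul_one, Real.exp_add]; ring
  have e2 : v (0 + 1) = Real.exp (-κ') * v 0 := by
    simp only [hv]; rw [h'.periodic, mul_add, mul_one, Real.exp_add]; ring
  have hW1 : W (0 + 1) = Real.exp κ * Real.exp (-κ') * W 0 := by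
    simp only [hW]
    rw [e1, e2, d2, p1]; ring
  rw [hconst, ← Real.exp_add] at hW1
  have h1 : Real.exp (κ + -κ') = 1 := by
    have : (Real.exp (κ + -κ') - 1) * W 0 = 0 := by linarith
    rcases mul_eq_zero.1 this with h | h
    · linarith
    · exact absurd h hW0.ne
  rw [Real.exp_eq_one_iff] at h1
  linarith

end IsBlochMode

/-! ### Concentration of the weight as λ → -∞ -/

/-- A weight concentrated near `0` detects the sign of a function at `0⁻`. -/
theorem intervalIntegral_mul_sq_neg {D ψ : ℝ → ℝ} {M δ ε a b : ℝ} (hD : Continuous D)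
    (hψ : Continuous ψ) (hM : ∀ x, |D x| ≤ M) (hδ : 0 < δ) (hε : 0 < ε) (hε1 : ε ≤ 1)
    (hDδ : ∀ x, -ε ≤ x → x ≤ 0 → D x ≤ δ * x) (ha : 0 < a) (hb : 1 / ε ≤ b)
    (hlow : ∀ x ≤ 0, Real.exp (b * x) ≤ ψ x) (hup : ∀ x ≤ 0, ψ x ≤ Real.exp (a * x))
    (hbig : M * Real.exp (-(2 * a * ε)) < δ * Real.exp (-2) / (4 * b ^ 2)) :
    ∫ x in (-1:ℝ)..0, D x * ψ x ^ 2 < 0 := by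
  have hb0 : 0 < b := (by positivity : 0 < 1 / ε).trans_le hb
  have hbε : 1 / b ≤ ε := by rwa [one_div_le hb0 hε]
  have hM0 : 0 ≤ M := (abs_nonneg _).trans (hM 0)
  have hi : ∀ c d, IntervalIntegrable (fun x => D x * ψ x ^ 2) volume c d :=
    fun c d => (hD.mul (hψ.pow 2)).intervalIntegrable c d
  have hψ0 : ∀ x ≤ 0, 0 ≤ ψ x := fun x hx => (Real.exp_pos _).le.trans (hlow x hx)
  have hhalf : 1 / (2 * b) ≤ 1 / b := one_div_le_one_div_of_le hb0 (by linarith)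
  have hp : 0 < 1 / (2 * b) := by positivity
  -- The interval is split at -ε, -1/b and -1/(2b). This far piece is exponentially small. On [-1/b,
  -- -1/(2b)] one has D ≤ -δ/(2b) and ψ² ≥ e^(-2), a contribution of at most -δ e^(-2)/(4b²); the
  -- other pieces are nonpositive.
  have s1 : ∫ x in (-1:ℝ)..(-ε), D x * ψ x ^ 2 ≤ M * Real.exp (-(2 * a * ε)) := by
    have : ∫ x in (-1:ℝ)..(-ε), D x * ψ x ^ 2
        ≤ ∫ _x in (-1:ℝ)..(-ε), M * Real.exp (-(2 * a * ε)) := by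
      refine intervalIntegral.integral_mono_on (by linarith) (hi _ _) (by simp) fun x hx => ?_
      have hx0 : x ≤ 0 := by linarith [hx.2]
      have h1 : ψ x ^ 2 ≤ Real.exp (-(2 * a * ε)) := by
        calc ψ x ^ 2 ≤ Real.exp (a * x) ^ 2 := pow_le_pow_left₀ (hψ0 x hx0) (hup x hx0) 2
          _ = Real.exp (2 * (a * x)) := by rw [← Real.exp_nat_mul]; norm_cast
          _ ≤ _ := by apply Real.exp_le_exp.2; nlinarith [hx.2]
      exact mul_le_mul ((le_abs_self _).trans (hM x)) h1 (sq_nonneg _) hM0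
    refine this.trans ?_
    rw [intervalIntegral.integral_const, smul_eq_mul]
    refine mul_le_of_le_one_left (by positivity) (by linarith)
  have nonpos : ∀ c d, c ≤ d → -ε ≤ c → d ≤ 0 → ∫ x in c..d, D x * ψ x ^ 2 ≤ 0 := by
    intro c d hcd hc hd
    have : ∫ x in c..d, D x * ψ x ^ 2 ≤ ∫ _x in c..d, (0:ℝ) := by
      refine intervalIntegral.integral_mono_on hcd (hi _ _) (by simp) fun x hx => ?_
      have h1 := hDδ x (by linarith [hx.1]) (by linarith [hx.2])
      have : δ * x ≤ 0 := mul_nonpos_of_nonneg_of_nonpos hδ.le (by linarith [hx.2])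
      exact mul_nonpos_of_nonpos_of_nonneg (by linarith) (sq_nonneg _)
    simpa using this
  have s2 := nonpos (-ε) (-(1 / b)) (by linarith) le_rfl (by linarith)
  have s4 := nonpos (-(1 / (2 * b))) 0 (by linarith) (by linarith) le_rfl
  have s3 : ∫ x in (-(1 / b))..(-(1 / (2 * b))), D x * ψ x ^ 2 ≤ -(δ * Real.exp (-2) / (4 * b ^ 2)) := by
    have : ∫ x in (-(1 / b))..(-(1 / (2 * b))), D x * ψ x ^ 2
        ≤ ∫ _x in (-(1 / b))..(-(1 / (2 * b))), -(δ / (2 * b) * Real.exp (-2)) := by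
      refine intervalIntegral.integral_mono_on (by linarith) (hi _ _) (by simp) fun x hx => ?_
      have hx0 : x ≤ 0 := by linarith [hx.2]
      have h1 := hDδ x (by linarith [hx.1]) hx0
      have h2 : δ * x ≤ -(δ / (2 * b)) := by
        have := mul_le_mul_of_nonneg_left hx.2 hδ.le
        calc δ * x ≤ δ * -(1 / (2 * b)) := this
          _ = _ := by ring
      have h3 : Real.exp (-2) ≤ ψ x ^ 2 := by
        calc Real.exp (-2) ≤ Real.exp (2 * (b * x)) := by
              apply Real.exp_le_exp.2
              have := mul_le_mul_of_nonneg_left hx.1 hb0.le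
              rw [mul_neg, mul_one_div_cancel hb0.ne'] at this
              linarith
          _ = Real.exp (b * x) ^ 2 := by rw [← Real.exp_nat_mul]; norm_cast
          _ ≤ _ := pow_le_pow_left₀ (Real.exp_pos _).le (hlow x hx0) 2
      have h4 : 0 < δ / (2 * b) := by positivity
      have h5 : D x ≤ -(δ / (2 * b)) := h1.trans h2
      nlinarith [mul_le_mul_of_nonneg_right h5 (sq_nonneg (ψ x)), mul_le_mul_of_nonneg_left h3 h4.le]
    refine this.trans (le_of_eq ?_)
    rw [intervalIntegral.integral_const, smul_eq_mul]
    field_simp; ring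
  rw [← intervalIntegral.integral_add_adjacent_intervals (hi (-1) (-ε)) (hi _ _),
    ← intervalIntegral.integral_add_adjacent_intervals (hi (-ε) (-(1 / b))) (hi _ _),
    ← intervalIntegral.integral_add_adjacent_intervals (hi (-(1 / b)) (-(1 / (2 * b)))) (hi _ _)]
  linarith

/-- For very negative spectral parameters the left Bloch condition follows from the behaviour of
the potential difference at `0⁻`. -/
theorem exists_leftBlochCondition {V₀ : ℝ → ℝ} {C τ δ ε : ℝ} (hV : Continuous V₀)
    (hC : ∀ x, |V₀ x| ≤ C) (hδ : 0 < δ) (hε : 0 < ε)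
    (hD : ∀ x, -ε ≤ x → x ≤ 0 → V₀ (x - τ) - V₀ (x + τ) ≤ δ * x) :
    ∃ lam₀ < (0:ℝ), ∀ lam < lam₀, ∀ κ q, 0 < κ → IsBlochMode (fun x => V₀ x - lam) κ q →
      LeftBlochCondition V₀ τ κ q := by
  wlog hε1 : ε ≤ 1 generalizing ε
  · exact this one_pos (fun x h1 h2 => hD x (by linarith [not_le.1 hε1]) h2) le_rfl
  have hC0 : 0 ≤ C := (abs_nonneg _).trans (hC 0)
  -- `k² e^{-kε} → 0`
  have hlim : Tendsto (fun k : ℝ => 2 * C * (16 * Real.exp 2) * (k ^ 2 * Real.exp (-ε * k))) atTop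
      (𝓝 0) := by
    have := (isLittleO_pow_exp_pos_mul_atTop (k := 2) hε).tendsto_div_nhds_zero
    have h2 := this.const_mul (2 * C * (16 * Real.exp 2))
    rw [mul_zero] at h2
    refine h2.congr fun k => ?_
    rw [neg_mul, Real.exp_neg, div_eq_mul_inv]
  obtain ⟨k₀, hk₀⟩ := eventually_atTop.1 (hlim.eventually (gt_mem_nhds hδ))
  -- For k = √(-λ) > k₁: `k₀` makes the far piece negligible, `1 / ε` places the concentration scale
  -- inside [-ε, 0], and `2 * C + 1` gives (k/2)² ≤ V₀ + k² ≤ (2k)², hence the exponents k/2 and 2k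
  -- below.
  set k₁ := max (max k₀ (1 / ε)) (2 * C + 1) with hk₁
  have hk₁0 : 0 < k₁ := lt_max_of_lt_right (by linarith)
  refine ⟨-k₁ ^ 2, by nlinarith, fun lam hlam κ q hκ hq => ?_⟩
  set k := √(-lam) with hk
  have hk2 : k ^ 2 = -lam := Real.sq_sqrt (by nlinarith)
  have hkk : k₁ < k := by
    rw [hk]; apply Real.lt_sqrt_of_sq_lt; linarith
  have hk0 : 0 < k := hk₁0.trans hkk
  have hkC : 2 * C + 1 < k := (le_max_right _ _).trans_lt hkk
  have hkε : 1 / ε ≤ k := ((le_max_right _ _).trans (le_max_left _ _)).trans hkk.le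
  have hkb := hk₀ k (((le_max_left _ _).trans (le_max_left _ _)).trans hkk.le)
  have hq' := hq.comp_add τ
  have hb := fun {x : ℝ} (hx : x ≤ 0) => hq'.exp_bounds (a := k / 2) (b := 2 * k) hκ
    ((hV.comp (continuous_id.add continuous_const)).sub continuous_const) (by positivity)
    (by positivity) (fun x => by
      have := (abs_le.1 (hC (x + τ))).1
      nlinarith) (fun x => by
      have := (abs_le.1 (hC (x + τ))).2
      nlinarith) hx
  simp only [zero_add] at hb
  have hqτ := hq.pos τ
  have key := intervalIntegral_mul_sq_neg (D := fun x => V₀ (x - τ) - V₀ (x + τ))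
    (ψ := fun x => q (x + τ) * Real.exp (κ * x) / q τ) (M := 2 * C) (a := k / 2) (b := 2 * k)
    (by fun_prop) (hq'.solves.1.continuous.div_const _)
    (fun x => (abs_sub _ _).trans (by linarith [hC (x - τ), hC (x + τ)])) hδ hε hε1 hD
    (by positivity) (by linarith) (fun x hx => ?_) (fun x hx => ?_) ?_
  · have e : ∀ x, (V₀ (x - τ) - V₀ (x + τ)) * (q (x + τ) * Real.exp (κ * x) / q τ) ^ 2
        = (1 / q τ ^ 2) * ((V₀ (x - τ) - V₀ (x + τ)) * (q (x + τ)) ^ 2 * Real.exp (2 * κ * x)) := by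
      intro x
      have : Real.exp (2 * κ * x) = Real.exp (κ * x) ^ 2 := by
        rw [← Real.exp_nat_mul]; congr 1; push_cast; ring
      rw [this]; field_simp
    simp only [e, intervalIntegral.integral_const_mul] at key
    have h1 : 0 < 1 / q τ ^ 2 := by positivity
    exact (pos_iff_neg_of_mul_neg key).1 h1
  · rw [le_div_iff₀ hqτ, mul_comm]; exact (hb hx).1
  · rw [div_le_iff₀ hqτ, mul_comm (Real.exp _)]; exact (hb hx).2
  · rw [lt_div_iff₀ (by positivity)]
    have e1 : 2 * (k / 2) * ε = ε * k := by ring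
    have e2 : Real.exp (-2) * Real.exp 2 = 1 := by rw [← Real.exp_add]; simp
    have e3 : 2 * C * Real.exp (-(ε * k)) * (4 * (2 * k) ^ 2)
        = Real.exp (-2) * (2 * C * (16 * Real.exp 2) * (k ^ 2 * Real.exp (-ε * k))) := by
      rw [neg_mul]
      linear_combination -(2 * C * 16 * k ^ 2 * Real.exp (-(ε * k))) * e2
    rw [e1, e3, mul_comm δ]
    exact mul_lt_mul_of_pos_left hkb (Real.exp_pos _)

/-! ### Existence of Bloch modes through the Riccati equation -/

theorem integral_exp_neg_mul {k : ℝ} (hk : 0 < k) :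
    ∫ r in (0:ℝ)..1, Real.exp (-(2 * k * r)) = (1 - Real.exp (-(2 * k))) / (2 * k) := by
  have hd : ∀ x ∈ uIcc (0:ℝ) 1, HasDerivAt (fun r => -Real.exp (-(2 * k * r)) / (2 * k))
      (Real.exp (-(2 * k * x))) x := by
    intro x _
    have h1 : HasDerivAt (fun r : ℝ => Real.exp (-(2 * k * r)))
        (Real.exp (-(2 * k * x)) * (-(2 * k * 1))) x :=
      ((hasDerivAt_id x).const_mul (2 * k)).neg.exp
    refine (h1.neg.div_const (2 * k)).congr_deriv ?_
    field_simp
  rw [intervalIntegral.integral_eq_sub_of_hasDerivAt hd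
    (Continuous.intervalIntegrable (by fun_prop) _ _)]
  simp only [mul_one, mul_zero, neg_zero, Real.exp_zero]
  ring

/-- The `1`-periodic solution of `G' + 2 k G = F` for `1`-periodic continuous `F`. -/
noncomputable def periodicResponse (k : ℝ) (F : ℝ → ℝ) (x : ℝ) : ℝ :=
  (1 - Real.exp (-(2 * k)))⁻¹ * ∫ r in (0:ℝ)..1, Real.exp (-(2 * k * r)) * F (x - r)

section PeriodicResponse

variable {k : ℝ} {F : ℝ → ℝ}

theorem one_sub_exp_neg_pos (hk : 0 < k) : 0 < 1 - Real.exp (-(2 * k)) := by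
  have : Real.exp (-(2 * k)) < Real.exp 0 := Real.exp_lt_exp.2 (by linarith)
  rw [Real.exp_zero] at this
  linarith

/-- The kernel is positive with total mass exactly 1/(2k); this factor drives the contraction for
large k. -/
theorem abs_periodicResponse_le (hk : 0 < k) {M : ℝ} (hM : ∀ x, |F x| ≤ M) (x : ℝ) :
    |periodicResponse k F x| ≤ M / (2 * k) := by
  have hc := one_sub_exp_neg_pos hk
  have h1 : |∫ r in (0:ℝ)..1, Real.exp (-(2 * k * r)) * F (x - r)|
      ≤ ∫ r in (0:ℝ)..1, Real.exp (-(2 * k * r)) * M := by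
    rw [← Real.norm_eq_abs]
    refine intervalIntegral.norm_integral_le_of_norm_le zero_le_one
      (Eventually.of_forall fun r _ => ?_) (Continuous.intervalIntegrable (by fun_prop) _ _)
    rw [norm_mul, Real.norm_eq_abs, abs_of_pos (Real.exp_pos _)]
    exact mul_le_mul_of_nonneg_left (hM _) (Real.exp_pos _).le
  rw [intervalIntegral.integral_mul_const, integral_exp_neg_mul hk] at h1
  rw [periodicResponse, abs_mul, abs_of_pos (inv_pos.2 hc)]
  refine (mul_le_mul_of_nonneg_left h1 (inv_pos.2 hc).le).trans (le_of_eq ?_)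
  have := hc.ne'
  field_simp

theorem continuous_periodicResponse (hF : Continuous F) : Continuous (periodicResponse k F) :=
  continuous_const.mul (intervalIntegral.continuous_parametric_intervalIntegral_of_continuous'
    (by fun_prop) 0 1)

theorem periodicResponse_sub {F' : ℝ → ℝ} (hF : Continuous F) (hF' : Continuous F') (x : ℝ) :
    periodicResponse k F x - periodicResponse k F' x
      = periodicResponse k (fun y => F y - F' y) x := by
  rw [periodicResponse, periodicResponse, periodicResponse, ← mul_sub,
    ← intervalIntegral.integral_sub (Continuous.intervalIntegrable (by fun_prop) _ _)
      (Continuous.intervalIntegrable (by fun_prop) _ _)]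
  simp only [mul_sub]

theorem Function.Periodic.periodicResponse (hF : Function.Periodic F 1) :
    Function.Periodic (periodicResponse k F) 1 := by
  intro x
  have : ∀ r, F (x + 1 - r) = F (x - r) := fun r => by rw [← hF (x - r)]; congr 1; ring
  simp only [_root_.periodicResponse, this]

/-- Variation of constants: substituting s = x - r rewrites the response as a multiple of
e^(-2kx)(P(x) - P(x - 1)), and periodicity of F produces the factor that cancels the normalization.
-/
theorem hasDerivAt_periodicResponse (hk : 0 < k) (hF : Continuous F) (hFp : Function.Periodic F 1)
    (x : ℝ) : HasDerivAt (periodicResponse k F) (F x - 2 * k * periodicResponse k F x) x := by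
  have hc := (one_sub_exp_neg_pos hk).ne'
  set P : ℝ → ℝ := fun x => ∫ s in (0:ℝ)..x, Real.exp (2 * k * s) * F s with hP
  have hcont : Continuous fun s => Real.exp (2 * k * s) * F s := by fun_prop
  have hPd : ∀ x, HasDerivAt P (Real.exp (2 * k * x) * F x) x := fun x =>
    intervalIntegral.integral_hasDerivAt_right (hcont.intervalIntegrable _ _)
      (hcont.stronglyMeasurableAtFilter _ _) hcont.continuousAt
  have e : periodicResponse k F = fun x => (1 - Real.exp (-(2 * k)))⁻¹ *
      (Real.exp (-(2 * k * x)) * (P x - P (x - 1))) := by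
    ext x
    have h1 := intervalIntegral.integral_comp_sub_left (a := (0:ℝ)) (b := 1)
      (fun s => Real.exp (-(2 * k * (x - s))) * F s) x
    simp only [sub_sub_cancel, sub_zero] at h1
    rw [periodicResponse, h1, hP]
    simp only
    rw [intervalIntegral.integral_interval_sub_left (hcont.intervalIntegrable _ _)
      (hcont.intervalIntegrable _ _), ← intervalIntegral.integral_const_mul (Real.exp _)]
    congr 1
    refine intervalIntegral.integral_congr fun s _ => ?_
    rw [← mul_assoc, ← Real.exp_add]
    congr 2; ring
  have hPs : HasDerivAt (fun x => P (x - 1)) (Real.exp (2 * k * (x - 1)) * F (x - 1)) x :=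
    HasDerivAt.comp_sub_const x 1 (hPd (x - 1))
  have he : HasDerivAt (fun r : ℝ => Real.exp (-(2 * k * r)))
      (Real.exp (-(2 * k * x)) * (-(2 * k * 1))) x :=
    ((hasDerivAt_id x).const_mul (2 * k)).neg.exp
  have hFx : F (x - 1) = F x := by
    have := hFp (x - 1); rwa [sub_add_cancel, eq_comm] at this
  rw [e]
  refine ((he.mul ((hPd x).sub hPs)).const_mul _).congr_deriv ?_
  rw [hFx]
  have e1 : Real.exp (-(2 * k * x)) * Real.exp (2 * k * x) = 1 := by
    rw [← Real.exp_add]; simp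
  have e2 : Real.exp (-(2 * k * x)) * Real.exp (2 * k * (x - 1)) = Real.exp (-(2 * k)) := by
    rw [← Real.exp_add]; congr 1; ring
  have e3 : Real.exp (-(2 * k * x)) * (Real.exp (2 * k * x) * F x
      - Real.exp (2 * k * (x - 1)) * F x) = (1 - Real.exp (-(2 * k))) * F x := by
    linear_combination F x * e1 - F x * e2
  have e4 : (1 - Real.exp (-(2 * k)))⁻¹ * ((1 - Real.exp (-(2 * k))) * F x) = F x :=
    inv_mul_cancel_left₀ hc _
  rw [mul_add, Pi.sub_apply, e3, e4]
  ring

end PeriodicResponse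

open BoundedContinuousFunction in
/-- The Riccati equation `σ' = V - σ² - 2 k σ` has a small periodic solution for large `k`. -/
theorem exists_periodic_riccati {V : ℝ → ℝ} {C k : ℝ} (hV : Continuous V) (hC : ∀ x, |V x| ≤ C)
    (hVp : Function.Periodic V 1) (hk : C + 2 ≤ k) :
    ∃ σ : ℝ → ℝ, Continuous σ ∧ Function.Periodic σ 1 ∧ (∀ x, |σ x| ≤ 1) ∧
      ∀ x, HasDerivAt σ (V x - σ x ^ 2 - 2 * k * σ x) x := by
  have hC0 : 0 ≤ C := (abs_nonneg _).trans (hC 0)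
  have hk0 : 0 < k := by linarith
  have hb : ∀ f : ℝ →ᵇ ℝ, ∀ x, |V x - f x ^ 2| ≤ C + ‖f‖ ^ 2 := fun f x => by
    refine (abs_sub _ _).trans (add_le_add (hC x) ?_)
    rw [abs_pow]
    exact pow_le_pow_left₀ (abs_nonneg _) (f.norm_coe_le_norm x) 2
  have hcont : ∀ f : ℝ →ᵇ ℝ, Continuous fun x => V x - f x ^ 2 := fun f =>
    hV.sub (f.continuous.pow 2)
  let T : (ℝ →ᵇ ℝ) → (ℝ →ᵇ ℝ) := fun f =>
    BoundedContinuousFunction.ofNormedAddCommGroup (periodicResponse k fun x => V x - f x ^ 2)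
      (continuous_periodicResponse (hcont f)) _ fun x => abs_periodicResponse_le hk0 (hb f) x
  have hT : ∀ f x, T f x = periodicResponse k (fun x => V x - f x ^ 2) x := fun f x => rfl
  -- On this closed set `T` has sup norm at most (C + 1)/(2k) ≤ 1 and Lipschitz constant at most
  -- 2/(2k) ≤ 1/2, both from k ≥ C + 2.
  let s : Set (ℝ →ᵇ ℝ) := {f | ∀ x, f (x + 1) = f x ∧ |f x| ≤ 1}
  have hs : IsClosed s := by
    have : s = ⋂ x : ℝ, ({f | f (x + 1) = f x} ∩ {f | |f x| ≤ 1}) := by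
      ext f; simp [s]
    rw [this]
    refine isClosed_iInter fun x => IsClosed.inter ?_ ?_
    · exact isClosed_eq (continuous_eval_const (x := x + 1)) (continuous_eval_const (x := x))
    · exact isClosed_le (continuous_eval_const (x := x)).abs continuous_const
  have hmaps : MapsTo T s s := by
    intro f hf x
    refine ⟨?_, ?_⟩
    · have hp : Function.Periodic (fun x => V x - f x ^ 2) 1 := fun x => by
        simp only [(hf x).1, hVp x]
      exact hp.periodicResponse x
    · have h1 : ∀ x, |V x - f x ^ 2| ≤ C + 1 := fun x => by
        refine (abs_sub _ _).trans (add_le_add (hC x) ?_)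
        rw [abs_pow]
        exact pow_le_one₀ (abs_nonneg _) (hf x).2
      refine (abs_periodicResponse_le hk0 h1 x).trans ?_
      rw [div_le_one (by positivity)]
      linarith
  have hcontr : ContractingWith (1 / 2) (hmaps.restrict T s s) := by
    refine ⟨by
      rw [← NNReal.coe_lt_coe]; norm_num, LipschitzWith.of_dist_le_mul ?_⟩
    rintro ⟨f, hf⟩ ⟨g, hg⟩
    rw [Subtype.dist_eq, Subtype.dist_eq]
    change dist (T f) (T g) ≤ _ * dist f g
    rw [BoundedContinuousFunction.dist_le (by positivity)]
    intro x
    rw [hT, hT, Real.dist_eq, periodicResponse_sub (hcont f) (hcont g)]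
    have h1 : ∀ x, |V x - f x ^ 2 - (V x - g x ^ 2)| ≤ 2 * dist f g := by
      intro x
      have e : V x - f x ^ 2 - (V x - g x ^ 2) = -((f x + g x) * (f x - g x)) := by ring
      rw [e, abs_neg, abs_mul]
      refine mul_le_mul ((abs_add_le _ _).trans (by linarith [(hf x).2, (hg x).2])) ?_
        (abs_nonneg _) zero_le_two
      rw [← Real.dist_eq]
      exact f.dist_coe_le_dist x
    refine (abs_periodicResponse_le hk0 h1 x).trans ?_
    have hd : 0 ≤ dist f g := dist_nonneg
    rw [div_le_iff₀ (by positivity)]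
    push_cast
    nlinarith
  obtain ⟨σ, hσs, hσ, -⟩ := hcontr.exists_fixedPoint' hs.isComplete hmaps (x := 0)
    (fun x => by simp) (edist_ne_top _ _)
  have hσ' : (σ : ℝ → ℝ) = periodicResponse k fun x => V x - σ x ^ 2 := by
    ext x
    have : T σ = σ := hσ
    rw [← hT, this]
  refine ⟨σ, σ.continuous, fun x => (hσs x).1, fun x => (hσs x).2, fun x => ?_⟩
  have := hasDerivAt_periodicResponse hk0 (hcont σ) (fun x => by
        simp only [(hσs x).1, hVp x]) x
  rwa [← hσ'] at this

/-- Existence of a growing Bloch mode for very negative spectral parameters. -/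
theorem exists_isBlochMode {V : ℝ → ℝ} {C k : ℝ} (hV : Continuous V) (hC : ∀ x, |V x| ≤ C)
    (hVp : Function.Periodic V 1) (hk : C + 2 ≤ k) :
    ∃ κ q, 0 < κ ∧ IsBlochMode (fun x => V x + k ^ 2) κ q := by
  have hC0 : 0 ≤ C := (abs_nonneg _).trans (hC 0)
  obtain ⟨σ, hσc, hσp, hσ1, hσd⟩ := exists_periodic_riccati hV hC hVp hk
  -- Writing ρ = k + σ turns the equation for σ into ρ' + ρ² = V + k², so exp ∫ρ solves the linear
  -- equation; its exponent κ is the mean of ρ, positive because |σ| ≤ 1 < k.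
  set ρ : ℝ → ℝ := fun x => k + σ x with hρ
  have hρc : Continuous ρ := continuous_const.add hσc
  have hρ0 : ∀ x, 0 < ρ x := fun x => by
    have := (abs_le.1 (hσ1 x)).1
    simp only [hρ]; linarith
  have hρp : Function.Periodic ρ 1 := fun x => by simp only [hρ, hσp x]
  set κ := ∫ t in (0:ℝ)..1, ρ t with hκ
  have hκ0 : 0 < κ :=
    intervalIntegral.intervalIntegral_pos_of_pos (hρc.intervalIntegrable _ _) hρ0 one_pos
  set R : ℝ → ℝ := fun x => ∫ t in (0:ℝ)..x, ρ t with hR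
  have hRd : ∀ x, HasDerivAt R (ρ x) x := fun x =>
    intervalIntegral.integral_hasDerivAt_right (hρc.intervalIntegrable _ _)
      (hρc.stronglyMeasurableAtFilter _ _) hρc.continuousAt
  have hR1 : ∀ x, R (x + 1) = R x + κ := fun x => by
    have h1 := intervalIntegral.integral_add_adjacent_intervals
      (hρc.intervalIntegrable (μ := volume) 0 x) (hρc.intervalIntegrable x (x + 1))
    have h2 := hρp.intervalIntegral_add_eq x 0
    rw [zero_add] at h2
    rw [hR, hκ, ← h2]; exact h1.symm
  set u : ℝ → ℝ := fun x => Real.exp (R x) with hu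
  have hud : ∀ x, HasDerivAt u (ρ x * u x) x := fun x =>
    (hRd x).exp.congr_deriv (mul_comm _ _)
  have hude : deriv u = fun x => ρ x * u x := funext fun x => (hud x).deriv
  have huc : Continuous u := continuous_iff_continuousAt.2 fun x => (hud x).continuousAt
  have hudd : ∀ x, HasDerivAt (deriv u) ((V x + k ^ 2) * u x) x := fun x => by
    rw [hude]
    refine (((hσd x).const_add k).mul (hud x)).congr_deriv ?_
    simp only [hρ]; ring
  have hus : SolvesHill (fun x => V x + k ^ 2) u := by
    refine ⟨contDiff_one_iff_deriv.2 ⟨fun x => (hud x).differentiableAt, ?_⟩, fun a b => ?_⟩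
    · rw [hude]; exact hρc.mul huc
    · exact (intervalIntegral.integral_eq_sub_of_hasDerivAt (fun x _ => hudd x)
        (Continuous.intervalIntegrable (by fun_prop) _ _)).symm
  set q₀ : ℝ → ℝ := fun x => Real.exp (R x - κ * x) with hq₀
  have hRc : Continuous R := continuous_iff_continuousAt.2 fun x => (hRd x).continuousAt
  have hq₀p : Function.Periodic q₀ 1 := fun x => by
    simp only [hq₀, hR1]; congr 1; ring
  obtain ⟨xM, -, hM⟩ := isCompact_Icc.exists_isMaxOn (nonempty_Icc.2 (zero_le_one (α := ℝ)))
    (f := q₀) (by fun_prop)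
  have hM' : ∀ y, q₀ y ≤ q₀ xM := fun y => by
    obtain ⟨t, ht, e⟩ := hq₀p.exists_mem_Ico₀ one_pos y
    rw [e]; exact hM ⟨ht.1, ht.2.le⟩
  have hpos : ∀ x, 0 < q₀ x := fun x => Real.exp_pos _
  refine ⟨κ, fun x => q₀ x / q₀ xM, hκ0, fun x => by simp only [hq₀p x],
    fun x => div_pos (hpos x) (hpos xM), IsGreatest.isLUB ⟨⟨xM, div_self (hpos xM).ne'⟩, ?_⟩, ?_⟩
  · rintro _ ⟨y, rfl⟩
    exact (div_le_one (hpos xM)).2 (hM' y)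
  · have := hus.const_mul (1 / q₀ xM)
    convert this using 2 with x
    rw [hu]
    simp only [hq₀]
    rw [div_mul_eq_mul_div, ← Real.exp_add, sub_add_cancel, one_div_mul_eq_div]

/-- The decaying mode is the reflected growing mode of the reflected potential; the Wronskian
argument identifies the two separately constructed exponents. -/
theorem exists_isBlochModePair {V : ℝ → ℝ} {C k : ℝ} (hV : Continuous V) (hC : ∀ x, |V x| ≤ C)
    (hVp : Function.Periodic V 1) (hk : C + 2 ≤ k) :
    ∃ κ pPlus pMinus, IsBlochModePair (fun x => V x + k ^ 2) κ pPlus pMinus := by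
  have hC0 : 0 ≤ C := (abs_nonneg _).trans (hC 0)
  obtain ⟨κ, q, hκ, hq⟩ := exists_isBlochMode hV hC hVp hk
  have hVp' : Function.Periodic (fun x => V (-x)) 1 := fun x => by
    have := hVp (-(x + 1))
    simp only
    rw [← this]; congr 1; ring
  obtain ⟨κ', q', hκ', hq'⟩ := exists_isBlochMode (V := fun x => V (-x)) (hV.comp continuous_neg)
    (fun x => hC (-x)) hVp' hk
  have hR := hq'.comp_neg
  simp only [neg_neg] at hR
  have e := hq.exponent_eq hR hκ hκ' (by fun_prop) (fun x => by
    have := (abs_le.1 (hC x)).1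
    nlinarith)
  exact ⟨κ, _, _, hκ, e ▸ hR, hq⟩

/-! ### Pointwise conditions on the potential -/

/-- A continuous function negative at `0` lies below a line of positive slope on some `[-ε, 0]`. -/
theorem exists_le_mul_of_neg {D : ℝ → ℝ} (hD : Continuous D) (h0 : D 0 < 0) :
    ∃ δ > 0, ∃ ε > 0, ∀ x, -ε ≤ x → x ≤ 0 → D x ≤ δ * x := by
  have hc : ContinuousAt (fun x => D x - x) 0 := by fun_prop
  have := hc.eventually (gt_mem_nhds (by simpa using h0 : D 0 - 0 < 0))
  obtain ⟨ε, hε, h⟩ := Metric.eventually_nhds_iff.1 this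
  refine ⟨1, one_pos, ε / 2, by positivity, fun x h1 h2 => ?_⟩
  have := h (y := x) (by rw [Real.dist_eq, sub_zero, abs_lt]; constructor <;> linarith)
  linarith

/-- A function vanishing at `0` with positive derivative lies below a line of positive slope on
some `[-ε, 0]`. -/
theorem exists_le_mul_of_hasDerivAt {D : ℝ → ℝ} {d : ℝ} (hD : HasDerivAt D d 0) (h0 : D 0 = 0)
    (hd : 0 < d) : ∃ δ > 0, ∃ ε > 0, ∀ x, -ε ≤ x → x ≤ 0 → D x ≤ δ * x := by
  have := hD.isLittleO.def (half_pos hd)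
  obtain ⟨ε, hε, h⟩ := Metric.eventually_nhds_iff.1 this
  refine ⟨d / 2, by positivity, ε / 2, by positivity, fun x h1 h2 => ?_⟩
  have := h (y := x) (by rw [Real.dist_eq, sub_zero, abs_lt]; constructor <;> linarith)
  simp only [h0, sub_zero, smul_eq_mul, Real.norm_eq_abs, abs_of_nonpos h2] at this
  have := (abs_le.1 this).2
  linarith

/-- Let D(x) = V₀(x - τ) - V₀(x + τ). If D(0) < 0, or D(0) = 0 < D'(0), then D is negative just left
of 0 and the left condition holds; if D(0) > 0, reflection gives the right one. The threshold is
fixed before the modes, so it depends only on V₀ and τ. -/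
theorem exists_blochModePair_and_condition {V₀ : ℝ → ℝ} {C τ : ℝ} (hV : ContDiff ℝ 1 V₀)
    (hC : ∀ x, |V₀ x| ≤ C) (hVp : Function.Periodic V₀ 1) (hτ : DislocationCondition V₀ τ) :
    ∃ lam₀ < (0 : ℝ), ∀ lam < lam₀,
      (∃ (κ : ℝ) (pPlus pMinus : ℝ → ℝ),
        IsBlochModePair (fun x => V₀ x - lam) κ pPlus pMinus) ∧
      ∀ (κ : ℝ) (pPlus pMinus : ℝ → ℝ),
        IsBlochModePair (fun x => V₀ x - lam) κ pPlus pMinus →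
        LeftBlochCondition V₀ τ κ pMinus ∨ RightBlochCondition V₀ τ κ pPlus := by
  have hC0 : 0 ≤ C := (abs_nonneg _).trans (hC 0)
  have hVc := hV.continuous
  suffices H : ∃ lam₀ < (0 : ℝ), ∀ lam < lam₀, ∀ (κ : ℝ) (pPlus pMinus : ℝ → ℝ),
      IsBlochModePair (fun x => V₀ x - lam) κ pPlus pMinus →
        LeftBlochCondition V₀ τ κ pMinus ∨ RightBlochCondition V₀ τ κ pPlus by
    obtain ⟨lam₀, h0, h⟩ := H
    refine ⟨min lam₀ (-(C + 2) ^ 2), (min_le_left _ _).trans_lt h0, fun lam hlam => ⟨?_, ?_⟩⟩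
    · have h1 : lam < -(C + 2) ^ 2 := hlam.trans_le (min_le_right _ _)
      have h2 : √(-lam) ^ 2 = -lam := Real.sq_sqrt (by nlinarith)
      have h3 : C + 2 ≤ √(-lam) := Real.le_sqrt_of_sq_le (by linarith)
      have := exists_isBlochModePair hVc hC hVp h3
      simpa only [h2, ← sub_eq_add_neg] using this
    · exact h lam (hlam.trans_le (min_le_left _ _))
  have left : ∀ δ > 0, ∀ ε > 0, (∀ x, -ε ≤ x → x ≤ 0 → V₀ (x - τ) - V₀ (x + τ) ≤ δ * x) →
      ∃ lam₀ < (0 : ℝ), ∀ lam < lam₀, ∀ (κ : ℝ) (pPlus pMinus : ℝ → ℝ),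
      IsBlochModePair (fun x => V₀ x - lam) κ pPlus pMinus →
        LeftBlochCondition V₀ τ κ pMinus ∨ RightBlochCondition V₀ τ κ pPlus := by
    intro δ hδ ε hε hD
    obtain ⟨lam₀, h0, h⟩ := exists_leftBlochCondition hVc hC hδ hε hD
    exact ⟨lam₀, h0, fun lam hlam κ _ _ hb => Or.inl (h lam hlam κ _ hb.kappa_pos hb.minus)⟩
  rcases hτ with hne | ⟨heq, hder⟩
  · rcases hne.lt_or_gt with hlt | hgt
    · obtain ⟨δ, hδ, ε, hε, hD⟩ := exists_le_mul_of_neg (D := fun x => V₀ (x - τ) - V₀ (x + τ))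
        (by fun_prop) (by simp only [zero_sub, zero_add]; linarith)
      exact left δ hδ ε hε hD
    · obtain ⟨δ, hδ, ε, hε, hD⟩ := exists_le_mul_of_neg
        (D := fun x => V₀ (-(x - τ)) - V₀ (-(x + τ))) (by fun_prop) (by
          simp only [zero_sub, zero_add, neg_neg]; linarith)
      obtain ⟨lam₀, h0, h⟩ := exists_leftBlochCondition (V₀ := fun x => V₀ (-x)) (by fun_prop)
        (fun x => hC (-x)) hδ hε hD
      refine ⟨lam₀, h0, fun lam hlam κ pPlus _ hb => Or.inr ?_⟩
      have hR := hb.plus.comp_neg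
      rw [neg_neg] at hR
      exact leftBlochCondition_comp_neg.1 (h lam hlam κ _ hb.kappa_pos hR)
  · have hd : ∀ x, HasDerivAt V₀ (deriv V₀ x) x := fun x =>
      (hV.differentiable one_ne_zero x).hasDerivAt
    have h1 : HasDerivAt (fun x => V₀ (x - τ)) (deriv V₀ (-τ)) 0 := by
      have := HasDerivAt.comp_sub_const (0:ℝ) τ (hd (0 - τ))
      rwa [zero_sub] at this
    have h2 : HasDerivAt (fun x => V₀ (x + τ)) (deriv V₀ τ) 0 := by
      have := HasDerivAt.comp_add_const (0:ℝ) τ (hd (0 + τ))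
      rwa [zero_add] at this
    obtain ⟨δ, hδ, ε, hε, hD⟩ := exists_le_mul_of_hasDerivAt
      (D := fun x => V₀ (x - τ) - V₀ (x + τ)) (h1.sub h2)
      (by simp only [zero_sub, zero_add, heq, sub_self]) (by linarith)
    exact left δ hδ ε hε hD

/-- If V₀'(0) ≠ 0, then V₀(-t) - V₀(t) has derivative -2V₀'(0) at 0 and is nonzero nearby. If V₀'(0)
= 0, then V₀'(-t) - V₀'(t) has derivative -2V₀''(0), and the sign hypothesis makes it positive at τ,
whether or not the values at ±τ agree. -/
theorem exists_dislocationCondition {V₀ : ℝ → ℝ} (hV : ContDiff ℝ 1 V₀) :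
    ∃ τ₀ > (0 : ℝ), ∀ τ : ℝ, 0 < |τ| → |τ| < τ₀ →
      (deriv V₀ 0 ≠ 0 ∨
        (deriv V₀ 0 = 0 ∧ DifferentiableAt ℝ (deriv V₀) 0 ∧
          Real.sign τ * deriv (deriv V₀) 0 < 0)) →
      DislocationCondition V₀ τ := by
  have hd : ∀ x, HasDerivAt V₀ (deriv V₀ x) x := fun x =>
    (hV.differentiable one_ne_zero x).hasDerivAt
  by_cases h0 : deriv V₀ 0 = 0
  · by_cases h2 : DifferentiableAt ℝ (deriv V₀) 0 ∧ deriv (deriv V₀) 0 ≠ 0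
    · obtain ⟨hdiff, hne⟩ := h2
      set d := deriv (deriv V₀) 0 with hdd
      have hg : HasDerivAt (fun t => deriv V₀ (-t) - deriv V₀ t) (-d - d) 0 := by
        have h1 : HasDerivAt (fun t => deriv V₀ (-t)) (-d) 0 := by
          have h3 : HasDerivAt (deriv V₀) d (-0) := by rw [neg_zero]; exact hdiff.hasDerivAt
          exact (h3.scomp (0:ℝ) (hasDerivAt_neg 0)).congr_deriv (by simp)
        exact h1.sub hdiff.hasDerivAt
      -- An error of at most |d||τ| is affordable: the linear term -2dτ equals 2|d||τ|.
      have := hg.isLittleO.def (abs_pos.2 hne)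
      obtain ⟨τ₀, hτ₀, h⟩ := Metric.eventually_nhds_iff.1 this
      refine ⟨τ₀, hτ₀, fun τ hτ hττ hcase => ?_⟩
      obtain ⟨-, -, hs⟩ := hcase.resolve_left (by simp [h0])
      have hb := h (y := τ) (by rwa [Real.dist_eq, sub_zero])
      simp only [neg_zero, sub_self, sub_zero, smul_eq_mul, Real.norm_eq_abs] at hb
      have hτd : τ * d < 0 := by
        rcases (abs_pos.1 hτ).lt_or_gt with h | h
        · rw [Real.sign_of_neg h] at hs; nlinarith
        · rw [Real.sign_of_pos h] at hs; nlinarith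
      have hb1 := (abs_le.1 hb).1
      rw [← abs_mul, mul_comm d, abs_of_neg hτd] at hb1
      by_cases hV0 : V₀ (-τ) = V₀ τ
      · exact Or.inr ⟨hV0, by change _ < _; linarith⟩
      · exact Or.inl hV0
    -- An arbitrary radius: here neither alternative of the hypothesis can hold.
    · refine ⟨1, one_pos, fun τ _ _ hcase => ?_⟩
      obtain ⟨-, hdiff, hs⟩ := hcase.resolve_left (by simp [h0])
      refine absurd ⟨hdiff, fun hz => ?_⟩ h2
      rw [hz, mul_zero] at hs
      exact lt_irrefl _ hs
  · have hg : HasDerivAt (fun t => V₀ (-t) - V₀ t) (-deriv V₀ 0 - deriv V₀ 0) 0 := by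
      have h1 : HasDerivAt (fun t => V₀ (-t)) (-deriv V₀ 0) 0 := by
        have h3 : HasDerivAt V₀ (deriv V₀ 0) (-0) := by rw [neg_zero]; exact hd 0
        exact (h3.scomp (0:ℝ) (hasDerivAt_neg 0)).congr_deriv (by simp)
      exact h1.sub (hd 0)
    have hne : -deriv V₀ 0 - deriv V₀ 0 ≠ 0 := fun h => h0 (by linarith)
    have := hg.eventually_ne (c := 0) hne
    rw [eventually_nhdsWithin_iff] at this
    obtain ⟨τ₀, hτ₀, h⟩ := Metric.eventually_nhds_iff.1 this
    refine ⟨τ₀, hτ₀, fun τ hτ hττ _ => Or.inl ?_⟩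
    have := h (y := τ) (by rwa [Real.dist_eq, sub_zero]) (abs_pos.1 hτ)
    exact sub_ne_zero.1 this

theorem corollary6p1 (V₀ : ℝ → ℝ) (hV_meas : AEMeasurable V₀ volume)
    (hV_bdd : ∃ C, ∀ x, |V₀ x| ≤ C) (hV_per : Function.Periodic V₀ 1) :
    -- (a) existence of strong ground states under the Bloch mode conditions, and `c₁ = c₂`
    (∀ (Γ₀ : ℝ → ℝ) (p τ lam : ℝ), AEMeasurable Γ₀ volume → (∃ C, ∀ x, |Γ₀ x| ≤ C) →
      Function.Periodic Γ₀ 1 → 0 < essSup Γ₀ volume → 1 < p →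
      PosMinSpectrum (fun x => dislocation V₀ τ x - lam) →
        nehariLevel (fun x => V₀ (x + τ) - lam) (fun x => Γ₀ (x + τ)) p
          = nehariLevel (fun x => V₀ (x - τ) - lam) (fun x => Γ₀ (x - τ)) p ∧
        ∀ (κ : ℝ) (pPlus pMinus : ℝ → ℝ),
          IsBlochModePair (fun x => V₀ x - lam) κ pPlus pMinus →
          LeftBlochCondition V₀ τ κ pMinus ∨ RightBlochCondition V₀ τ κ pPlus →
          ∃ w, IsStrongGroundState (fun x => dislocation V₀ τ x - lam) (dislocation Γ₀ τ) p w) ∧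
    -- (b) pointwise conditions on a `C¹` potential
    (ContDiff ℝ 1 V₀ →
      (∀ τ : ℝ, DislocationCondition V₀ τ →
        ∃ lam₀ < (0 : ℝ), ∀ lam < lam₀,
          (∃ (κ : ℝ) (pPlus pMinus : ℝ → ℝ),
            IsBlochModePair (fun x => V₀ x - lam) κ pPlus pMinus) ∧
          ∀ (κ : ℝ) (pPlus pMinus : ℝ → ℝ),
            IsBlochModePair (fun x => V₀ x - lam) κ pPlus pMinus →
            LeftBlochCondition V₀ τ κ pMinus ∨ RightBlochCondition V₀ τ κ pPlus) ∧
      (∃ τ₀ > (0 : ℝ), ∀ τ : ℝ, 0 < |τ| → |τ| < τ₀ →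
        (deriv V₀ 0 ≠ 0 ∨
          (deriv V₀ 0 = 0 ∧ DifferentiableAt ℝ (deriv V₀) 0 ∧
            Real.sign τ * deriv (deriv V₀) 0 < 0)) →
        DislocationCondition V₀ τ)) := by
  obtain ⟨C, hC⟩ := hV_bdd
  refine ⟨fun Γ₀ p τ lam hΓ_meas hΓ_bdd hΓ_per hpos hp hspec => ?_, fun hV1 =>
    ⟨fun τ hτ => exists_blochModePair_and_condition hV1 hC hV_per hτ,
      exists_dislocationCondition hV1⟩⟩
  obtain ⟨D, hD⟩ := hΓ_bdd
  have hV : IsBoundedCoeff V₀ C := ⟨hV_meas.aestronglyMeasurable, hC⟩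
  have hΓ : IsBoundedCoeff Γ₀ D := ⟨hΓ_meas.aestronglyMeasurable, hD⟩
  refine ⟨?_, fun κ pPlus pMinus hbl hcond =>
    exists_isStrongGroundState_dislocation hV hΓ hV_per hΓ_per hp hpos hspec hbl hcond⟩
  -- Both levels are compared with that of the untranslated coefficients; coercivity plays no role
  -- here.
  have h1 := nehariLevel_comp_add hp (hV.sub_const lam) hΓ τ
  have h2 := nehariLevel_comp_add hp (hV.sub_const lam) hΓ (-τ)
  simp only [← sub_eq_add_neg] at h1 h2
  exact h1.trans h2.symm
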